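/- Let $d\ge 1$, $1/2\le H<1$, $0<\alpha\le 2$, $0<\beta<d$ and $T_0>0$. Let $X=\{X(t),t\ge 0\}$ be a symmetric Lévy process in $\mathbb R^d$ with generator $\mathscr L$ and characteristic exponent $\Psi$, i.e. $\mathbb E[e^{i\xi\cdot X(t)}]=e^{-t\Psi(\xi)}$, such that for $t>0$ the variable $X(t)$ has the probability density $p_t(x)=(2\pi)^{-d}\int_{\mathbb R^d}e^{-i\xi\cdot x}e^{-t\Psi(\xi)}\,d\xi$. Let $h:\mathbb R^d\to\mathbb R$ be measurable. Suppose that there are positive finite constants $c_\Psi,C_\Psi,c_h,C_h$ with $$c_\Psi|\xi|^\alpha\le\Psi(\xi)\le C_\Psi|\xi|^\alpha\quad(\xi\in\mathbb R^d),\qquad c_h|\xi|^{-\beta}\le h(\xi)\le C_h|\xi|^{-\beta}\quad(\xi\ne 0).$$ Let $\dot W$ be a fractional-colored centered Gaussian noise on $(0,T_0)\times\mathbb R^d$ with $\mathbb E[\dot W(t,x)\dot W(s,y)]=\rho_H(t-s)f(x-y)$, where $\rho_H(t)=H(2H-1)|t|^{2H-2}$ if $H>1/2$, $\rho_{1/2}=\delta$,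 and $f$ is the Fourier transform of the tempered measure $\mu(d\xi)=h(\xi)\,d\xi$. That is, $W$ is a linear centered Gaussian family indexed by $\varphi\in C_c^\infty((0,T_0)\times\mathbb R^d)$ with $$\mathbb E[W(\varphi)W(\psi)]=\langle\varphi,\psi\rangle:=\int_0^{T_0}\!\!\int_0^{T_0}\rho_H(s-r)\,(2\pi)^{-d}\!\int_{\mathbb R^d}\hat\varphi(s,\xi)\,\overline{\hat\psi(r,\xi)}\,\mu(d\xi)\,ds\,dr,\qquad \hat\varphi(s,\xi)=\int_{\mathbb R^d}e^{-i\xi\cdot y}\varphi(s,y)\,dy,$$ and $W$ is extended by $L^2$-isometry to the functions that are limits of test functions in the norm of this inner product. Put $$\theta_1=H-\frac{d-\beta}{2\alpha},\qquad \theta_2=\alpha\theta_1,$$ and suppose $\theta_1>0$ and $\theta_2<1$. Let $u$ be the random field solution on $[0,T_0]\times\mathbb R^d$ of $$\frac{\partial}{\partial t}u(t,x)=\mathscr Lu(t,x)+\dot W(t,x),\quad u(0,x)=0,\qquad\text{i.e.}\qquad u(t,x)=\int_0^t\int_{\mathbb R^d}p_{t-s}(x-y)\,W(ds,dy).$$ Let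 $T$ be a compact rectangle in $(0,T_0]\times\mathbb R^d$ (here $T_0>0$ is arbitrary), and let $\Delta((t,x),(s,y))=|t-s|^{\theta_1}+\sum_{j=1}^d|x_j-y_j|^{\theta_2}$. Then there is a constant $c_2>0$ such that for every $n\ge1$ and all $(t,x),(t^1,x^1),\dots,(t^n,x^n)\in T$, almost surely, $$\mathrm{Var}\big(u(t,x)\,\big|\,u(t^1,x^1),\dots,u(t^n,x^n)\big)\ge c_2\min_{1\le j\le n}\Delta^2\big((t,x),(t^j,x^j)\big),$$ and, with the same constant, $\|u(t,x)-u(s,y)\|_{L^2}\ge\sqrt{c_2}\,\Delta((t,x),(s,y))$ for all $(t,x),(s,y)\in T$. -/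

import Mathlib

open MeasureTheory ProbabilityTheory Filter Topology
open scoped NNReal ENNReal Distributions

noncomputable section

namespace FractionalColored

/-- The spatial domain `ℝ^d` with its Euclidean norm. -/
abbrev Space (d : ℕ) := EuclideanSpace ℝ (Fin d)

/-! ### The Lévy process and its transition density -/

/-- `X` is a symmetric Lévy process on `ℝ^d` under `P`: it starts at `0`, has independent and
stationary increments, is stochastically continuous, and `-X t` has the same law as `X t`. -/
structure IsSymmetricLevyProcess {d : ℕ} {Ω : Type*} [MeasurableSpace Ω] (P : Measure Ω)
    (X : ℝ≥0 → Ω → Space d) : Prop where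
  measurable : ∀ t, Measurable (X t)
  start : ∀ᵐ ω ∂P, X 0 ω = 0
  indep_increments : HasIndepIncrements X P
  stationary_increments : ∀ s t, P.map (fun ω => X (s + t) ω - X s ω) = P.map (X t)
  stoch_continuous : ∀ t, TendstoInMeasure P X (𝓝 t) (X t)
  symmetric : ∀ t, P.map (fun ω => -X t ω) = P.map (X t)

/-- `Ψ` is the characteristic exponent of `X`: `E exp(i ξ·X(t)) = exp(-t Ψ(ξ))`. -/
def IsCharacteristicExponent {d : ℕ} {Ω : Type*} [MeasurableSpace Ω] (P : Measure Ω)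
    (X : ℝ≥0 → Ω → Space d) (Ψ : Space d → ℝ) : Prop :=
  ∀ (t : ℝ≥0) (ξ : Space d), charFun (P.map (X t)) ξ = Complex.exp (-(t : ℂ) * (Ψ ξ : ℂ))

/-- `p_t(x) = (2π)^{-d} ∫ exp(-i ξ·x) exp(-t Ψ(ξ)) dξ`. -/
def transitionDensity {d : ℕ} (Ψ : Space d → ℝ) (t : ℝ) (x : Space d) : ℝ :=
  (((2 * Real.pi : ℝ) : ℂ) ^ (-(d : ℤ)) *
    ∫ ξ : Space d, Complex.exp (-Complex.I * (inner ℝ ξ x : ℝ)) *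
      Complex.exp (-(t : ℂ) * (Ψ ξ : ℂ))).re

/-- For each `t > 0` the function `p_t` is a probability density function of `X t`. -/
def HasTransitionDensity {d : ℕ} {Ω : Type*} [MeasurableSpace Ω] (P : Measure Ω)
    (X : ℝ≥0 → Ω → Space d) (Ψ : Space d → ℝ) : Prop :=
  ∀ t : ℝ≥0, 0 < t →
    P.map (X t) = volume.withDensity (fun x => ENNReal.ofReal (transitionDensity Ψ t x))

/-! ### The inner product of the noise -/

/-- The measure `ρ_H(s - r) ds dr` on `[0,T₀] × [0,T₀]`, where
`ρ_H(s - r) = H(2H-1)|s - r|^{2H-2}` for `1/2 < H < 1` and `ρ_{1/2} = δ` is the delta function,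
so that for `H = 1/2` the measure is Lebesgue measure on the diagonal. -/
def timeCovariance (H T₀ : ℝ) : Measure (ℝ × ℝ) :=
  if H = 1 / 2 then
    (volume.restrict (Set.Icc 0 T₀)).map (fun s => (s, s))
  else
    ((volume.restrict (Set.Icc 0 T₀)).prod (volume.restrict (Set.Icc 0 T₀))).withDensity
      (fun p => ENNReal.ofReal (H * (2 * H - 1) * |p.1 - p.2| ^ (2 * H - 2)))

/-- The spectral measure `μ(dξ) = h(ξ) dξ`. -/
def spectralMeasure {d : ℕ} (h : Space d → ℝ) : Measure (Space d) :=
  volume.withDensity (fun ξ => ENNReal.ofReal (h ξ))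

/-- The Fourier transform in the space variable at time `s`,
`∫ exp(-i ξ·y) φ(s, y) dy`. -/
def spaceFourier {d : ℕ} (φ : ℝ × Space d → ℝ) (s : ℝ) (ξ : Space d) : ℂ :=
  ∫ y : Space d, Complex.exp (-Complex.I * (inner ℝ ξ y : ℝ)) * (φ (s, y) : ℂ)

/-- The function `((s, r), ξ) ↦ φ^(s, ξ) conj(ψ^(r, ξ))`. -/
def hpIntegrand {d : ℕ} (φ ψ : ℝ × Space d → ℝ) (q : (ℝ × ℝ) × Space d) : ℂ :=
  spaceFourier φ q.1.1 q.2 * (starRingEnd ℂ) (spaceFourier ψ q.1.2 q.2)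

/-- The inner product
`⟨φ, ψ⟩ = ∫∫ ds dr ρ_H(s - r) ∫∫ dy dz φ(s, y) f(y - z) ψ(r, z)`,
where `f` is the (tempered distributional) Fourier transform of the spectral measure `μ`. Since `f`
need not be a function, the space integral is defined, as usual, through `μ`:
`∫∫ φ(s, y) f(y - z) ψ(r, z) dy dz = (2π)^{-d} ∫ φ^(s, ξ) conj(ψ^(r, ξ)) μ(dξ)`. -/
def hpInner {d : ℕ} (H T₀ : ℝ) (h : Space d → ℝ) (φ ψ : ℝ × Space d → ℝ) : ℂ :=
  ((2 * Real.pi : ℝ) : ℂ) ^ (-(d : ℤ)) *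
    ∫ q, hpIntegrand φ ψ q ∂((timeCovariance H T₀).prod (spectralMeasure h))

/-- The inner product `⟨φ, φ⟩` is an absolutely convergent integral. -/
def HPFinite {d : ℕ} (H T₀ : ℝ) (h : Space d → ℝ) (φ : ℝ × Space d → ℝ) : Prop :=
  Integrable (hpIntegrand φ φ) ((timeCovariance H T₀).prod (spectralMeasure h))

/-! ### The noise, the Wiener integral and the solution -/

/-- The open set `(0, T₀) × ℝ^d`. -/
def openSlab (d : ℕ) (T₀ : ℝ) : TopologicalSpace.Opens (ℝ × Space d) :=
  ⟨Set.Ioo 0 T₀ ×ˢ Set.univ, isOpen_Ioo.prod isOpen_univ⟩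

/-- `W` is a fractional-colored Gaussian noise on `(0, T₀) × ℝ^d` with Hurst index `H` and spatial
spectral density `h`: a centered Gaussian family indexed by `C_c^∞((0, T₀) × ℝ^d)`, linear in the
test function, with covariance `⟨φ, ψ⟩`. -/
structure IsFractionalColoredNoise {d : ℕ} {Ω : Type*} [MeasurableSpace Ω] (Q : Measure Ω)
    (H T₀ : ℝ) (h : Space d → ℝ) (W : 𝓓(openSlab d T₀, ℝ) → Ω → ℝ) : Prop where
  gaussian : IsGaussianProcess W Q
  centered : ∀ φ, ∫ ω, W φ ω ∂Q = 0
  linear : ∀ (a b : ℝ) (φ ψ : 𝓓(openSlab d T₀, ℝ)),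
    W (a • φ + b • ψ) =ᵐ[Q] fun ω => a * W φ ω + b * W ψ ω
  covariance : ∀ φ ψ : 𝓓(openSlab d T₀, ℝ),
    ((∫ ω, W φ ω * W ψ ω ∂Q : ℝ) : ℂ) = hpInner H T₀ h φ ψ

/-- `Y = ∫_0^{T₀} ∫_{ℝ^d} g(s, y) W(ds, dy)`: the function `g` is a limit of test functions in the
norm of the Hilbert space completion, and `Y` is the `L²` limit of `W` along them. -/
def IsWienerIntegral {d : ℕ} {Ω : Type*} [MeasurableSpace Ω] (Q : Measure Ω)
    (H T₀ : ℝ) (h : Space d → ℝ) (W : 𝓓(openSlab d T₀, ℝ) → Ω → ℝ)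
    (g : ℝ × Space d → ℝ) (Y : Ω → ℝ) : Prop :=
  MemLp Y 2 Q ∧ ∃ φ : ℕ → 𝓓(openSlab d T₀, ℝ),
    (∀ k, HPFinite H T₀ h (fun z => φ k z - g z)) ∧
    Tendsto (fun k => hpInner H T₀ h (fun z => φ k z - g z) (fun z => φ k z - g z))
      atTop (𝓝 0) ∧
    Tendsto (fun k => eLpNorm (fun ω => W (φ k) ω - Y ω) 2 Q) atTop (𝓝 0)

/-- `G_{t,x}(s, y) = p_{t-s}(x - y) 1_{[0,t]}(s)`. -/
def greenKernel {d : ℕ} (Ψ : Space d → ℝ) (t : ℝ) (x : Space d) (z : ℝ × Space d) : ℝ :=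
  (Set.Icc 0 t).indicator (fun s => transitionDensity Ψ (t - s) (x - z.2)) z.1

/-- `u` is the random field solution on `[0, T₀] × ℝ^d` of `∂u/∂t = 𝓛 u + Ẇ`, `u(0, ·) = 0`, where
`𝓛` generates the Lévy process with exponent `Ψ`:
`u(t, x) = ∫_0^t ∫_{ℝ^d} p_{t-s}(x - y) W(ds, dy)`. -/
structure IsRandomFieldSolution {d : ℕ} {Ω : Type*} [MeasurableSpace Ω] (Q : Measure Ω)
    (H T₀ : ℝ) (h Ψ : Space d → ℝ) (W : 𝓓(openSlab d T₀, ℝ) → Ω → ℝ)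
    (u : ℝ × Space d → Ω → ℝ) : Prop where
  measurable : ∀ t ∈ Set.Icc 0 T₀, ∀ x, Measurable (u (t, x))
  wiener : ∀ t ∈ Set.Icc 0 T₀, ∀ x,
    IsWienerIntegral Q H T₀ h W (greenKernel Ψ t x) (u (t, x))

/-! ### Exponents, metric, rectangles -/

/-- `θ₁ = H - (d - β) / (2α)`. -/
def theta₁ (d : ℕ) (H α β : ℝ) : ℝ := H - (d - β) / (2 * α)

/-- `θ₂ = α θ₁`. -/
def theta₂ (d : ℕ) (H α β : ℝ) : ℝ := α * theta₁ d H α β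

/-- `Δ((t, x), (s, y)) = |t - s|^{θ₁} + ∑_j |x_j - y_j|^{θ₂}`. -/
def Delta {d : ℕ} (θ₁ θ₂ : ℝ) (p q : ℝ × Space d) : ℝ :=
  |p.1 - q.1| ^ θ₁ + ∑ j, |p.2 j - q.2 j| ^ θ₂

/-- The rectangle `[a, a'] × ∏_j [b_j, b'_j]`. -/
def rectangle {d : ℕ} (a a' : ℝ) (b b' : Fin d → ℝ) : Set (ℝ × Space d) :=
  {p | p.1 ∈ Set.Icc a a' ∧ ∀ j, p.2 j ∈ Set.Icc (b j) (b' j)}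

end FractionalColored

end

noncomputable section

namespace FractionalColored

/-! The variance is bounded below by duality. Each `u (t', x')` is the Wiener integral of a Green
kernel whose spatial Fourier transform is `exp(-iξ·x') exp(-(t'-s)Ψ(ξ))` for `0 ≤ s < t'`. Fix a
point `(t, x)` and scales `ε = δ^α` in time and `δ` in space. Symbols `F(s, ξ)` are paired with
`(κ'(s) + Ψ(ξ)κ(s)) q(δξ) exp(iξ·x)`, where `κ` is a bump near `t` and `q` is the Fourier transform
of a bump. Since `exp(-(t'-s)Ψ)(κ' + Ψκ)` is the `s`-derivative of `exp(-(t'-s)Ψ)κ`, the pairing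
with the Green symbol of `(t', x')` collapses to `κ(t') δ^{-d}` times a bump in `(x - x')/δ`
(`pairing_greenSymbol`). This is at least `ε² δ^{-d}/2` at `(t, x)` and zero at points far away in
`Δ`. So the pairing sees only `u(t, x)` in `u(t, x) - ∑ w_j u(q_j)`, whatever the weights are.

The pairing is also bounded in the norm of the noise: its square is at most `K ε^{4-2H} δ^{-β-d}`
times the energy of `F` (`exists_pairing_bound`). Dividing, the prediction error is at least a
constant times `δ^{2θ₂}`, and `δ^{θ₂}` may be chosen proportional to the distance `r` from `(t, x)`
to the other points (`exists_le_integral_prediction_error`).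

The bound in time rests on writing `|s-r|^{2H-2}` as a superposition over `ℓ` of `(ℓ - |s-r|)₊
ℓ^{2H-4}`. The energy becomes an integral of squared integrals of `F` over windows `[v, v+ℓ]`, and
keeping only `ε ≤ ℓ ≤ 2ε` bounds it below (`exists_energy_lower_bound`). The bump `κ` is an average
over exactly these windows, so Cauchy–Schwarz applies without any Fourier analysis in time, and the
truncation to `[0, T₀]` is harmless.

Finally, for centered Gaussian variables the conditional variance is the squared `L²` distance to
the linear span of the observations (`le_condVar_of_gaussian`). -/

theorem sq_lintegral_mul_le {X : Type*} [MeasurableSpace X] (μ : Measure X) {f g : X → ℝ≥0∞}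
    (hf : AEMeasurable f μ) (hg : AEMeasurable g μ) :
    (∫⁻ x, f x * g x ∂μ) ^ 2 ≤ (∫⁻ x, f x ^ 2 ∂μ) * ∫⁻ x, g x ^ 2 ∂μ := by
  have h2 : (2 : ℝ).HolderConjugate 2 := Real.HolderConjugate.two_two
  have key := ENNReal.lintegral_mul_le_Lp_mul_Lq μ h2 hf hg
  calc (∫⁻ x, f x * g x ∂μ) ^ 2
      ≤ ((∫⁻ x, f x ^ (2 : ℝ) ∂μ) ^ (1 / (2 : ℝ)) * (∫⁻ x, g x ^ (2 : ℝ) ∂μ) ^ (1 / (2 : ℝ))) ^ 2 := by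
        gcongr
        exact key
    _ = (∫⁻ x, f x ^ 2 ∂μ) * ∫⁻ x, g x ^ 2 ∂μ := by
        rw [mul_pow, ← ENNReal.rpow_natCast, ← ENNReal.rpow_mul, ← ENNReal.rpow_natCast,
          ← ENNReal.rpow_mul]
        norm_num

/-! ### The time covariance as a superposition of windows -/

/-- The interval `[v, v + ℓ]` attached to the pair `(ℓ, v)`. -/
def window (z : ℝ × ℝ) : Set ℝ := Set.Icc z.2 (z.2 + z.1)

/-- The measure `ℓ^{2H-4} dℓ dv` on `(0, ∞) × ℝ`. -/
def scaleMeasure (H : ℝ) : Measure (ℝ × ℝ) :=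
  ((volume.restrict (Set.Ioi 0)).withDensity fun l : ℝ => ENNReal.ofReal (l ^ (2 * H - 4))).prod
    volume

instance (H : ℝ) : SFinite (scaleMeasure H) := by
  unfold scaleMeasure; infer_instance

/-- Pairs of a window and two points in it. -/
def windowPairs : Set ((ℝ × ℝ) × (ℝ × ℝ)) := {p | p.2.1 ∈ window p.1 ∧ p.2.2 ∈ window p.1}

theorem measurableSet_windowPairs : MeasurableSet windowPairs := by
  have : windowPairs = {p : (ℝ × ℝ) × (ℝ × ℝ) | (p.1.2 ≤ p.2.1 ∧ p.2.1 ≤ p.1.2 + p.1.1) ∧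
      (p.1.2 ≤ p.2.2 ∧ p.2.2 ≤ p.1.2 + p.1.1)} := rfl
  rw [this]
  measurability

/-- For `x = |s - r|`, the factor `ENNReal.ofReal (l - x)` is the length of the set of left
endpoints of windows of length `l` containing both `s` and `r`; integrating over `l` rebuilds the
fractional kernel. Both exponents `2H - 3` and `2H - 4` lie below `-1`, so the two tails converge
separately. -/
theorem lintegral_rpow_mul_sub {H x : ℝ} (hH1 : H < 1) (hx : 0 < x) :
    ∫⁻ l in Set.Ioi (0 : ℝ), ENNReal.ofReal (l ^ (2 * H - 4)) * ENNReal.ofReal (l - x) =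
      ENNReal.ofReal (x ^ (2 * H - 2) / ((2 - 2 * H) * (3 - 2 * H))) := by
  have hsub : Set.Ioi x ⊆ Set.Ioi (0 : ℝ) := Set.Ioi_subset_Ioi hx.le
  have i1 : IntegrableOn (fun l : ℝ => l ^ (2 * H - 3)) (Set.Ioi x) :=
    integrableOn_Ioi_rpow_of_lt (by linarith) hx
  have i2 : IntegrableOn (fun l : ℝ => x * l ^ (2 * H - 4)) (Set.Ioi x) :=
    (integrableOn_Ioi_rpow_of_lt (by linarith) hx).const_mul x
  have e1 : ∫⁻ l in Set.Ioi (0 : ℝ), ENNReal.ofReal (l ^ (2 * H - 4)) * ENNReal.ofReal (l - x) =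
      ∫⁻ l in Set.Ioi x, ENNReal.ofReal (l ^ (2 * H - 3) - x * l ^ (2 * H - 4)) := by
    rw [← lintegral_indicator measurableSet_Ioi, ← lintegral_indicator measurableSet_Ioi]
    refine lintegral_congr fun l => ?_
    by_cases hl : x < l
    · have hl0 : 0 < l := hx.trans hl
      rw [Set.indicator_of_mem (by exact hl0), Set.indicator_of_mem (by exact hl),
        ← ENNReal.ofReal_mul (Real.rpow_nonneg hl0.le _)]
      congr 1
      rw [show 2 * H - 3 = (2 * H - 4) + 1 by ring, Real.rpow_add_one hl0.ne']
      ring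
    · rw [Set.indicator_of_notMem (by simpa using hl) (f := fun l : ℝ => ENNReal.ofReal (l ^ (2 * H - 3) - x * l ^ (2 * H - 4)))]
      have : ENNReal.ofReal (l - x) = 0 := ENNReal.ofReal_of_nonpos (by linarith [not_lt.1 hl])
      simp [Set.indicator_apply, this]
  rw [e1]
  erw [← ofReal_integral_eq_lintegral_ofReal (i1.sub i2)]
  erw [integral_sub i1 i2]
  rw [
    integral_const_mul, integral_Ioi_rpow_of_lt (by linarith) hx,
    integral_Ioi_rpow_of_lt (by linarith) hx]
  · congr 1
    have a1 : 2 * H - 3 + 1 = 2 * H - 2 := by ring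
    have a2 : x ^ (2 * H - 2) = x ^ (2 * H - 4 + 1) * x := by
      rw [← Real.rpow_add_one hx.ne']; ring_nf
    rw [a1, a2]
    obtain ⟨y, hy⟩ : ∃ y, y = 2 - 2 * H := ⟨_, rfl⟩
    have b3 : y ≠ 0 := by linarith
    have b4 : y + 1 ≠ 0 := by linarith
    rw [show 2 * H - 4 + 1 = -(y + 1) by linarith, show 2 * H - 2 = -y by linarith,
      show 3 - 2 * H = y + 1 by linarith, ← hy]
    field_simp
    ring
  · refine (ae_restrict_mem measurableSet_Ioi).mono fun l hl => ?_
    have hl0 : 0 < l := hsub hl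
    have : l ^ (2 * H - 3) = l * l ^ (2 * H - 4) := by
      rw [show 2 * H - 3 = (2 * H - 4) + 1 by ring, Real.rpow_add_one hl0.ne']; ring
    simp only [Pi.zero_apply, Pi.sub_apply, this, ← sub_mul]
    exact mul_nonneg (sub_nonneg.2 (le_of_lt hl)) (Real.rpow_nonneg hl0.le _)

theorem scaleMeasure_section {H s r : ℝ} (hH1 : H < 1) (hsr : s ≠ r) :
    scaleMeasure H ((fun z => (z, (s, r))) ⁻¹' windowPairs) =
      ENNReal.ofReal (|s - r| ^ (2 * H - 2) / ((2 - 2 * H) * (3 - 2 * H))) := by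
  have hm : MeasurableSet ((fun z : ℝ × ℝ => (z, (s, r))) ⁻¹' windowPairs) :=
    measurableSet_windowPairs.preimage (by fun_prop)
  rw [scaleMeasure, Measure.prod_apply hm, ← lintegral_rpow_mul_sub hH1 (abs_pos.2 (sub_ne_zero.2 hsr)),
    lintegral_withDensity_eq_lintegral_mul₀ (by fun_prop) (measurable_measure_prodMk_left hm).aemeasurable]
  refine lintegral_congr fun l => ?_
  have : Prod.mk l ⁻¹' ((fun z : ℝ × ℝ => (z, (s, r))) ⁻¹' windowPairs) =
      Set.Icc (max s r - l) (min s r) := by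
    ext v
    simp only [windowPairs, window, Set.mem_preimage, Set.mem_ofPred_eq, Set.mem_Icc,
      tsub_le_iff_right, max_le_iff, le_min_iff]
    tauto
  simp only [Pi.mul_apply, this, Real.volume_Icc]
  congr 2
  rcases le_total s r with h | h
  · rw [max_eq_right h, min_eq_left h, abs_of_nonpos (by linarith)]; ring
  · rw [max_eq_left h, min_eq_right h, abs_of_nonneg (by linarith)]; ring

/-- Tonelli on triples (window, `s`, `r`): the windows containing both points have mass proportional
to `|s - r|^{2H-2}`, and the prefactor restores the normalization of `ρ_H`. -/
theorem timeCovariance_eq_map {H : ℝ} (hH : 1 / 2 < H) (hH1 : H < 1) (T₀ : ℝ) :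
    timeCovariance H T₀ =
      ENNReal.ofReal (H * (2 * H - 1) * ((2 - 2 * H) * (3 - 2 * H))) •
        (((scaleMeasure H).prod ((volume.restrict (Set.Icc 0 T₀)).prod
          (volume.restrict (Set.Icc 0 T₀)))).restrict windowPairs).map Prod.snd := by
  have hc : 0 ≤ H * (2 * H - 1) * ((2 - 2 * H) * (3 - 2 * H)) := by
    have h1 : 0 < 2 * H - 1 := by linarith
    have h2 : 0 < 2 - 2 * H := by linarith
    have h3 : 0 < 3 - 2 * H := by linarith
    have h4 : 0 < H := by linarith
    positivity
  ext A hA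
  rw [timeCovariance, if_neg hH.ne', withDensity_apply _ hA, Measure.smul_apply,
    Measure.map_apply measurable_snd hA, Measure.restrict_apply (measurable_snd hA),
    Measure.prod_apply_symm ((measurable_snd hA).inter measurableSet_windowPairs), smul_eq_mul,
    ← lintegral_const_mul _ (measurable_measure_prodMk_right
      ((measurable_snd hA).inter measurableSet_windowPairs)), ← lintegral_indicator hA]
  -- The diagonal must be discarded: there the windows have infinite mass, while `0 ^ (2H - 2)`
  -- evaluates to `0`.
  have hd : ∀ᵐ p : ℝ × ℝ ∂((volume.restrict (Set.Icc 0 T₀)).prod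
          (volume.restrict (Set.Icc 0 T₀))), p.1 ≠ p.2 := by
    refine (Measure.ae_prod_iff_ae_ae (p := fun p : ℝ × ℝ => p.1 ≠ p.2)
      (measurableSet_eq_fun measurable_fst measurable_snd).compl).2 ?_
    refine Eventually.of_forall fun s => ?_
    simp only [ne_eq]
    refine (ae_iff.2 ?_)
    simp
  refine lintegral_congr_ae (hd.mono fun p hp => ?_)
  by_cases hpA : p ∈ A
  · have : (fun x => (x, p)) ⁻¹' (Prod.snd ⁻¹' A ∩ windowPairs) =
        (fun z : ℝ × ℝ => (z, (p.1, p.2))) ⁻¹' windowPairs := by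
      ext z; simp [hpA]
    simp only [this, Set.indicator_of_mem hpA]
    rw [scaleMeasure_section hH1 hp, ← ENNReal.ofReal_mul hc]
    congr 1
    have b5 : (2 - 2 * H) * (3 - 2 * H) ≠ 0 :=
      mul_ne_zero (by linarith) (by linarith)
    rw [mul_assoc (H * (2 * H - 1)) ((2 - 2 * H) * (3 - 2 * H)), mul_div_cancel₀ _ b5]
  · have : (fun x => (x, p)) ⁻¹' (Prod.snd ⁻¹' A ∩ windowPairs) = (∅ : Set (ℝ × ℝ)) := by
      ext z; simp [hpA]
    simp only [this, Set.indicator_of_notMem hpA]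
    simp

/-- The integral of `F` over the part of a window lying in `[0, T₀]`. -/
def windowIntegral (T₀ : ℝ) (F : ℝ → ℂ) (z : ℝ × ℝ) : ℂ :=
  ∫ s in Set.Icc 0 T₀, (window z).indicator F s

/-- The quadratic form of the time covariance. -/
def energy (H T₀ : ℝ) (F : ℝ → ℂ) : ℂ :=
  ∫ p, F p.1 * (starRingEnd ℂ) (F p.2) ∂(timeCovariance H T₀)

/-- Lebesgue measure on `[ε, 2ε] × ℝ`. -/
def scaleStrip (ε : ℝ) : Measure (ℝ × ℝ) := (volume.restrict (Set.Icc ε (2 * ε))).prod volume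

instance (ε : ℝ) : SFinite (scaleStrip ε) := by
  unfold scaleStrip; infer_instance

theorem measurableSet_mem_window : MeasurableSet {p : (ℝ × ℝ) × ℝ | p.2 ∈ window p.1} := by
  have : {p : (ℝ × ℝ) × ℝ | p.2 ∈ window p.1} =
    {p : (ℝ × ℝ) × ℝ | p.1.2 ≤ p.2 ∧ p.2 ≤ p.1.2 + p.1.1} := rfl
  rw [this]
  measurability

theorem measurable_window_indicator {F : ℝ → ℂ} (hF : Measurable F) :
    Measurable fun p : (ℝ × ℝ) × ℝ => (window p.1).indicator F p.2 := by
  have : (fun p : (ℝ × ℝ) × ℝ => (window p.1).indicator F p.2) =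
      {p : (ℝ × ℝ) × ℝ | p.2 ∈ window p.1}.indicator fun p => F p.2 := by
    ext p
    by_cases h : p.2 ∈ window p.1 <;> simp [h]
  rw [this]
  exact (hF.comp measurable_snd).indicator measurableSet_mem_window

theorem measurable_windowIntegral (T₀ : ℝ) {F : ℝ → ℂ} (hF : Measurable F) :
    Measurable (windowIntegral T₀ F) :=
  ((measurable_window_indicator hF).stronglyMeasurable.integral_prod_right
    (ν := volume.restrict (Set.Icc 0 T₀))).measurable

/-- The two points range independently over the same window, so the double integral factors into a
number times its conjugate. This is where positivity of the covariance becomes visible. -/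
theorem integral_window_pairs (T₀ : ℝ) (F : ℝ → ℂ) (z : ℝ × ℝ) :
    ∫ y, windowPairs.indicator (fun p : (ℝ × ℝ) × (ℝ × ℝ) => F p.2.1 * (starRingEnd ℂ) (F p.2.2))
      (z, y) ∂((volume.restrict (Set.Icc 0 T₀)).prod (volume.restrict (Set.Icc 0 T₀))) =
      ((‖windowIntegral T₀ F z‖ ^ 2 : ℝ) : ℂ) := by
  have : ∀ y : ℝ × ℝ, windowPairs.indicator
      (fun p : (ℝ × ℝ) × (ℝ × ℝ) => F p.2.1 * (starRingEnd ℂ) (F p.2.2)) (z, y) =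
      (window z).indicator F y.1 * (starRingEnd ℂ) ((window z).indicator F y.2) := by
    intro y
    by_cases h1 : y.1 ∈ window z <;> by_cases h2 : y.2 ∈ window z <;>
      simp [windowPairs, h1, h2]
  simp_rw [this]
  rw [integral_prod_mul (f := fun s => (window z).indicator F s)
    (g := fun s => (starRingEnd ℂ) ((window z).indicator F s)), integral_conj]
  rw [RCLike.mul_conj]
  simp [windowIntegral]

/-- Fubini turns the quadratic form into an integral of squares, which can then be bounded below by
its part over any chosen range of window lengths. -/
theorem energy_eq_integral_window {H T₀ : ℝ} (hH : 1 / 2 < H) (hH1 : H < 1) {F : ℝ → ℂ}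
    (hF : Measurable F)
    (hint : Integrable (fun p : ℝ × ℝ => F p.1 * (starRingEnd ℂ) (F p.2)) (timeCovariance H T₀)) :
    Integrable (fun z => ‖windowIntegral T₀ F z‖ ^ 2) (scaleMeasure H) ∧
    energy H T₀ F = ((H * (2 * H - 1) * ((2 - 2 * H) * (3 - 2 * H)) *
      ∫ z, ‖windowIntegral T₀ F z‖ ^ 2 ∂(scaleMeasure H) : ℝ) : ℂ) := by
  have hc : 0 < H * (2 * H - 1) * ((2 - 2 * H) * (3 - 2 * H)) := by
    have h1 : 0 < 2 * H - 1 := by linarith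
    have h2 : 0 < 2 - 2 * H := by linarith
    have h3 : 0 < 3 - 2 * H := by linarith
    have h4 : 0 < H := by linarith
    positivity
  have hg : Measurable fun p : ℝ × ℝ => F p.1 * (starRingEnd ℂ) (F p.2) :=
    (hF.comp measurable_fst).mul (Complex.continuous_conj.measurable.comp (hF.comp measurable_snd))
  rw [timeCovariance_eq_map hH hH1, integrable_smul_measure (by simpa using hc) (by simp),
    integrable_map_measure hg.aestronglyMeasurable measurable_snd.aemeasurable,
    ← IntegrableOn, ← integrable_indicator_iff measurableSet_windowPairs] at hint
  have hint' := hint.integral_prod_left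
  rw [energy, timeCovariance_eq_map hH hH1, integral_smul_measure,
    integral_map measurable_snd.aemeasurable hg.aestronglyMeasurable,
    ← integral_indicator measurableSet_windowPairs]
  have hi2 : Integrable (fun z => ((‖windowIntegral T₀ F z‖ ^ 2 : ℝ) : ℂ)) (scaleMeasure H) := by
    refine hint'.congr (Eventually.of_forall fun z => ?_)
    exact integral_window_pairs T₀ F z
  refine ⟨hi2.re, ?_⟩
  erw [integral_prod _ hint]
  erw [integral_congr_ae (Eventually.of_forall (integral_window_pairs T₀ F))]
  rw [
    integral_complex_ofReal, ENNReal.toReal_ofReal hc.le, Complex.real_smul,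
    ← Complex.ofReal_mul]

/-- The exponent `2H - 4` is negative, so for `ε ≤ ℓ ≤ 2ε` the density is at least `(2ε)^{2H-4}`. -/
theorem lintegral_scaleStrip_le (H : ℝ) (hH1 : H < 1) {ε : ℝ} (hε : 0 < ε) {f : ℝ × ℝ → ℝ≥0∞}
    (hf : Measurable f) :
    ∫⁻ z, f z ∂(scaleStrip ε) ≤
      ENNReal.ofReal ((2 * ε) ^ (4 - 2 * H)) * ∫⁻ z, f z ∂(scaleMeasure H) := by
  rw [scaleStrip, scaleMeasure, lintegral_prod _ hf.aemeasurable, lintegral_prod _ hf.aemeasurable,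
    lintegral_withDensity_eq_lintegral_mul₀ (by fun_prop) hf.lintegral_prod_right'.aemeasurable,
    ← lintegral_const_mul' _ _ ENNReal.ofReal_ne_top]
  have hsub : Set.Icc ε (2 * ε) ⊆ Set.Ioi 0 := fun x hx => lt_of_lt_of_le hε hx.1
  refine le_trans ?_ (lintegral_mono_set hsub)
  refine setLIntegral_mono' measurableSet_Icc fun l hl => ?_
  have hl0 : 0 < l := hsub hl
  simp only [Pi.mul_apply]
  rw [← mul_assoc, ← ENNReal.ofReal_mul (by positivity)]
  refine le_mul_of_one_le_left (by simp) ?_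
  rw [ENNReal.one_le_ofReal, show 2 * H - 4 = -(4 - 2 * H) by ring, Real.rpow_neg hl0.le,
    ← div_eq_mul_inv, one_le_div (by positivity)]
  exact Real.rpow_le_rpow hl0.le hl.2 (by linarith)

/-- This replaces the window formula for white noise in time. Cauchy–Schwarz on a window gives its
length, at most `2ε`; the pairs `(ℓ, v)` whose window contains a given `s` have measure at most `2ε
· ε`. The product is `4ε³`. -/
theorem lintegral_windowIntegral_sq_le (T₀ : ℝ) {F : ℝ → ℂ} (hF : Measurable F) {ε : ℝ}
    (hε : 0 < ε) :
    ∫⁻ z, ‖windowIntegral T₀ F z‖ₑ ^ 2 ∂(scaleStrip ε) ≤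
      ENNReal.ofReal (4 * ε ^ 3) * ∫⁻ s in Set.Icc 0 T₀, ‖F s‖ₑ ^ 2 := by
  have hmeas : Measurable fun p : (ℝ × ℝ) × ℝ => ‖(window p.1).indicator F p.2‖ₑ ^ 2 :=
    (measurable_window_indicator hF).enorm.pow_const 2
  have hwin : ∀ z : ℝ × ℝ, MeasurableSet (window z) := fun z => measurableSet_Icc
  have h1 : ∀ᵐ z ∂(scaleStrip ε), ‖windowIntegral T₀ F z‖ₑ ^ 2 ≤
      ENNReal.ofReal (2 * ε) * ∫⁻ s in Set.Icc 0 T₀, ‖(window z).indicator F s‖ₑ ^ 2 := by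
    have hz : ∀ᵐ z ∂(scaleStrip ε), z.1 ∈ Set.Icc ε (2 * ε) := by
      have : ∀ᵐ l ∂(volume.restrict (Set.Icc ε (2 * ε))), l ∈ Set.Icc ε (2 * ε) :=
        ae_restrict_mem measurableSet_Icc
      exact Measure.quasiMeasurePreserving_fst.ae this
    filter_upwards [hz] with z hz
    calc ‖windowIntegral T₀ F z‖ₑ ^ 2
        ≤ (∫⁻ s in Set.Icc 0 T₀, (window z).indicator 1 s * ‖(window z).indicator F s‖ₑ) ^ 2 := by
          gcongr
          refine (enorm_integral_le_lintegral_enorm _).trans (lintegral_mono fun s => ?_)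
          by_cases hs : s ∈ window z <;> simp [hs]
      _ ≤ (∫⁻ s in Set.Icc 0 T₀, ((window z).indicator 1 s : ℝ≥0∞) ^ 2) *
          ∫⁻ s in Set.Icc 0 T₀, ‖(window z).indicator F s‖ₑ ^ 2 :=
          sq_lintegral_mul_le _ (measurable_one.indicator (hwin z)).aemeasurable
            (hF.indicator (hwin z)).enorm.aemeasurable
      _ ≤ _ := by
          gcongr
          calc ∫⁻ s in Set.Icc 0 T₀, ((window z).indicator 1 s : ℝ≥0∞) ^ 2
              ≤ ∫⁻ s, ((window z).indicator 1 s : ℝ≥0∞) ^ 2 := setLIntegral_le_lintegral _ _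
            _ = ∫⁻ s, (window z).indicator 1 s := by
                refine lintegral_congr fun s => ?_
                by_cases hs : s ∈ window z <;> simp [hs]
            _ = ENNReal.ofReal z.1 := by
                rw [lintegral_indicator_one (hwin z), window, Real.volume_Icc]
                simp
            _ ≤ _ := ENNReal.ofReal_le_ofReal hz.2
  refine (lintegral_mono_ae h1).trans ?_
  rw [lintegral_const_mul' _ _ ENNReal.ofReal_ne_top,
    lintegral_lintegral_swap hmeas.aemeasurable, show 4 * ε ^ 3 = 2 * ε * (2 * ε * ε) by ring,
    ENNReal.ofReal_mul (p := 2 * ε) (q := 2 * ε * ε) (by positivity),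
    mul_assoc (ENNReal.ofReal (2 * ε))]
  refine mul_le_mul' le_rfl ?_
  rw [← lintegral_const_mul' _ _ ENNReal.ofReal_ne_top]
  refine lintegral_mono fun s => ?_
  have h2 : ∀ z : ℝ × ℝ, ‖(window z).indicator F s‖ₑ ^ 2 =
      ‖F s‖ₑ ^ 2 * {z : ℝ × ℝ | s ∈ window z}.indicator 1 z := by
    intro z
    by_cases hs : s ∈ window z <;> simp [hs]
  have hms : MeasurableSet {z : ℝ × ℝ | s ∈ window z} :=
    measurableSet_mem_window.preimage (f := fun z : ℝ × ℝ => (z, s)) (by fun_prop)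
  simp_rw [h2]
  rw [lintegral_const_mul' _ _ (by simp), lintegral_indicator_one hms, mul_comm]
  gcongr
  rw [scaleStrip, Measure.prod_apply hms]
  calc ∫⁻ l in Set.Icc ε (2 * ε), volume (Prod.mk l ⁻¹' {z | s ∈ window z})
      ≤ ∫⁻ l in Set.Icc ε (2 * ε), ENNReal.ofReal (2 * ε) := by
        refine setLIntegral_mono' measurableSet_Icc fun l hl => ?_
        have : Prod.mk l ⁻¹' {z | s ∈ window z} = Set.Icc (s - l) s := by
          ext v
          simp [window, and_comm]
        rw [this, Real.volume_Icc]
        exact ENNReal.ofReal_le_ofReal (by linarith [hl.2])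
    _ = ENNReal.ofReal (2 * ε * ε) := by
        rw [lintegral_const, Measure.restrict_apply_univ, Real.volume_Icc,
          ← ENNReal.ofReal_mul (by positivity)]
        congr 1; ring

/-- The power `ε^{4-2H}` covers both regimes: for `H > 1/2` it comes from the density of the
windows, and at `H = 1/2` it is the `ε³` of the Cauchy–Schwarz estimate. Uniformity of `N` in `T₀`
and `F` matters because `F` will be the slice of a symbol at each frequency. -/
theorem exists_energy_lower_bound {H : ℝ} (hH : 1 / 2 ≤ H) (hH1 : H < 1) :
    ∃ N : ℝ, 0 < N ∧ ∀ (T₀ : ℝ) (F : ℝ → ℂ), Measurable F →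
      Integrable (fun p : ℝ × ℝ => F p.1 * (starRingEnd ℂ) (F p.2)) (timeCovariance H T₀) →
      energy H T₀ F = ((energy H T₀ F).re : ℂ) ∧ 0 ≤ (energy H T₀ F).re ∧
        ∀ ε : ℝ, 0 < ε → ∫⁻ z, ‖windowIntegral T₀ F z‖ₑ ^ 2 ∂(scaleStrip ε) ≤
          ENNReal.ofReal (N * ε ^ (4 - 2 * H) * (energy H T₀ F).re) := by
  rcases hH.eq_or_lt with rfl | hH
  · refine ⟨4, by norm_num, fun T₀ F hF hint => ?_⟩
    have hg : Measurable fun p : ℝ × ℝ => F p.1 * (starRingEnd ℂ) (F p.2) :=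
      (hF.comp measurable_fst).mul
        (Complex.continuous_conj.measurable.comp (hF.comp measurable_snd))
    have hd : Measurable fun s : ℝ => (s, s) := by fun_prop
    have he : energy (1 / 2) T₀ F = ((∫ s in Set.Icc 0 T₀, ‖F s‖ ^ 2 : ℝ) : ℂ) := by
      rw [energy, timeCovariance, if_pos rfl, integral_map hd.aemeasurable hg.aestronglyMeasurable,
        ← integral_complex_ofReal]
      refine integral_congr_ae (Eventually.of_forall fun s => ?_)
      simp only [RCLike.mul_conj]
      simp
    have hi : Integrable (fun s => ‖F s‖ ^ 2) (volume.restrict (Set.Icc 0 T₀)) := by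
      rw [timeCovariance, if_pos rfl, integrable_map_measure hg.aestronglyMeasurable
        hd.aemeasurable] at hint
      refine hint.norm.congr (Eventually.of_forall fun s => ?_)
      simp [sq]
    rw [he, Complex.ofReal_re]
    refine ⟨rfl, integral_nonneg fun s => by positivity, fun ε hε => ?_⟩
    refine (lintegral_windowIntegral_sq_le T₀ hF hε).trans (le_of_eq ?_)
    rw [ENNReal.ofReal_mul (p := 4 * ε ^ _) (by positivity),
      ofReal_integral_eq_lintegral_ofReal hi (Eventually.of_forall fun s => by positivity)]
    congr 1
    · congr 2
      rw [show (4 - 2 * (1 / 2) : ℝ) = ((3 : ℕ) : ℝ) by norm_num, Real.rpow_natCast]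
    · refine lintegral_congr fun s => ?_
      rw [← ofReal_norm, ENNReal.ofReal_pow (norm_nonneg _)]
  · have hc : 0 < H * (2 * H - 1) * ((2 - 2 * H) * (3 - 2 * H)) := by
      have h1 : 0 < 2 * H - 1 := by linarith
      have h2 : 0 < 2 - 2 * H := by linarith
      have h3 : 0 < 3 - 2 * H := by linarith
      have h4 : 0 < H := by linarith
      positivity
    set c := H * (2 * H - 1) * ((2 - 2 * H) * (3 - 2 * H)) with hcdef
    refine ⟨2 ^ (4 - 2 * H) / c, by positivity, fun T₀ F hF hint => ?_⟩
    obtain ⟨hi, he⟩ := energy_eq_integral_window hH hH1 hF hint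
    rw [he, Complex.ofReal_re]
    refine ⟨rfl, mul_nonneg hc.le (integral_nonneg fun s => by positivity), fun ε hε => ?_⟩
    refine (lintegral_scaleStrip_le H hH1 hε
      ((measurable_windowIntegral T₀ hF).enorm.pow_const 2)).trans (le_of_eq ?_)
    have : 2 ^ (4 - 2 * H) / c * ε ^ (4 - 2 * H) *
        (c * ∫ z, ‖windowIntegral T₀ F z‖ ^ 2 ∂(scaleMeasure H)) =
        (2 * ε) ^ (4 - 2 * H) * ∫ z, ‖windowIntegral T₀ F z‖ ^ 2 ∂(scaleMeasure H) := by
      rw [Real.mul_rpow (by norm_num) hε.le]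
      field_simp
    rw [← hcdef, this, ENNReal.ofReal_mul (by positivity),
      ofReal_integral_eq_lintegral_ofReal hi (Eventually.of_forall fun s => by positivity)]
    congr 1
    refine lintegral_congr fun s => ?_
    rw [← ofReal_norm, ENNReal.ofReal_pow (norm_nonneg _)]

/-! ### Averages over windows and their duality with the energy -/

/-- The measure `1_{ε ≤ ℓ ≤ 2ε} 1_{0 ≤ w ≤ ℓ} dℓ dw`. -/
def averagingMeasure (ε : ℝ) : Measure (ℝ × ℝ) :=
  (scaleStrip ε).restrict {q | 0 ≤ q.2 ∧ q.2 ≤ q.1}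

theorem measurableSet_averaging : MeasurableSet {q : ℝ × ℝ | 0 ≤ q.2 ∧ q.2 ≤ q.1} := by
  measurability

theorem ae_averagingMeasure (ε : ℝ) :
    ∀ᵐ q ∂(averagingMeasure ε), ε ≤ q.1 ∧ q.1 ≤ 2 * ε ∧ 0 ≤ q.2 ∧ q.2 ≤ q.1 := by
  have h1 : ∀ᵐ q ∂(averagingMeasure ε), 0 ≤ q.2 ∧ q.2 ≤ q.1 :=
    ae_restrict_mem measurableSet_averaging
  have hz : ∀ᵐ z ∂(scaleStrip ε), z.1 ∈ Set.Icc ε (2 * ε) := by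
    have : ∀ᵐ l ∂(volume.restrict (Set.Icc ε (2 * ε))), l ∈ Set.Icc ε (2 * ε) :=
      ae_restrict_mem measurableSet_Icc
    exact Measure.quasiMeasurePreserving_fst.ae this
  filter_upwards [h1, ae_restrict_of_ae hz] with q h1 h2
  exact ⟨h2.1, h2.2, h1⟩

instance (ε : ℝ) : IsFiniteMeasure (averagingMeasure ε) := by
  constructor
  rw [averagingMeasure, Measure.restrict_apply_univ]
  have hz : ∀ᵐ z ∂(scaleStrip ε), z.1 ∈ Set.Icc ε (2 * ε) := by
    have : ∀ᵐ l ∂(volume.restrict (Set.Icc ε (2 * ε))), l ∈ Set.Icc ε (2 * ε) :=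
      ae_restrict_mem measurableSet_Icc
    exact Measure.quasiMeasurePreserving_fst.ae this
  calc (scaleStrip ε) {q | 0 ≤ q.2 ∧ q.2 ≤ q.1}
      ≤ (scaleStrip ε) (Set.univ ×ˢ Set.Icc 0 (2 * ε)) := by
        refine measure_mono_ae ?_
        filter_upwards [hz] with q hq h
        exact ⟨Set.mem_univ _, h.1, h.2.trans hq.2⟩
    _ < ∞ := by
        rw [scaleStrip, Measure.prod_prod]
        exact ENNReal.mul_lt_top (measure_lt_top _ _)
          (by rw [Real.volume_Icc]; exact ENNReal.ofReal_lt_top)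

/-- The average of `∫_{s-ℓ}^s m` over `ε ≤ ℓ ≤ 2ε` (not normalized). -/
def average (ε : ℝ) (m : ℝ → ℝ) (s : ℝ) : ℝ := ∫ q, m (s - q.2) ∂(averagingMeasure ε)

theorem integrable_average {ε : ℝ} {m : ℝ → ℝ} (hm : Continuous m) {M : ℝ} (hM : ∀ v, ‖m v‖ ≤ M)
    (s : ℝ) : Integrable (fun q : ℝ × ℝ => m (s - q.2)) (averagingMeasure ε) :=
  (integrable_const M).mono' (by fun_prop) (Eventually.of_forall fun q => hM _)

theorem hasDerivAt_average {ε : ℝ} {m m' : ℝ → ℝ} (hm : ∀ v, HasDerivAt m (m' v) v)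
    (hm' : Continuous m') {M : ℝ} (hM : ∀ v, ‖m v‖ ≤ M) {M' : ℝ} (hM' : ∀ v, ‖m' v‖ ≤ M')
    (s : ℝ) : HasDerivAt (average ε m) (average ε m' s) s := by
  have hc : Continuous m := continuous_iff_continuousAt.2 fun v => (hm v).continuousAt
  refine (hasDerivAt_integral_of_dominated_loc_of_deriv_le (bound := fun _ => M')
    (F := fun s (q : ℝ × ℝ) => m (s - q.2)) (F' := fun s q => m' (s - q.2)) (s := Set.univ)
    univ_mem (Eventually.of_forall fun s => (integrable_average hc hM s).aestronglyMeasurable)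
    (integrable_average hc hM s) (by fun_prop)
    (Eventually.of_forall fun q x _ => hM' _) (integrable_const M')
    (Eventually.of_forall fun q x _ => ?_)).2
  exact (hm (x - q.2)).comp_sub_const x q.2

theorem continuous_average {ε : ℝ} {m : ℝ → ℝ} (hm : Continuous m) {M : ℝ} (hM : ∀ v, ‖m v‖ ≤ M) :
    Continuous (average ε m) :=
  continuous_of_dominated (fun s => (integrable_average hm hM s).aestronglyMeasurable)
    (bound := fun _ => M) (fun s => Eventually.of_forall fun q => hM _) (integrable_const M)
    (Eventually.of_forall fun q => by fun_prop)

theorem average_add_const_mul {ε : ℝ} {m₁ m₂ : ℝ → ℝ} (h₁ : Continuous m₁) (h₂ : Continuous m₂)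
    {M₁ M₂ : ℝ} (hM₁ : ∀ v, ‖m₁ v‖ ≤ M₁) (hM₂ : ∀ v, ‖m₂ v‖ ≤ M₂) (c s : ℝ) :
    average ε (fun v => m₁ v + c * m₂ v) s = average ε m₁ s + c * average ε m₂ s := by
  rw [average, integral_add (integrable_average h₁ hM₁ s)
    ((integrable_average h₂ hM₂ s).const_mul c), integral_const_mul]
  rfl

/-- Under `v = s - w` the condition `0 ≤ w ≤ ℓ` says that `s` lies in `[v, v + ℓ]`. -/
theorem average_eq_integral_window (ε : ℝ) {m : ℝ → ℝ} (s : ℝ) :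
    average ε m s = ∫ z, {z | s ∈ window z}.indicator (fun z => m z.2) z ∂(scaleStrip ε) := by
  have hmp : MeasurePreserving (Prod.map id fun w : ℝ => s - w) (scaleStrip ε) (scaleStrip ε) :=
    (MeasurePreserving.id _).prod (Measure.measurePreserving_sub_left volume s)
  have he : MeasurableEmbedding (Prod.map (id : ℝ → ℝ) fun w : ℝ => s - w) :=
    MeasurableEmbedding.id.prodMap (MeasurableEquiv.subLeft s).measurableEmbedding
  rw [← hmp.integral_comp he, average, averagingMeasure,
    ← integral_indicator measurableSet_averaging]
  refine integral_congr_ae (Eventually.of_forall fun q => ?_)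
  by_cases hq : 0 ≤ q.2 ∧ q.2 ≤ q.1
  · have : s ≤ s - q.2 + q.1 := by linarith [hq.2]
    simp [Set.indicator, window, hq, this]
  · have : ¬ (0 ≤ q.2 ∧ s ≤ s - q.2 + q.1) := fun h => hq ⟨h.1, by linarith [h.2]⟩
    simp [Set.indicator, window, hq, this]

theorem integrable_scaleStrip_snd (ε : ℝ) {m : ℝ → ℝ} (hm : Integrable m) :
    Integrable (fun z : ℝ × ℝ => m z.2) (scaleStrip ε) := by
  have := (integrable_const (μ := volume.restrict (Set.Icc ε (2 * ε))) (1 : ℝ)).mul_prod hm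
  simpa [scaleStrip] using this

/-- By Fubini, an averaged function sees `F` only through its window integrals, which are what the
energy controls. This is the reason for averaging the test function. -/
theorem integral_mul_average (ε T₀ : ℝ) {m : ℝ → ℝ} (hm : Integrable m) {F : ℝ → ℂ}
    (hF : IntegrableOn F (Set.Icc 0 T₀)) :
    ∫ s in Set.Icc 0 T₀, F s * (average ε m s : ℂ) =
      ∫ z, (m z.2 : ℂ) * windowIntegral T₀ F z ∂(scaleStrip ε) := by
  have h1 : ∀ s, F s * (average ε m s : ℂ) =
      ∫ z, {z | s ∈ window z}.indicator (fun z => F s * (m z.2 : ℂ)) z ∂(scaleStrip ε) := by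
    intro s
    rw [average_eq_integral_window, ← integral_complex_ofReal, ← integral_const_mul]
    refine integral_congr_ae (Eventually.of_forall fun z => ?_)
    by_cases hz : s ∈ window z <;> simp [hz]
  have h2 : ∀ z, (m z.2 : ℂ) * windowIntegral T₀ F z =
      ∫ s in Set.Icc 0 T₀, {z | s ∈ window z}.indicator (fun z => F s * (m z.2 : ℂ)) z := by
    intro z
    rw [windowIntegral, ← integral_const_mul]
    refine integral_congr_ae (Eventually.of_forall fun s => ?_)
    by_cases hz : s ∈ window z <;> simp [hz, mul_comm]
  simp_rw [h1, h2]
  refine integral_integral_swap ?_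
  have hi : Integrable (fun p : ℝ × (ℝ × ℝ) => F p.1 * (m p.2.2 : ℂ))
      ((volume.restrict (Set.Icc 0 T₀)).prod (scaleStrip ε)) :=
    Integrable.mul_prod hF (integrable_scaleStrip_snd ε hm).ofReal
  have hS : MeasurableSet {p : ℝ × (ℝ × ℝ) | p.1 ∈ window p.2} :=
    measurableSet_mem_window.preimage measurable_swap
  refine (hi.indicator hS).congr (Eventually.of_forall fun p => ?_)
  by_cases hz : p.1 ∈ window p.2 <;> simp [Function.uncurry, hz]

/-- Cauchy–Schwarz on the strip. Since `m` does not depend on `ℓ`, its square norm there gains the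
factor `ε`, the length of `[ε, 2ε]`, which raises the exponent from `4 - 2H` to `5 - 2H`. -/
theorem enorm_integral_mul_average_sq_le {H : ℝ} (hH : 1 / 2 ≤ H) (hH1 : H < 1) :
    ∃ N : ℝ, 0 < N ∧ ∀ (T₀ : ℝ) (F : ℝ → ℂ), Measurable F → IntegrableOn F (Set.Icc 0 T₀) →
      Integrable (fun p : ℝ × ℝ => F p.1 * (starRingEnd ℂ) (F p.2)) (timeCovariance H T₀) →
      ∀ (m : ℝ → ℝ), Measurable m → Integrable m → ∀ ε : ℝ, 0 < ε →
        ‖∫ s in Set.Icc 0 T₀, F s * (average ε m s : ℂ)‖ₑ ^ 2 ≤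
          ENNReal.ofReal (N * ε ^ (5 - 2 * H) * (energy H T₀ F).re) * ∫⁻ v, ‖m v‖ₑ ^ 2 := by
  obtain ⟨N, hN, h⟩ := exists_energy_lower_bound hH hH1
  refine ⟨N, hN, fun T₀ F hFm hF hint m hmm hm ε hε => ?_⟩
  obtain ⟨-, he0, hb⟩ := h T₀ F hFm hint
  rw [integral_mul_average ε T₀ hm hF]
  have hA := measurable_windowIntegral T₀ hFm
  have hm2 : ∫⁻ z, ‖m z.2‖ₑ ^ 2 ∂(scaleStrip ε) = ENNReal.ofReal ε * ∫⁻ v, ‖m v‖ₑ ^ 2 := by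
    rw [scaleStrip, lintegral_prod _ (by fun_prop)]
    simp only [lintegral_const, Measure.restrict_apply_univ, Real.volume_Icc]
    rw [mul_comm]
    congr 2
    ring
  calc ‖∫ z, (m z.2 : ℂ) * windowIntegral T₀ F z ∂(scaleStrip ε)‖ₑ ^ 2
      ≤ (∫⁻ z, ‖m z.2‖ₑ * ‖windowIntegral T₀ F z‖ₑ ∂(scaleStrip ε)) ^ 2 := by
        gcongr
        refine (enorm_integral_le_lintegral_enorm _).trans (lintegral_mono fun z => ?_)
        rw [enorm_mul]
        simp [← ofReal_norm]
    _ ≤ (∫⁻ z, ‖m z.2‖ₑ ^ 2 ∂(scaleStrip ε)) *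
          ∫⁻ z, ‖windowIntegral T₀ F z‖ₑ ^ 2 ∂(scaleStrip ε) :=
        sq_lintegral_mul_le _ (by fun_prop) (by fun_prop)
    _ ≤ (ENNReal.ofReal ε * ∫⁻ v, ‖m v‖ₑ ^ 2) *
          ENNReal.ofReal (N * ε ^ (4 - 2 * H) * (energy H T₀ F).re) := by
        rw [hm2]
        gcongr
        exact hb ε hε
    _ = _ := by
        rw [show 5 - 2 * H = (4 - 2 * H) + 1 by ring, Real.rpow_add_one hε.ne',
          show N * (ε ^ (4 - 2 * H) * ε) * (energy H T₀ F).re =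
            ε * (N * ε ^ (4 - 2 * H) * (energy H T₀ F).re) by ring,
          ENNReal.ofReal_mul (p := ε) hε.le]
        ring

/-! ### The test function in time -/

/-- A fixed smooth bump on the line. -/
def timeBump : ContDiffBump (0 : ℝ) := ⟨1 / 2, 1, by norm_num, by norm_num⟩

@[fun_prop]
theorem continuous_timeBump : Continuous timeBump := timeBump.continuous

theorem continuous_deriv_timeBump : Continuous (deriv timeBump) :=
  (timeBump.contDiff (n := 1)).continuous_deriv le_rfl

theorem exists_timeBump_bound : ∃ M : ℝ, 0 < M ∧ (∀ v, ‖timeBump v‖ ≤ M) ∧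
    ∀ v, ‖deriv timeBump v‖ ≤ M := by
  obtain ⟨M, hM⟩ :=
    timeBump.hasCompactSupport.deriv.exists_bound_of_continuous continuous_deriv_timeBump
  refine ⟨max M 1, by positivity, fun v => ?_, fun v => (hM v).trans (le_max_left _ _)⟩
  rw [Real.norm_of_nonneg timeBump.nonneg]
  exact timeBump.le_one.trans (le_max_right _ _)

/-- The bump at time `t` and scale `ε`, averaged. -/
def timeTest (t ε : ℝ) : ℝ → ℝ := average ε fun v => timeBump ((v - t) / ε)

/-- The derivative of `timeTest`. -/
def timeTestDeriv (t ε : ℝ) : ℝ → ℝ := average ε fun v => deriv timeBump ((v - t) / ε) * (1 / ε)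

theorem exists_scaled_bound (t ε : ℝ) : ∃ M : ℝ, (∀ v, ‖timeBump ((v - t) / ε)‖ ≤ M) ∧
    ∀ v, ‖deriv timeBump ((v - t) / ε) * (1 / ε)‖ ≤ M := by
  obtain ⟨M, hM0, h1, h2⟩ := exists_timeBump_bound
  refine ⟨max M (M * ‖1 / ε‖), fun v => (h1 _).trans (le_max_left _ _), fun v => ?_⟩
  rw [norm_mul]
  exact (mul_le_mul_of_nonneg_right (h2 _) (norm_nonneg _)).trans (le_max_right _ _)

theorem hasDerivAt_timeTest (t ε s : ℝ) :
    HasDerivAt (timeTest t ε) (timeTestDeriv t ε s) s := by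
  obtain ⟨M, h1, h2⟩ := exists_scaled_bound t ε
  have hd := continuous_deriv_timeBump
  refine hasDerivAt_average (fun v => ?_) (by fun_prop) h1 h2 s
  have hb : HasDerivAt timeBump (deriv timeBump ((v - t) / ε)) ((v - t) / ε) :=
    ((timeBump.contDiff (n := 1)).differentiable (by simp)).differentiableAt.hasDerivAt
  have hl : HasDerivAt (fun v => (v - t) / ε) (1 / ε) v :=
    ((hasDerivAt_id v).sub_const t).div_const ε
  exact HasDerivAt.comp (h₂ := timeBump) (h := fun v => (v - t) / ε) v hb hl

theorem continuous_timeTest (t ε : ℝ) : Continuous (timeTest t ε) :=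
  continuous_iff_continuousAt.2 fun s => (hasDerivAt_timeTest t ε s).continuousAt

theorem continuous_timeTestDeriv (t ε : ℝ) : Continuous (timeTestDeriv t ε) := by
  obtain ⟨M, h1, h2⟩ := exists_scaled_bound t ε
  have hd := continuous_deriv_timeBump
  exact continuous_average (by fun_prop) h2

/-- The bump lives within `ε` of `t` and averaging delays it by at most `2ε`. Thanks to the left end
`t - ε`, the test function vanishes at time `0` as soon as `ε ≤ t`. -/
theorem timeTest_eq_zero {t ε s : ℝ} (hε : 0 < ε) (hs : s ≤ t - ε ∨ t + 3 * ε ≤ s) :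
    timeTest t ε s = 0 := by
  refine integral_eq_zero_of_ae ((ae_averagingMeasure ε).mono fun q hq => ?_)
  refine timeBump.zero_of_le_dist ?_
  have h1 : timeBump.rOut = 1 := rfl
  rw [h1, Real.dist_eq, sub_zero, abs_div, abs_of_pos hε, one_le_div hε]
  rcases hs with hs | hs
  · rw [abs_of_nonpos (by linarith [hq.2.2.1])]; linarith [hq.2.2.1]
  · rw [abs_of_nonneg (by linarith [hq.2.2.2, hq.2.1])]; linarith [hq.2.2.2, hq.2.1]

/-- The bump equals `1` at `t - w` for `0 ≤ w ≤ ε/2`, and the rectangle `[ε, 2ε] × [0, ε/2]` has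
area `ε²/2`. -/
theorem le_timeTest {t ε : ℝ} (hε : 0 < ε) : ε ^ 2 / 2 ≤ timeTest t ε t := by
  obtain ⟨M, h1, h2⟩ := exists_scaled_bound t ε
  have hc : Continuous fun v => timeBump ((v - t) / ε) := by fun_prop
  have hi := integrable_average (ε := ε) hc h1 t
  have hm : MeasurableSet (Set.Icc ε (2 * ε) ×ˢ Set.Icc 0 (ε / 2)) :=
    measurableSet_Icc.prod measurableSet_Icc
  have hsub : Set.Icc ε (2 * ε) ×ˢ Set.Icc 0 (ε / 2) ⊆ {q : ℝ × ℝ | 0 ≤ q.2 ∧ q.2 ≤ q.1} :=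
    fun q hq => ⟨hq.2.1, by linarith [hq.2.2, hq.1.1]⟩
  have hmass : (averagingMeasure ε).real (Set.Icc ε (2 * ε) ×ˢ Set.Icc 0 (ε / 2)) = ε ^ 2 / 2 := by
    rw [measureReal_def, averagingMeasure, Measure.restrict_apply hm,
      Set.inter_eq_left.2 hsub, scaleStrip, Measure.prod_prod, Measure.restrict_apply_self,
      Real.volume_Icc, Real.volume_Icc, ← ENNReal.ofReal_mul (by linarith),
      ENNReal.toReal_ofReal (mul_nonneg (by linarith) (by linarith))]
    ring
  calc ε ^ 2 / 2 = ∫ q in Set.Icc ε (2 * ε) ×ˢ Set.Icc 0 (ε / 2), (1 : ℝ) ∂(averagingMeasure ε) := by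
        rw [setIntegral_const, hmass]; simp
    _ = ∫ q in Set.Icc ε (2 * ε) ×ˢ Set.Icc 0 (ε / 2), timeBump ((t - q.2 - t) / ε)
          ∂(averagingMeasure ε) := by
        refine setIntegral_congr_fun hm fun q hq => ?_
        refine (timeBump.one_of_mem_closedBall ?_).symm
        have h1 : timeBump.rIn = 1 / 2 := rfl
        rw [Metric.mem_closedBall, h1, Real.dist_eq, sub_zero, abs_div, abs_of_pos hε,
          div_le_iff₀ hε, abs_of_nonpos (by linarith [hq.2.1])]
        linarith [hq.2.2]
    _ ≤ _ := setIntegral_le_integral hi (Eventually.of_forall fun q => timeBump.nonneg)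

/-- The combination `κ' + cκ` is itself an average, of a function `m` bounded by `M(1 + εc)/ε` on an
interval of length `2ε`. Its square norm costs `ε⁻¹(1 + εc)²`, which brings `5 - 2H` back to `4 -
2H`. The dependence on `c` is kept explicit because `c` will be the unbounded quantity `Ψ(ξ)`. -/
theorem exists_timeTest_bound {H : ℝ} (hH : 1 / 2 ≤ H) (hH1 : H < 1) :
    ∃ C : ℝ, 0 < C ∧ ∀ (T₀ : ℝ) (F : ℝ → ℂ), Measurable F → IntegrableOn F (Set.Icc 0 T₀) →
      Integrable (fun p : ℝ × ℝ => F p.1 * (starRingEnd ℂ) (F p.2)) (timeCovariance H T₀) →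
      ∀ t ε c : ℝ, 0 < ε → 0 ≤ c →
        ‖∫ s in Set.Icc 0 T₀, F s * ((timeTestDeriv t ε s + c * timeTest t ε s : ℝ) : ℂ)‖ₑ ^ 2 ≤
          ENNReal.ofReal (C * ε ^ (4 - 2 * H) * (1 + ε * c) ^ 2 * (energy H T₀ F).re) := by
  obtain ⟨N, hN, h⟩ := enorm_integral_mul_average_sq_le hH hH1
  obtain ⟨M, hM0, hM1, hM2⟩ := exists_timeBump_bound
  have hd := continuous_deriv_timeBump
  refine ⟨N * (2 * M ^ 2), by positivity, fun T₀ F hFm hF hint t ε c hε hc => ?_⟩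
  obtain ⟨M', h1, h2⟩ := exists_scaled_bound t ε
  set m : ℝ → ℝ := fun v => deriv timeBump ((v - t) / ε) * (1 / ε) + c * timeBump ((v - t) / ε)
    with hmdef
  have hmc : Continuous m := by fun_prop
  have hm0 : ∀ v, v ∉ Set.Icc (t - ε) (t + ε) → m v = 0 := by
    intro v hv
    have hv' : (v - t) / ε ∉ tsupport timeBump := by
      rw [timeBump.tsupport_eq, Metric.mem_closedBall, Real.dist_eq, sub_zero, abs_div,
        abs_of_pos hε, not_le, lt_div_iff₀ hε, show timeBump.rOut = 1 from rfl, one_mul, lt_abs]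
      by_contra! hcon
      exact hv ⟨by linarith [hcon.2], by linarith [hcon.1]⟩
    have e1 : timeBump ((v - t) / ε) = 0 := image_eq_zero_of_notMem_tsupport hv'
    have e2 : deriv timeBump ((v - t) / ε) = 0 :=
      Function.notMem_support.1 fun h => hv' (support_deriv_subset h)
    simp [hmdef, e1, e2]
  have hmcs : HasCompactSupport m := HasCompactSupport.intro isCompact_Icc hm0
  have hmb : ∀ v, ‖m v‖ ≤ M / ε * (1 + ε * c) := by
    intro v
    calc ‖m v‖ ≤ ‖deriv timeBump ((v - t) / ε)‖ * ‖1 / ε‖ + ‖c‖ * ‖timeBump ((v - t) / ε)‖ := by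
          rw [hmdef]; exact (norm_add_le _ _).trans (by rw [norm_mul, norm_mul])
      _ ≤ M * (1 / ε) + c * M := by
          rw [Real.norm_of_nonneg hc, Real.norm_of_nonneg (by positivity : 0 ≤ 1 / ε)]
          gcongr
          · exact hM2 _
          · exact hM1 _
      _ = _ := by field_simp
  have hml : ∫⁻ v, ‖m v‖ₑ ^ 2 ≤ ENNReal.ofReal (2 * M ^ 2 / ε * (1 + ε * c) ^ 2) := by
    calc ∫⁻ v, ‖m v‖ₑ ^ 2
        ≤ ∫⁻ v in Set.Icc (t - ε) (t + ε), ENNReal.ofReal (M / ε * (1 + ε * c)) ^ 2 := by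
          rw [← lintegral_indicator measurableSet_Icc]
          refine lintegral_mono fun v => ?_
          by_cases hv : v ∈ Set.Icc (t - ε) (t + ε)
          · rw [Set.indicator_of_mem hv, ← ofReal_norm]
            gcongr
            exact hmb v
          · simp [hm0 v hv]
      _ = _ := by
          rw [lintegral_const, Measure.restrict_apply_univ, Real.volume_Icc,
            ← ENNReal.ofReal_pow (by positivity), ← ENNReal.ofReal_mul (by positivity)]
          congr 1
          field_simp
          ring
  have hav : ∀ s, average ε m s = timeTestDeriv t ε s + c * timeTest t ε s := fun s =>
    average_add_const_mul (by fun_prop) (by fun_prop) h2 h1 c s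
  have key := h T₀ F hFm hF hint m hmc.measurable (hmc.integrable_of_hasCompactSupport hmcs) ε hε
  simp_rw [hav] at key
  -- A negative real part would be truncated to zero by `ENNReal.ofReal`, and the left side would
  -- then vanish.
  by_cases hE : 0 ≤ (energy H T₀ F).re
  · refine key.trans ((mul_le_mul_right hml _).trans (le_of_eq ?_))
    rw [← ENNReal.ofReal_mul (by positivity)]
    congr 1
    rw [show 5 - 2 * H = (4 - 2 * H) + 1 by ring, Real.rpow_add_one hε.ne']
    field_simp
  · rw [ENNReal.ofReal_of_nonpos (mul_nonpos_of_nonneg_of_nonpos (by positivity)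
      (not_le.1 hE).le), zero_mul] at key
    exact key.trans (by simp)

/-! ### The test function in space -/

/-- A fixed smooth bump on `ℝ^d`, supported in the ball of radius `1/(2π)`. -/
def spaceBump (d : ℕ) : ContDiffBump (0 : Space d) :=
  ⟨1 / (4 * Real.pi), 1 / (2 * Real.pi), by positivity, by
    apply one_div_lt_one_div_of_lt <;> linarith [Real.pi_pos]⟩

theorem hasCompactSupport_spaceBump (d : ℕ) :
    HasCompactSupport fun x : Space d => (spaceBump d x : ℂ) :=
  (spaceBump d).hasCompactSupport.comp_left (g := fun r : ℝ => (r : ℂ)) Complex.ofReal_zero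

/-- `spaceBump` as a complex Schwartz function. -/
def spaceBumpSchwartz (d : ℕ) : SchwartzMap (Space d) ℂ :=
  (hasCompactSupport_spaceBump d).toSchwartzMap
    (Complex.ofRealCLM.contDiff.comp (spaceBump d).contDiff)

/-- The Fourier transform of `spaceBump`. -/
def spaceSymbol (d : ℕ) : SchwartzMap (Space d) ℂ :=
  FourierTransform.fourier (spaceBumpSchwartz d)

/-- Fourier inversion; the dilation by `(2π)⁻¹` passes from the kernel `exp(2πi w·z)` to `exp(i
w·z)`. With the support radius `1/(2π)`, the result is supported in `‖z‖ ≤ 1`. -/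
theorem integral_spaceSymbol {d : ℕ} (z : Space d) :
    ∫ w, spaceSymbol d w * Complex.exp (Complex.I * (inner ℝ w z : ℝ)) =
      (spaceBump d ((2 * Real.pi)⁻¹ • z) : ℂ) := by
  have h : FourierTransformInv.fourierInv (spaceSymbol d) = spaceBumpSchwartz d :=
    FourierPair.fourierInv_fourier_eq _
  have h2 := congrArg (fun f : SchwartzMap (Space d) ℂ => f ((2 * Real.pi)⁻¹ • z)) h
  simp only [SchwartzMap.fourierInv_coe] at h2
  rw [Real.fourierInv_eq'] at h2
  rw [show (spaceBump d ((2 * Real.pi)⁻¹ • z) : ℂ) = spaceBumpSchwartz d ((2 * Real.pi)⁻¹ • z)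
    from rfl, ← h2]
  refine integral_congr_ae (Eventually.of_forall fun w => ?_)
  simp only [smul_eq_mul]
  rw [mul_comm, inner_smul_right, mul_comm Complex.I]
  congr 4
  field_simp

theorem integral_spaceSymbol_smul {d : ℕ} {δ : ℝ} (hδ : 0 < δ) (z : Space d) :
    ∫ w : Space d, spaceSymbol d (δ • w) * Complex.exp (Complex.I * (inner ℝ w z : ℝ)) =
      ((δ ^ d)⁻¹ * spaceBump d ((2 * Real.pi)⁻¹ • δ⁻¹ • z) : ℝ) := by
  have h := Measure.integral_comp_smul_of_nonneg (μ := (volume : Measure (Space d)))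
    (fun w => spaceSymbol d w * Complex.exp (Complex.I * (inner ℝ w (δ⁻¹ • z) : ℝ))) δ
    (hR := hδ.le)
  rw [integral_spaceSymbol, finrank_euclideanSpace_fin] at h
  rw [Complex.ofReal_mul, ← Complex.real_smul, ← h]
  refine integral_congr_ae (Eventually.of_forall fun w => ?_)
  have : inner ℝ (δ • w) (δ⁻¹ • z) = inner ℝ w z := by
    rw [inner_smul_left, inner_smul_right, ← mul_assoc]
    simp [hδ.ne']
  simp only [this]

theorem integrable_one_add_norm_pow_mul {d : ℕ} (f : SchwartzMap (Space d) ℂ) (k : ℕ) :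
    Integrable fun w => (1 + ‖w‖) ^ k * ‖f w‖ := by
  have h0 : Integrable fun w => 2 ^ k * (‖f w‖ + ‖w‖ ^ k * ‖f w‖) :=
    (f.integrable.norm.add (f.integrable_pow_mul volume k)).const_mul _
  refine h0.mono' (by fun_prop) (Eventually.of_forall fun w => ?_)
  rw [Real.norm_of_nonneg (by positivity)]
  have : (1 + ‖w‖) ^ k ≤ 2 ^ k * (1 + ‖w‖ ^ k) := by
    calc (1 + ‖w‖) ^ k ≤ (2 * max 1 ‖w‖) ^ k := by
          gcongr
          linarith [le_max_left 1 ‖w‖, le_max_right 1 ‖w‖]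
      _ = 2 ^ k * max 1 ‖w‖ ^ k := mul_pow _ _ _
      _ ≤ _ := by
          gcongr
          rcases le_total 1 ‖w‖ with h | h
          · rw [max_eq_right h]; linarith
          · rw [max_eq_left h]; simp
  calc (1 + ‖w‖) ^ k * ‖f w‖ ≤ 2 ^ k * (1 + ‖w‖ ^ k) * ‖f w‖ := by gcongr
    _ = _ := by ring

theorem integrable_one_add_norm_pow_mul_sq {d : ℕ} (f : SchwartzMap (Space d) ℂ) (k : ℕ) :
    Integrable fun w => (1 + ‖w‖) ^ k * ‖f w‖ ^ 2 := by
  obtain ⟨M, hM⟩ : ∃ M, ∀ w, ‖f w‖ ≤ M := by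
    obtain ⟨M, hM⟩ := f.decay 0 0
    exact ⟨M, fun w => by simpa using hM.2 w⟩
  refine ((integrable_one_add_norm_pow_mul f k).const_mul M).mono' (by fun_prop)
    (Eventually.of_forall fun w => ?_)
  rw [Real.norm_of_nonneg (by positivity)]
  calc (1 + ‖w‖) ^ k * ‖f w‖ ^ 2 = ‖f w‖ * ((1 + ‖w‖) ^ k * ‖f w‖) := by ring
    _ ≤ _ := by gcongr; exact hM w

theorem rpow_norm_le_one_add_pow {d : ℕ} (w : Space d) {r : ℝ} {k : ℕ} (hr : 0 ≤ r)
    (hk : r ≤ k) : ‖w‖ ^ r ≤ (1 + ‖w‖) ^ k := by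
  calc ‖w‖ ^ r ≤ (1 + ‖w‖) ^ r := Real.rpow_le_rpow (norm_nonneg _) (by linarith) hr
    _ ≤ (1 + ‖w‖) ^ (k : ℝ) := Real.rpow_le_rpow_of_exponent_le (by linarith [norm_nonneg w]) hk
    _ = _ := Real.rpow_natCast _ _

/-! ### The dual pairing -/

/-- A jointly measurable bounded function of time and frequency. -/
structure BoundedSymbol {d : ℕ} (F : ℝ → Space d → ℂ) : Prop where
  measurable : Measurable (Function.uncurry F)
  bounded : ∃ B : ℝ, ∀ s ξ, ‖F s ξ‖ ≤ B

/-- The time part `∫_0^{T₀} F(s, ξ) (κ'(s) + Ψ(ξ) κ(s)) ds` of the pairing. -/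
def timePairing {d : ℕ} (Ψ : Space d → ℝ) (T₀ t ε : ℝ) (F : ℝ → Space d → ℂ) (ξ : Space d) : ℂ :=
  ∫ s in Set.Icc 0 T₀, F s ξ * ((timeTestDeriv t ε s + Ψ ξ * timeTest t ε s : ℝ) : ℂ)

/-- The pairing of a symbol with the test function at the point `(t, x)` and scales `ε`, `δ`. -/
def pairing {d : ℕ} (Ψ : Space d → ℝ) (T₀ t ε δ : ℝ) (x : Space d) (F : ℝ → Space d → ℂ) : ℂ :=
  ∫ ξ, timePairing Ψ T₀ t ε F ξ *
    (spaceSymbol d (δ • ξ) * Complex.exp (Complex.I * (inner ℝ ξ x : ℝ)))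

namespace BoundedSymbol

variable {d : ℕ} {F G : ℝ → Space d → ℂ}

theorem measurable_section (hF : BoundedSymbol F) (ξ : Space d) : Measurable fun s => F s ξ :=
  hF.measurable.comp (by fun_prop : Measurable fun s : ℝ => (s, ξ))

theorem integrableOn (hF : BoundedSymbol F) (T₀ : ℝ) (ξ : Space d) :
    IntegrableOn (fun s => F s ξ) (Set.Icc 0 T₀) := by
  obtain ⟨B, hB⟩ := hF.bounded
  exact (integrable_const B).mono' (hF.measurable_section ξ).aestronglyMeasurable
    (Eventually.of_forall fun s => hB s ξ)

theorem integrableOn_mul (hF : BoundedSymbol F) (T₀ : ℝ) (ξ : Space d) {k : ℝ → ℝ}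
    (hk : Continuous k) : IntegrableOn (fun s => F s ξ * (k s : ℂ)) (Set.Icc 0 T₀) := by
  obtain ⟨B, hB⟩ := hF.bounded
  have hi : IntegrableOn (fun s => (k s : ℂ)) (Set.Icc 0 T₀) :=
    (Complex.continuous_ofReal.comp hk).continuousOn.integrableOn_Icc
  exact hi.bdd_mul (hF.measurable_section ξ).aestronglyMeasurable
    (Eventually.of_forall fun s => hB s ξ)

theorem add (hF : BoundedSymbol F) (hG : BoundedSymbol G) :
    BoundedSymbol fun s ξ => F s ξ + G s ξ := by
  obtain ⟨B, hB⟩ := hF.bounded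
  obtain ⟨B', hB'⟩ := hG.bounded
  exact ⟨hF.measurable.add hG.measurable, B + B', fun s ξ =>
    (norm_add_le _ _).trans (add_le_add (hB s ξ) (hB' s ξ))⟩

theorem const_mul (hF : BoundedSymbol F) (c : ℂ) : BoundedSymbol fun s ξ => c * F s ξ := by
  obtain ⟨B, hB⟩ := hF.bounded
  refine ⟨hF.measurable.const_mul c, ‖c‖ * B, fun s ξ => ?_⟩
  rw [norm_mul]
  exact mul_le_mul_of_nonneg_left (hB s ξ) (norm_nonneg _)

theorem sub (hF : BoundedSymbol F) (hG : BoundedSymbol G) :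
    BoundedSymbol fun s ξ => F s ξ - G s ξ := by
  simpa [sub_eq_add_neg] using hF.add (hG.const_mul (-1))

theorem zero : BoundedSymbol fun (_ : ℝ) (_ : Space d) => (0 : ℂ) :=
  ⟨measurable_const, 0, by simp⟩

theorem sum {ι : Type*} (S : Finset ι) {F : ι → ℝ → Space d → ℂ} (hF : ∀ i, BoundedSymbol (F i)) :
    BoundedSymbol fun s ξ => ∑ i ∈ S, F i s ξ := by
  classical
  induction S using Finset.induction_on with
  | empty => simpa using zero
  | insert i S hi ih => simpa [Finset.sum_insert hi] using (hF i).add ih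

end BoundedSymbol

section Pairing

variable {d : ℕ} {Ψ : Space d → ℝ} {F G : ℝ → Space d → ℂ} {T₀ t ε δ : ℝ} {x : Space d}

theorem continuous_timeKernel (t ε c : ℝ) :
    Continuous fun s => timeTestDeriv t ε s + c * timeTest t ε s :=
  (continuous_timeTestDeriv t ε).add ((continuous_timeTest t ε).const_mul c)

theorem timePairing_add (hF : BoundedSymbol F) (hG : BoundedSymbol G) (ξ : Space d) :
    timePairing Ψ T₀ t ε (fun s ξ => F s ξ + G s ξ) ξ =
      timePairing Ψ T₀ t ε F ξ + timePairing Ψ T₀ t ε G ξ := by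
  have hk := continuous_timeKernel t ε (Ψ ξ)
  simp only [timePairing, add_mul]
  exact integral_add (hF.integrableOn_mul T₀ ξ hk) (hG.integrableOn_mul T₀ ξ hk)

theorem timePairing_const_mul (c : ℂ) (ξ : Space d) :
    timePairing Ψ T₀ t ε (fun s ξ => c * F s ξ) ξ = c * timePairing Ψ T₀ t ε F ξ := by
  simp only [timePairing, mul_assoc]
  exact integral_const_mul _ _

theorem measurable_timePairing (hΨ : Measurable Ψ) (hF : BoundedSymbol F) :
    Measurable (timePairing Ψ T₀ t ε F) := by
  have h1 := (continuous_timeTest t ε).measurable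
  have h2 := (continuous_timeTestDeriv t ε).measurable
  have : Measurable fun p : Space d × ℝ => F p.2 p.1 *
      ((timeTestDeriv t ε p.2 + Ψ p.1 * timeTest t ε p.2 : ℝ) : ℂ) := by
    refine (hF.measurable.comp measurable_swap).mul (Complex.measurable_ofReal.comp ?_)
    fun_prop
  exact (this.stronglyMeasurable.integral_prod_right (ν := volume.restrict (Set.Icc 0 T₀))).measurable

theorem exists_norm_timePairing_le (hF : BoundedSymbol F) (T₀ t ε : ℝ) :
    ∃ B : ℝ, 0 ≤ B ∧ ∀ ξ, 0 ≤ Ψ ξ → ‖timePairing Ψ T₀ t ε F ξ‖ ≤ B * (1 + Ψ ξ) := by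
  obtain ⟨B, hB⟩ := hF.bounded
  obtain ⟨M₁, h1⟩ := isCompact_Icc.exists_bound_of_continuousOn (s := Set.Icc 0 T₀)
    (continuous_timeTest t ε).continuousOn
  obtain ⟨M₂, h2⟩ := isCompact_Icc.exists_bound_of_continuousOn (s := Set.Icc 0 T₀)
    (continuous_timeTestDeriv t ε).continuousOn
  set M := max 0 (max M₁ M₂)
  have hM0 : 0 ≤ M := le_max_left _ _
  have hB0 : 0 ≤ |B| := abs_nonneg B
  refine ⟨|B| * M * volume.real (Set.Icc 0 T₀), by positivity, fun ξ hξ => ?_⟩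
  have : ∀ s ∈ Set.Icc 0 T₀, ‖F s ξ * ((timeTestDeriv t ε s + Ψ ξ * timeTest t ε s : ℝ) : ℂ)‖ ≤
      |B| * (M * (1 + Ψ ξ)) := by
    intro s hs
    rw [norm_mul]
    refine mul_le_mul ((hB s ξ).trans (le_abs_self B)) ?_ (norm_nonneg _) hB0
    rw [Complex.norm_real]
    calc ‖timeTestDeriv t ε s + Ψ ξ * timeTest t ε s‖
        ≤ ‖timeTestDeriv t ε s‖ + Ψ ξ * ‖timeTest t ε s‖ := by
          refine (norm_add_le _ _).trans ?_
          rw [norm_mul, Real.norm_of_nonneg hξ]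
      _ ≤ M + Ψ ξ * M := by
          gcongr
          · exact (h2 s hs).trans ((le_max_right _ _).trans (le_max_right _ _))
          · exact (h1 s hs).trans ((le_max_left _ _).trans (le_max_right _ _))
      _ = _ := by ring
  refine (norm_setIntegral_le_of_norm_le_const (by simp) this).trans (le_of_eq ?_)
  ring

/-- The time pairing grows at most like `1 + ‖ξ‖^α` with `α ≤ 2`, which a quadratic weight against
the Schwartz function absorbs. This makes the pairing additive in the symbol. -/
theorem integrable_pairing (hΨ : Measurable Ψ) {C α : ℝ} (hα : 0 < α) (hα2 : α ≤ 2)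
    (hΨ0 : ∀ ξ, 0 ≤ Ψ ξ) (hΨC : ∀ ξ, Ψ ξ ≤ C * ‖ξ‖ ^ α) (hδ : 0 < δ) (hF : BoundedSymbol F) :
    Integrable fun ξ => timePairing Ψ T₀ t ε F ξ *
      (spaceSymbol d (δ • ξ) * Complex.exp (Complex.I * (inner ℝ ξ x : ℝ))) := by
  obtain ⟨B, hB0, hB⟩ := exists_norm_timePairing_le (Ψ := Ψ) hF T₀ t ε
  have h1 : Integrable fun ξ : Space d => (1 + ‖δ • ξ‖) ^ 2 * ‖spaceSymbol d (δ • ξ)‖ :=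
    (integrable_one_add_norm_pow_mul (spaceSymbol d) 2).comp_smul hδ.ne'
  have hq : Continuous fun ξ : Space d => spaceSymbol d (δ • ξ) *
      Complex.exp (Complex.I * (inner ℝ ξ x : ℝ)) := by
    have := (spaceSymbol d).continuous
    fun_prop
  refine (h1.const_mul (B * (1 + |C| * (δ ^ α)⁻¹))).mono'
    ((measurable_timePairing hΨ hF).aestronglyMeasurable.mul hq.aestronglyMeasurable)
    (Eventually.of_forall fun ξ => ?_)
  have he : ‖Complex.exp (Complex.I * (inner ℝ ξ x : ℝ))‖ = 1 := by
    rw [mul_comm]; exact Complex.norm_exp_ofReal_mul_I _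
  rw [norm_mul, norm_mul, he, mul_one, ← mul_assoc]
  gcongr
  refine (hB ξ (hΨ0 ξ)).trans ?_
  rw [mul_assoc]
  gcongr
  have hn : ‖ξ‖ ^ α ≤ (δ ^ α)⁻¹ * (1 + ‖δ • ξ‖) ^ 2 := by
    have := rpow_norm_le_one_add_pow (δ • ξ) (k := 2) hα.le (by exact_mod_cast hα2)
    rw [norm_smul, Real.norm_of_nonneg hδ.le, Real.mul_rpow hδ.le (norm_nonneg _)] at this
    rw [inv_mul_eq_div, le_div_iff₀ (by positivity), norm_smul, Real.norm_of_nonneg hδ.le]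
    linarith
  calc 1 + Ψ ξ ≤ (1 + ‖δ • ξ‖) ^ 2 + |C| * ((δ ^ α)⁻¹ * (1 + ‖δ • ξ‖) ^ 2) := by
        refine add_le_add (one_le_pow₀ (by linarith [norm_nonneg (δ • ξ)])) ((hΨC ξ).trans ?_)
        exact mul_le_mul (le_abs_self C) hn (by positivity) (abs_nonneg C)
    _ = _ := by ring

end Pairing

/-! ### Boundedness of the pairing in the norm of the noise -/

section PairingBound

variable {d : ℕ} {Ψ h : Space d → ℝ} {F G : ℝ → Space d → ℂ} {T₀ t ε δ : ℝ} {x : Space d}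
  {C α : ℝ}

theorem pairing_add (hΨ : Measurable Ψ) (hα : 0 < α) (hα2 : α ≤ 2)
    (hΨ0 : ∀ ξ, 0 ≤ Ψ ξ) (hΨC : ∀ ξ, Ψ ξ ≤ C * ‖ξ‖ ^ α) (hδ : 0 < δ) (hF : BoundedSymbol F)
    (hG : BoundedSymbol G) :
    pairing Ψ T₀ t ε δ x (fun s ξ => F s ξ + G s ξ) =
      pairing Ψ T₀ t ε δ x F + pairing Ψ T₀ t ε δ x G := by
  simp only [pairing, timePairing_add hF hG, add_mul]
  exact integral_add (integrable_pairing hΨ hα hα2 hΨ0 hΨC hδ hF)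
    (integrable_pairing hΨ hα hα2 hΨ0 hΨC hδ hG)

theorem pairing_const_mul (c : ℂ) :
    pairing Ψ T₀ t ε δ x (fun s ξ => c * F s ξ) = c * pairing Ψ T₀ t ε δ x F := by
  simp only [pairing, timePairing_const_mul, mul_assoc]
  exact integral_const_mul _ _

theorem pairing_sub (hΨ : Measurable Ψ) (hα : 0 < α) (hα2 : α ≤ 2)
    (hΨ0 : ∀ ξ, 0 ≤ Ψ ξ) (hΨC : ∀ ξ, Ψ ξ ≤ C * ‖ξ‖ ^ α) (hδ : 0 < δ) (hF : BoundedSymbol F)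
    (hG : BoundedSymbol G) :
    pairing Ψ T₀ t ε δ x (fun s ξ => F s ξ - G s ξ) =
      pairing Ψ T₀ t ε δ x F - pairing Ψ T₀ t ε δ x G := by
  have := pairing_add (T₀ := T₀) (t := t) (ε := ε) (x := x) hΨ hα hα2 hΨ0 hΨC hδ hF
    (hG.const_mul (-1))
  rw [pairing_const_mul] at this
  simpa [sub_eq_add_neg] using this

theorem pairing_sum (hΨ : Measurable Ψ) (hα : 0 < α) (hα2 : α ≤ 2)
    (hΨ0 : ∀ ξ, 0 ≤ Ψ ξ) (hΨC : ∀ ξ, Ψ ξ ≤ C * ‖ξ‖ ^ α) (hδ : 0 < δ) {ι : Type*} (S : Finset ι)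
    (c : ι → ℂ) {F : ι → ℝ → Space d → ℂ} (hF : ∀ i, BoundedSymbol (F i)) :
    pairing Ψ T₀ t ε δ x (fun s ξ => ∑ i ∈ S, c i * F i s ξ) =
      ∑ i ∈ S, c i * pairing Ψ T₀ t ε δ x (F i) := by
  classical
  induction S using Finset.induction_on with
  | empty => simp [pairing, timePairing]
  | insert i S hi ih =>
    simp only [Finset.sum_insert hi]
    rw [pairing_add hΨ hα hα2 hΨ0 hΨC hδ ((hF i).const_mul (c i))
      (BoundedSymbol.sum S fun i => (hF i).const_mul (c i)), ih, pairing_const_mul]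

instance (H T₀ : ℝ) : SFinite (timeCovariance H T₀) := by
  unfold timeCovariance
  split_ifs <;> infer_instance

/-- The function `((s, r), ξ) ↦ F(s, ξ) conj F(r, ξ)`. -/
def symbolSquare (F : ℝ → Space d → ℂ) (q : (ℝ × ℝ) × Space d) : ℂ :=
  F q.1.1 q.2 * (starRingEnd ℂ) (F q.1.2 q.2)

theorem BoundedSymbol.measurable_symbolSquare (hF : BoundedSymbol F) :
    Measurable (symbolSquare F) := by
  have h1 : Measurable fun q : (ℝ × ℝ) × Space d => F q.1.1 q.2 :=
    hF.measurable.comp (by fun_prop : Measurable fun q : (ℝ × ℝ) × Space d => (q.1.1, q.2))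
  have h2 : Measurable fun q : (ℝ × ℝ) × Space d => F q.1.2 q.2 :=
    hF.measurable.comp (by fun_prop : Measurable fun q : (ℝ × ℝ) × Space d => (q.1.2, q.2))
  exact h1.mul (Complex.continuous_conj.measurable.comp h2)

theorem BoundedSymbol.measurable_energy (hF : BoundedSymbol F) (H T₀ : ℝ) :
    Measurable fun ξ => energy H T₀ fun s => F s ξ :=
  (hF.measurable_symbolSquare.stronglyMeasurable.integral_prod_left'
    (μ := timeCovariance H T₀)).measurable

/-- The total energy of a symbol is the integral of the energies at fixed frequency. -/
theorem lintegral_energy {H : ℝ} (hH : 1 / 2 ≤ H) (hH1 : H < 1) (hh : Measurable h)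
    (hF : BoundedSymbol F)
    (hint : Integrable (symbolSquare F) ((timeCovariance H T₀).prod (spectralMeasure h))) :
    0 ≤ (∫ q, symbolSquare F q ∂((timeCovariance H T₀).prod (spectralMeasure h))).re ∧
    ∫⁻ ξ, ENNReal.ofReal (h ξ) * ENNReal.ofReal (energy H T₀ fun s => F s ξ).re =
      ENNReal.ofReal
        (∫ q, symbolSquare F q ∂((timeCovariance H T₀).prod (spectralMeasure h))).re := by
  obtain ⟨N, -, hN⟩ := exists_energy_lower_bound hH hH1
  have : SFinite (spectralMeasure h) := by unfold spectralMeasure; infer_instance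
  have hsec : ∀ᵐ ξ ∂(spectralMeasure h), 0 ≤ (energy H T₀ fun s => F s ξ).re := by
    filter_upwards [hint.prod_left_ae] with ξ hξ
    exact (hN T₀ _ (hF.measurable_section ξ) hξ).2.1
  have hE : Integrable (fun ξ => energy H T₀ fun s => F s ξ) (spectralMeasure h) :=
    hint.integral_prod_right
  have heq : (∫ q, symbolSquare F q ∂((timeCovariance H T₀).prod (spectralMeasure h))).re =
      ∫ ξ, (energy H T₀ fun s => F s ξ).re ∂(spectralMeasure h) := by
    rw [integral_prod_symm _ hint]
    exact (integral_re hE).symm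
  rw [heq]
  refine ⟨integral_nonneg_of_ae hsec, ?_⟩
  have hEr : Integrable (fun ξ => (energy H T₀ fun s => F s ξ).re) (spectralMeasure h) := hE.re
  rw [ofReal_integral_eq_lintegral_ofReal hEr hsec, spectralMeasure,
    lintegral_withDensity_eq_lintegral_mul₀ (by fun_prop)]
  · rfl
  · exact (Complex.measurable_re.comp (hF.measurable_energy H T₀)).ennreal_ofReal.aemeasurable

/-- The pairing with the test function at scales `ε = δ^α` is bounded in the norm of the noise. -/
theorem exists_pairing_bound (d : ℕ) {H α β cΨ ch : ℝ} (hH : 1 / 2 ≤ H) (hH1 : H < 1)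
    (hα2 : α ≤ 2) (hα : 0 < α) (hβ : 0 < β) (hβd : β < d) (hcΨ : 0 < cΨ) (hch : 0 < ch) :
    ∃ K : ℝ, 0 < K ∧ ∀ (Ψ h : Space d → ℝ), Measurable Ψ → Measurable h → (∀ ξ, 0 ≤ Ψ ξ) →
      (∀ ξ, Ψ ξ ≤ cΨ * ‖ξ‖ ^ α) → (∀ ξ, ξ ≠ 0 → ch * ‖ξ‖ ^ (-β) ≤ h ξ) →
      ∀ (T₀ : ℝ) (F : ℝ → Space d → ℂ), BoundedSymbol F →
      Integrable (symbolSquare F) ((timeCovariance H T₀).prod (spectralMeasure h)) →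
      ∀ (t δ : ℝ) (x : Space d), 0 < δ →
        ‖pairing Ψ T₀ t (δ ^ α) δ x F‖ ^ 2 ≤ K * ((δ ^ α) ^ (4 - 2 * H) * (δ ^ β)⁻¹ * (δ ^ d)⁻¹) *
          (∫ q, symbolSquare F q ∂((timeCovariance H T₀).prod (spectralMeasure h))).re := by
  obtain ⟨C, hC, hbound⟩ := exists_timeTest_bound hH hH1
  -- The weight `4 + d` collects `(1 + ‖δξ‖)^4` from `(1 + εΨ)²`, using `α ≤ 2`, and `(1 + ‖δξ‖)^d`
  -- from `1/h`, using `β < d`.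
  set I : ℝ := ∫ w, (1 + ‖w‖) ^ (4 + d) * ‖spaceSymbol d w‖ ^ 2 with hI
  have hI0 : 0 ≤ I := integral_nonneg fun w => by positivity
  refine ⟨C * (1 + cΨ) ^ 2 * ch⁻¹ * (I + 1), by positivity, ?_⟩
  intro Ψ h hΨm hhm hΨ0 hΨC hhc T₀ F hF hint t δ x hδ
  set ε := δ ^ α with hεdef
  have hε : 0 < ε := by positivity
  obtain ⟨hJ0, hJ⟩ := lintegral_energy hH hH1 hhm hF hint
  set J := (∫ q, symbolSquare F q ∂((timeCovariance H T₀).prod (spectralMeasure h))).re with hJdef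
  have hd0 : (d : ℝ) ≠ 0 := by
    have : (0 : ℝ) < d := hβ.trans hβd
    exact this.ne'
  have hnt : Nontrivial (Space d) := by
    have : NeZero d := ⟨fun h0 => hd0 (by simp [h0])⟩
    infer_instance
  have hne : ∀ᵐ ξ : Space d, ξ ≠ 0 := by
    rw [ae_iff]; simp
  have hEm : Measurable fun ξ => (energy H T₀ fun s => F s ξ).re :=
    Complex.measurable_re.comp (hF.measurable_energy H T₀)
  -- integrability in time for almost every frequency
  have hsec : ∀ᵐ ξ : Space d, Integrable
      (fun p : ℝ × ℝ => F p.1 ξ * (starRingEnd ℂ) (F p.2 ξ)) (timeCovariance H T₀) := by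
    have hsf : SFinite (spectralMeasure h) := by unfold spectralMeasure; infer_instance
    have h1 := hint.prod_left_ae
    rw [spectralMeasure, ae_withDensity_iff (by fun_prop)] at h1
    filter_upwards [h1, hne] with ξ h1 hξ
    refine h1 ?_
    have : 0 < ch * ‖ξ‖ ^ (-β) := mul_pos hch (Real.rpow_pos_of_pos (norm_pos_iff.2 hξ) _)
    simpa using this.trans_le (hhc ξ hξ)
  -- Cauchy–Schwarz in frequency: `a²` is the energy density of the noise norm, and `b²` is the
  -- explicit remaining weight.
  set a : Space d → ℝ≥0∞ := fun ξ =>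
    ENNReal.ofReal (√(h ξ * (energy H T₀ fun s => F s ξ).re)) with ha
  set A : ℝ := C * ε ^ (4 - 2 * H) * (1 + cΨ) ^ 2 * ch⁻¹ * (δ ^ β)⁻¹ with hA
  have hA0 : 0 < A := by positivity
  set b : Space d → ℝ≥0∞ := fun ξ => ENNReal.ofReal
    (√(A * ((1 + ‖δ • ξ‖) ^ (4 + d) * ‖spaceSymbol d (δ • ξ)‖ ^ 2))) with hb
  have hqm := (spaceSymbol d).continuous
  have ham : Measurable a := by fun_prop
  have hbm : Measurable b := by fun_prop
  have hpt : ∀ᵐ ξ : Space d, ‖timePairing Ψ T₀ t ε F ξ *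
      (spaceSymbol d (δ • ξ) * Complex.exp (Complex.I * (inner ℝ ξ x : ℝ)))‖ₑ ≤ a ξ * b ξ := by
    filter_upwards [hsec, hne] with ξ hξ hξ0
    have hn : 0 < ‖ξ‖ := norm_pos_iff.2 hξ0
    have k1 := hbound T₀ _ (hF.measurable_section ξ) (hF.integrableOn T₀ ξ) hξ t ε (Ψ ξ) hε (hΨ0 ξ)
    obtain ⟨N, -, hN⟩ := exists_energy_lower_bound hH hH1
    have hE0 := (hN T₀ _ (hF.measurable_section ξ) hξ).2.1
    have hhpos : 0 < h ξ :=
      (mul_pos hch (Real.rpow_pos_of_pos hn _)).trans_le (hhc ξ hξ0)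
    set E := (energy H T₀ fun s => F s ξ).re with hEdef
    have hΨ1 := hΨ0 ξ
    change ‖timePairing Ψ T₀ t ε F ξ‖ₑ ^ 2 ≤ _ at k1
    rw [← ofReal_norm, ← ENNReal.ofReal_pow (norm_nonneg _),
      ENNReal.ofReal_le_ofReal_iff (by positivity)] at k1
    have he : ‖Complex.exp (Complex.I * (inner ℝ ξ x : ℝ))‖ = 1 := by
      rw [mul_comm]; exact Complex.norm_exp_ofReal_mul_I _
    rw [← ofReal_norm, norm_mul, norm_mul, he, mul_one, ha, hb,
      ← ENNReal.ofReal_mul (Real.sqrt_nonneg _), ← Real.sqrt_mul (by positivity)]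
    refine ENNReal.ofReal_le_ofReal (Real.le_sqrt_of_sq_le ?_)
    have hδξ : ‖δ • ξ‖ = δ * ‖ξ‖ := by rw [norm_smul, Real.norm_of_nonneg hδ.le]
    have w1 : ‖δ • ξ‖ ^ α ≤ (1 + ‖δ • ξ‖) ^ 2 :=
      rpow_norm_le_one_add_pow (δ • ξ) (k := 2) hα.le (by exact_mod_cast hα2)
    have w2 : ‖δ • ξ‖ ^ β ≤ (1 + ‖δ • ξ‖) ^ d :=
      rpow_norm_le_one_add_pow (δ • ξ) hβ.le hβd.le
    -- The choice `ε = δ^α` makes `εΨ(ξ)` at most a constant times `‖δξ‖^α`, so the bound depends on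
    -- `δξ` alone.
    have w3 : 1 + ε * Ψ ξ ≤ (1 + cΨ) * (1 + ‖δ • ξ‖) ^ 2 := by
      have : ε * Ψ ξ ≤ cΨ * ‖δ • ξ‖ ^ α := by
        calc ε * Ψ ξ ≤ ε * (cΨ * ‖ξ‖ ^ α) := by gcongr; exact hΨC ξ
          _ = _ := by rw [hδξ, Real.mul_rpow hδ.le hn.le]; ring
      have o : 1 ≤ (1 + ‖δ • ξ‖) ^ 2 := one_le_pow₀ (by linarith [norm_nonneg (δ • ξ)])
      nlinarith
    -- Inserting the spectral density costs `‖ξ‖^β = δ^{-β} ‖δξ‖^β`.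
    have w4 : 1 ≤ ch⁻¹ * (δ ^ β)⁻¹ * (1 + ‖δ • ξ‖) ^ d * h ξ := by
      have e1 := hhc ξ hξ0
      rw [Real.rpow_neg hn.le] at e1
      have e2 : 1 ≤ ch⁻¹ * ‖ξ‖ ^ β * h ξ := by
        calc (1 : ℝ) = ch⁻¹ * ‖ξ‖ ^ β * (ch * (‖ξ‖ ^ β)⁻¹) := by
              have := (Real.rpow_pos_of_pos hn β).ne'
              field_simp
          _ ≤ _ := by gcongr
      refine e2.trans (mul_le_mul_of_nonneg_right ?_ hhpos.le)
      rw [mul_assoc]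
      refine mul_le_mul_of_nonneg_left ?_ (inv_nonneg.2 hch.le)
      rw [hδξ, Real.mul_rpow hδ.le hn.le, ← hδξ] at w2
      rw [inv_mul_eq_div, le_div_iff₀ (by positivity)]
      linarith
    calc (‖timePairing Ψ T₀ t ε F ξ‖ * ‖spaceSymbol d (δ • ξ)‖) ^ 2
        ≤ C * ε ^ (4 - 2 * H) * (1 + ε * Ψ ξ) ^ 2 * E * ‖spaceSymbol d (δ • ξ)‖ ^ 2 := by
          rw [mul_pow]
          gcongr
      _ ≤ C * ε ^ (4 - 2 * H) * ((1 + cΨ) * (1 + ‖δ • ξ‖) ^ 2) ^ 2 * E *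
            ‖spaceSymbol d (δ • ξ)‖ ^ 2 * 1 := by
          rw [mul_one]
          gcongr
      _ ≤ C * ε ^ (4 - 2 * H) * ((1 + cΨ) * (1 + ‖δ • ξ‖) ^ 2) ^ 2 * E *
            ‖spaceSymbol d (δ • ξ)‖ ^ 2 * (ch⁻¹ * (δ ^ β)⁻¹ * (1 + ‖δ • ξ‖) ^ d * h ξ) := by
          gcongr
      _ = _ := by rw [hA]; ring
  -- The change of variables `w = δξ` produces the factor `δ^{-d}`.
  have hb2 : ∫⁻ ξ, b ξ ^ 2 = ENNReal.ofReal (A * ((δ ^ d)⁻¹ * I)) := by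
    have i0 := integrable_one_add_norm_pow_mul_sq (spaceSymbol d) (4 + d)
    have i1 : Integrable fun ξ : Space d =>
        (1 + ‖δ • ξ‖) ^ (4 + d) * ‖spaceSymbol d (δ • ξ)‖ ^ 2 := i0.comp_smul hδ.ne'
    have i2 := Measure.integral_comp_smul_of_nonneg (μ := (volume : Measure (Space d)))
      (fun w => (1 + ‖w‖) ^ (4 + d) * ‖spaceSymbol d w‖ ^ 2) δ (hR := hδ.le)
    rw [finrank_euclideanSpace_fin, smul_eq_mul] at i2
    rw [← i2, ← integral_const_mul, ofReal_integral_eq_lintegral_ofReal (i1.const_mul A)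
      (Eventually.of_forall fun ξ => by positivity)]
    refine lintegral_congr fun ξ => ?_
    rw [hb, ← ENNReal.ofReal_pow (Real.sqrt_nonneg _), Real.sq_sqrt (by positivity)]
  have ha2 : ∫⁻ ξ, a ξ ^ 2 ≤ ENNReal.ofReal J := by
    rw [← hJ]
    refine lintegral_mono_ae ?_
    filter_upwards [hsec, hne] with ξ hξ hξ0
    obtain ⟨N, -, hN⟩ := exists_energy_lower_bound hH hH1
    have hE0 := (hN T₀ _ (hF.measurable_section ξ) hξ).2.1
    have hn : 0 < ‖ξ‖ := norm_pos_iff.2 hξ0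
    have hhpos : 0 < h ξ :=
      (mul_pos hch (Real.rpow_pos_of_pos hn _)).trans_le (hhc ξ hξ0)
    rw [ha, ← ENNReal.ofReal_pow (Real.sqrt_nonneg _), Real.sq_sqrt (by positivity),
      ENNReal.ofReal_mul hhpos.le]
  have hfin : ‖pairing Ψ T₀ t ε δ x F‖ₑ ^ 2 ≤ ENNReal.ofReal (J * (A * ((δ ^ d)⁻¹ * I))) := by
    calc ‖pairing Ψ T₀ t ε δ x F‖ₑ ^ 2 ≤ (∫⁻ ξ, a ξ * b ξ) ^ 2 := by
          gcongr
          exact (enorm_integral_le_lintegral_enorm _).trans (lintegral_mono_ae hpt)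
      _ ≤ (∫⁻ ξ, a ξ ^ 2) * ∫⁻ ξ, b ξ ^ 2 :=
          sq_lintegral_mul_le _ ham.aemeasurable hbm.aemeasurable
      _ ≤ ENNReal.ofReal J * ENNReal.ofReal (A * ((δ ^ d)⁻¹ * I)) := by
          rw [hb2]; gcongr
      _ = _ := (ENNReal.ofReal_mul hJ0).symm
  rw [← ofReal_norm, ← ENNReal.ofReal_pow (norm_nonneg _),
      ENNReal.ofReal_le_ofReal_iff (by positivity)] at hfin
  refine hfin.trans ?_
  calc J * (A * ((δ ^ d)⁻¹ * I)) ≤ J * (A * ((δ ^ d)⁻¹ * (I + 1))) := by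
        gcongr; linarith
    _ = _ := by rw [hA]; ring

end PairingBound

/-! ### The transition density -/

section Density

variable {d : ℕ} {Ω : Type*} [MeasurableSpace Ω] {P : Measure Ω} {X : ℝ≥0 → Ω → Space d}
  {Ψ : Space d → ℝ} {c α : ℝ}

/-- As `Ψ` is real, the characteristic function at time `1` has modulus `exp(-Ψ)`, and a logarithm
recovers `Ψ`. -/
theorem measurable_of_isCharacteristicExponent [IsProbabilityMeasure P]
    (hΨ : IsCharacteristicExponent P X Ψ) : Measurable Ψ := by
  have : Ψ = fun ξ => -Real.log ‖charFun (P.map (X 1)) ξ‖ := by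
    ext ξ
    rw [hΨ 1 ξ, Complex.norm_exp]
    simp
  rw [this]
  exact (Real.measurable_log.comp measurable_charFun.norm).neg

theorem integrable_exp_neg_norm_rpow (d : ℕ) [NeZero d] {b α : ℝ} (hb : 0 < b) (hα : 0 < α) :
    Integrable fun ξ : Space d => Real.exp (-b * ‖ξ‖ ^ α) := by
  have h := integrableOn_rpow_mul_exp_neg_mul_rpow (s := (d - 1 : ℕ)) (b := b)
    (lt_of_lt_of_le (by norm_num) (Nat.cast_nonneg _)) hα hb
  refine (integrable_fun_norm_addHaar (volume : Measure (Space d))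
    (f := fun y => Real.exp (-b * y ^ α))).2 ?_
  rw [finrank_euclideanSpace_fin]
  refine h.congr_fun (fun y _ => ?_) measurableSet_Ioi
  simp [Real.rpow_natCast]

theorem integrable_exp_neg_exponent [NeZero d] (hΨm : Measurable Ψ) (hc : 0 < c) (hα : 0 < α)
    (hΨc : ∀ ξ, c * ‖ξ‖ ^ α ≤ Ψ ξ) {τ : ℝ} (hτ : 0 < τ) :
    Integrable fun ξ : Space d => Complex.exp (-(τ : ℂ) * (Ψ ξ : ℂ)) := by
  refine (integrable_exp_neg_norm_rpow d (mul_pos hτ hc) hα).mono' (by fun_prop)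
    (Eventually.of_forall fun ξ => ?_)
  rw [Complex.norm_exp]
  refine Real.exp_le_exp.2 ?_
  have := mul_le_mul_of_nonneg_left (hΨc ξ) hτ.le
  simp
  linarith

theorem norm_exp_neg_I_mul (r : ℝ) : ‖Complex.exp (-Complex.I * (r : ℂ))‖ = 1 := by
  rw [show -Complex.I * (r : ℂ) = ((-r : ℝ) : ℂ) * Complex.I by push_cast; ring]
  exact Complex.norm_exp_ofReal_mul_I _

theorem continuous_transitionDensity [NeZero d] (hΨm : Measurable Ψ) (hc : 0 < c) (hα : 0 < α)
    (hΨc : ∀ ξ, c * ‖ξ‖ ^ α ≤ Ψ ξ) {τ : ℝ} (hτ : 0 < τ) :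
    Continuous (transitionDensity Ψ τ) := by
  have hi := integrable_exp_neg_exponent hΨm hc hα hΨc hτ
  refine Complex.continuous_re.comp (continuous_const.mul ?_)
  refine continuous_of_dominated (bound := fun ξ => ‖Complex.exp (-(τ : ℂ) * (Ψ ξ : ℂ))‖)
    (fun x => ?_) (fun x => Eventually.of_forall fun ξ => ?_) hi.norm
    (Eventually.of_forall fun ξ => by fun_prop)
  · exact (Continuous.aestronglyMeasurable (by fun_prop)).mul hi.aestronglyMeasurable
  · rw [norm_mul, norm_exp_neg_I_mul, one_mul]

/-- The transition density is a nonnegative integrable function with Fourier transform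
`exp(-τ Ψ)`. -/
theorem transitionDensity_fourier [NeZero d] [IsProbabilityMeasure P]
    (hX : ∀ t, Measurable (X t)) (hΨ : IsCharacteristicExponent P X Ψ)
    (hp : HasTransitionDensity P X Ψ) (hc : 0 < c) (hα : 0 < α)
    (hΨc : ∀ ξ, c * ‖ξ‖ ^ α ≤ Ψ ξ) {τ : ℝ} (hτ : 0 < τ) :
    Integrable (transitionDensity Ψ τ) ∧ ∀ ξ, ∫ z, Complex.exp (Complex.I * (inner ℝ ξ z : ℝ)) *
      (transitionDensity Ψ τ z : ℂ) = Complex.exp (-(τ : ℂ) * (Ψ ξ : ℂ)) := by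
  have hΨm := measurable_of_isCharacteristicExponent hΨ
  have hcont := continuous_transitionDensity hΨm hc hα hΨc hτ
  set p := transitionDensity Ψ τ with hpdef
  -- The law of `X τ` determines only the positive part of `p`, since the density passes through
  -- `ENNReal.ofReal`. The work is done with `f` until Fourier inversion identifies it with `p`.
  set f : Space d → ℝ := fun x => max (p x) 0 with hf
  have hfc : Continuous f := hcont.max continuous_const
  have hlaw : P.map (X τ.toNNReal) = volume.withDensity fun x => ENNReal.ofReal (p x) := by
    have := hp τ.toNNReal (by simpa using hτ)
    rwa [Real.coe_toNNReal _ hτ.le] at this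
  have hfi : Integrable f := by
    refine ⟨hfc.aestronglyMeasurable, ?_⟩
    have hprob : IsProbabilityMeasure (P.map (X τ.toNNReal)) :=
      Measure.isProbabilityMeasure_map (hX _).aemeasurable
    have h1 : ∫⁻ x, ENNReal.ofReal (p x) = 1 := by
      have := hprob.measure_univ
      rwa [hlaw, withDensity_apply _ MeasurableSet.univ, Measure.restrict_univ] at this
    have hf0 : ∀ x, 0 ≤ f x := fun x => le_max_right _ _
    rw [hasFiniteIntegral_iff_ofReal (Eventually.of_forall hf0)]
    calc ∫⁻ x, ENNReal.ofReal (f x) = 1 := by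
          rw [← h1]
          refine lintegral_congr fun x => ?_
          rw [hf]; simp [ENNReal.ofReal_max]
      _ < ∞ := ENNReal.one_lt_top
  have hchar : ∀ ξ, ∫ z, Complex.exp (Complex.I * (inner ℝ ξ z : ℝ)) * (f z : ℂ) =
      Complex.exp (-(τ : ℂ) * (Ψ ξ : ℂ)) := by
    intro ξ
    have := hΨ τ.toNNReal ξ
    rw [hlaw, charFun_apply, integral_withDensity_eq_integral_toReal_smul (by fun_prop)
      (by simp)] at this
    rw [show ((τ.toNNReal : ℝ≥0) : ℂ) = ((τ.toNNReal : ℝ) : ℂ) from rfl,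
      Real.coe_toNNReal _ hτ.le] at this
    rw [← this]
    refine integral_congr_ae (Eventually.of_forall fun z => ?_)
    simp only [Complex.real_smul, ENNReal.toReal_ofReal']
    rw [hf, real_inner_comm, mul_comm Complex.I, mul_comm]
  set g : Space d → ℂ := fun x => (f x : ℂ) with hg
  have hgi : Integrable g := hfi.ofReal
  have hgc : Continuous g := Complex.continuous_ofReal.comp hfc
  have hE := integrable_exp_neg_exponent hΨm hc hα hΨc hτ
  have hFg : ∀ w, FourierTransform.fourier g w =
      Complex.exp (-(τ : ℂ) * (Ψ (-(2 * Real.pi) • w) : ℂ)) := by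
    intro w
    rw [← hchar, Real.fourier_eq']
    refine integral_congr_ae (Eventually.of_forall fun z => ?_)
    simp only [smul_eq_mul]
    rw [inner_smul_left, real_inner_comm]
    congr 2
    rw [mul_comm]
    congr 2
    simp
  have hFgi : Integrable (FourierTransform.fourier g) := by
    have h2 : (-(2 * Real.pi)) ≠ 0 := by simp [Real.pi_ne_zero]
    exact (hE.comp_smul h2).congr (Eventually.of_forall fun w => (hFg w).symm)
  have hinv := hgc.fourierInv_fourier_eq hgi hFgi
  -- Inversion for the continuous function `f` holds at every point, and after the substitution of
  -- `-2πv` for the frequency it is the integral that defines `p`.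
  have hpf : p = f := by
    ext x
    have h1 := congrFun hinv x
    rw [Real.fourierInv_eq'] at h1
    have h2 := Measure.integral_comp_smul (μ := (volume : Measure (Space d)))
      (fun ξ => Complex.exp (-Complex.I * (inner ℝ ξ x : ℝ)) *
        Complex.exp (-(τ : ℂ) * (Ψ ξ : ℂ))) (-(2 * Real.pi))
    have h3 : ∫ v, Complex.exp (((2 * Real.pi * inner ℝ v x : ℝ) : ℂ) * Complex.I) •
        FourierTransform.fourier g v = ∫ ξ : Space d,
          Complex.exp (-Complex.I * (inner ℝ (-(2 * Real.pi) • ξ) x : ℝ)) *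
            Complex.exp (-(τ : ℂ) * (Ψ (-(2 * Real.pi) • ξ) : ℂ)) := by
      refine integral_congr_ae (Eventually.of_forall fun v => ?_)
      simp only [hFg, smul_eq_mul]
      rw [inner_smul_left]
      congr 2
      push_cast
      simp
      ring
    rw [h3, h2, finrank_euclideanSpace_fin, Complex.real_smul] at h1
    have h4 : ((|((-(2 * Real.pi)) ^ d)⁻¹| : ℝ) : ℂ) = ((2 * Real.pi : ℝ) : ℂ) ^ (-(d : ℤ)) := by
      rw [abs_inv, abs_pow, abs_neg, abs_of_pos (by positivity), zpow_neg, zpow_natCast]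
      push_cast
      rfl
    rw [h4] at h1
    have h5 := congrArg Complex.re h1
    exact h5.trans (Complex.ofReal_re _)
  rw [hpf]
  exact ⟨hfi, hchar⟩

/-- At time `0` the integrand has modulus one and is not integrable, so the Bochner integral takes
its default value. The Green kernel therefore vanishes at `s = t`, which is why `greenSymbol` lives
on a half-open interval. -/
theorem transitionDensity_zero [NeZero d] (x : Space d) : transitionDensity Ψ 0 x = 0 := by
  rw [transitionDensity, integral_undef, mul_zero, Complex.zero_re]
  intro h
  have h1 : Integrable fun _ : Space d => (1 : ℝ) := by
    refine h.norm.congr (Eventually.of_forall fun ξ => ?_)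
    simp only [norm_mul, norm_exp_neg_I_mul]
    simp
  rw [integrable_const_iff] at h1
  have := h1.resolve_left one_ne_zero
  exact this.measure_univ_lt_top.ne (measure_univ_of_isAddLeftInvariant _)

end Density

/-! ### The Fourier transform of the Green kernel -/

section Green

variable {d : ℕ} {Ω : Type*} [MeasurableSpace Ω] {P : Measure Ω} {X : ℝ≥0 → Ω → Space d}
  {Ψ : Space d → ℝ} {c α : ℝ}

/-- The Fourier transform in space of the Green kernel. -/
def greenSymbol (Ψ : Space d → ℝ) (t : ℝ) (x : Space d) (s : ℝ) (ξ : Space d) : ℂ :=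
  (Set.Ico 0 t).indicator (fun s => Complex.exp (-Complex.I * (inner ℝ ξ x : ℝ)) *
    Complex.exp (-((t - s : ℝ) : ℂ) * (Ψ ξ : ℂ))) s

theorem integrable_greenKernel [NeZero d] [IsProbabilityMeasure P]
    (hX : ∀ t, Measurable (X t)) (hΨ : IsCharacteristicExponent P X Ψ)
    (hp : HasTransitionDensity P X Ψ) (hc : 0 < c) (hα : 0 < α)
    (hΨc : ∀ ξ, c * ‖ξ‖ ^ α ≤ Ψ ξ) (t : ℝ) (x : Space d) (s : ℝ) :
    Integrable fun y => greenKernel Ψ t x (s, y) := by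
  by_cases hs : s ∈ Set.Icc 0 t
  · simp only [greenKernel, Set.indicator_of_mem hs]
    rcases hs.2.eq_or_lt with rfl | hst
    · simp [transitionDensity_zero]
    · exact (transitionDensity_fourier hX hΨ hp hc hα hΨc (sub_pos.2 hst)).1.comp_sub_left x
  · simp [greenKernel, Set.indicator_of_notMem hs]

theorem spaceFourier_greenKernel [NeZero d] [IsProbabilityMeasure P]
    (hX : ∀ t, Measurable (X t)) (hΨ : IsCharacteristicExponent P X Ψ)
    (hp : HasTransitionDensity P X Ψ) (hc : 0 < c) (hα : 0 < α)
    (hΨc : ∀ ξ, c * ‖ξ‖ ^ α ≤ Ψ ξ) (t : ℝ) (x : Space d) (s : ℝ) (ξ : Space d) :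
    spaceFourier (greenKernel Ψ t x) s ξ = greenSymbol Ψ t x s ξ := by
  by_cases hs : s ∈ Set.Ico 0 t
  · have hs' : s ∈ Set.Icc 0 t := Set.Ico_subset_Icc_self hs
    have h := (transitionDensity_fourier hX hΨ hp hc hα hΨc (sub_pos.2 hs.2)).2 ξ
    simp only [spaceFourier, greenKernel, greenSymbol, Set.indicator_of_mem hs,
      Set.indicator_of_mem hs']
    rw [← h, ← integral_const_mul, ← integral_sub_left_eq_self _ volume x]
    refine integral_congr_ae (Eventually.of_forall fun z => ?_)
    simp only [sub_sub_cancel]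
    rw [← mul_assoc, ← Complex.exp_add, inner_sub_right]
    congr 2
    push_cast
    ring
  · have h0 : ∀ y, greenKernel Ψ t x (s, y) = 0 := by
      intro y
      by_cases hs' : s ∈ Set.Icc 0 t
      · have : s = t := le_antisymm hs'.2 (not_lt.1 fun h => hs ⟨hs'.1, h⟩)
        simp [greenKernel, this, transitionDensity_zero]
      · simp [greenKernel, Set.indicator_of_notMem hs']
    simp [spaceFourier, greenSymbol, Set.indicator_of_notMem hs, h0]

theorem boundedSymbol_greenSymbol (hΨm : Measurable Ψ) (hΨ0 : ∀ ξ, 0 ≤ Ψ ξ) (t : ℝ)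
    (x : Space d) : BoundedSymbol (greenSymbol Ψ t x) := by
  refine ⟨?_, 1, fun s ξ => ?_⟩
  · have : Function.uncurry (greenSymbol Ψ t x) = (Prod.fst ⁻¹' Set.Ico 0 t).indicator
        fun p : ℝ × Space d => Complex.exp (-Complex.I * (inner ℝ p.2 x : ℝ)) *
          Complex.exp (-((t - p.1 : ℝ) : ℂ) * (Ψ p.2 : ℂ)) := by
      ext p
      by_cases hp : p.1 ∈ Set.Ico 0 t
      · simp only [Function.uncurry, greenSymbol, Set.indicator_of_mem hp]
        rw [Set.indicator_of_mem (by exact hp)]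
      · simp only [Function.uncurry, greenSymbol, Set.indicator_of_notMem hp]
        rw [Set.indicator_of_notMem (by exact hp)]
    rw [this]
    refine Measurable.indicator ?_ (measurableSet_Ico.preimage measurable_fst)
    fun_prop
  · by_cases hs : s ∈ Set.Ico 0 t
    · rw [greenSymbol, Set.indicator_of_mem hs, norm_mul, norm_exp_neg_I_mul, one_mul,
        Complex.norm_exp]
      refine Real.exp_le_one_iff.2 ?_
      rw [← Complex.ofReal_neg, ← Complex.ofReal_mul, Complex.ofReal_re]
      have := mul_nonneg (sub_nonneg.2 hs.2.le) (hΨ0 ξ)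
      linarith
    · simp [greenSymbol, Set.indicator_of_notMem hs]

/-- On `[0, t')` the integrand is the exact derivative of `exp(-(t'-s)Ψ) κ(s)`, up to a phase, so
only endpoint values remain. The one at `0` vanishes because `ε ≤ t`, and past `t'` the symbol is
zero. -/
theorem timePairing_greenSymbol {T₀ t ε t' : ℝ} (ht' : 0 ≤ t') (ht'T : t' ≤ T₀) (hε : 0 < ε)
    (hεt : ε ≤ t) (x : Space d) (ξ : Space d) :
    timePairing Ψ T₀ t ε (greenSymbol Ψ t' x) ξ =
      Complex.exp (-Complex.I * (inner ℝ ξ x : ℝ)) * (timeTest t ε t' : ℂ) := by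
  set g : ℝ → ℝ := fun s => Real.exp (-(t' - s) * Ψ ξ) * timeTest t ε s with hg
  have hder : ∀ s, HasDerivAt g
      (Real.exp (-(t' - s) * Ψ ξ) * (timeTestDeriv t ε s + Ψ ξ * timeTest t ε s)) s := by
    intro s
    have h1 : HasDerivAt (fun s => -(t' - s) * Ψ ξ) (Ψ ξ) s := by
      have := (((hasDerivAt_id s).const_sub t').neg).mul_const (Ψ ξ)
      simpa using this
    refine (h1.exp.mul (hasDerivAt_timeTest t ε s)).congr_deriv ?_
    ring
  have hcont : Continuous fun s =>
      Real.exp (-(t' - s) * Ψ ξ) * (timeTestDeriv t ε s + Ψ ξ * timeTest t ε s) :=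
    Continuous.mul (by fun_prop) (continuous_timeKernel t ε (Ψ ξ))
  have hftc := intervalIntegral.integral_eq_sub_of_hasDerivAt (fun s _ => hder s)
    (hcont.intervalIntegrable 0 t')
  have h0 : g 0 = 0 := by
    rw [hg]
    simp [timeTest_eq_zero hε (Or.inl (by linarith : (0 : ℝ) ≤ t - ε))]
  have h1 : g t' = timeTest t ε t' := by simp [hg]
  rw [h0, h1, sub_zero, intervalIntegral.integral_of_le ht', ← integral_Ico_eq_integral_Ioc] at hftc
  rw [← hftc, ← integral_complex_ofReal, ← integral_const_mul, timePairing,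
    ← integral_indicator measurableSet_Icc, ← integral_indicator measurableSet_Ico]
  refine integral_congr_ae (Eventually.of_forall fun s => ?_)
  by_cases hs : s ∈ Set.Ico 0 t'
  · have hs' : s ∈ Set.Icc 0 T₀ := ⟨hs.1, hs.2.le.trans ht'T⟩
    simp only [Set.indicator_of_mem hs, Set.indicator_of_mem hs', greenSymbol]
    push_cast
    ring
  · simp [Set.indicator_of_notMem hs, greenSymbol]

/-- Once time is integrated out, the frequency integral is an inverse Fourier transform at `x - x'`.
The pairing thus localizes each Green kernel to a compactly supported function of its base point. -/
theorem pairing_greenSymbol {T₀ t ε δ t' : ℝ} (ht' : 0 ≤ t') (ht'T : t' ≤ T₀) (hε : 0 < ε)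
    (hεt : ε ≤ t) (hδ : 0 < δ) (x x' : Space d) :
    pairing Ψ T₀ t ε δ x (greenSymbol Ψ t' x') =
      (timeTest t ε t' * ((δ ^ d)⁻¹ * spaceBump d ((2 * Real.pi)⁻¹ • δ⁻¹ • (x - x'))) : ℝ) := by
  rw [Complex.ofReal_mul, ← integral_spaceSymbol_smul hδ, ← integral_const_mul, pairing]
  refine integral_congr_ae (Eventually.of_forall fun ξ => ?_)
  simp only [timePairing_greenSymbol ht' ht'T hε hεt]
  have : Complex.exp (Complex.I * (inner ℝ ξ (x - x') : ℝ)) =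
      Complex.exp (-Complex.I * (inner ℝ ξ x' : ℝ)) * Complex.exp (Complex.I * (inner ℝ ξ x : ℝ)) := by
    rw [← Complex.exp_add, inner_sub_right]
    congr 1
    push_cast
    ring
  rw [this]
  ring

end Green

/-! ### Test functions -/

/-- Polar coordinates. It serves twice: for `|s|^{2H-2}` on the line and for `‖ξ‖^{-β}` near the
zero frequency. -/
theorem integrableOn_norm_rpow_ball {E : Type*} [NormedAddCommGroup E] [NormedSpace ℝ E]
    [FiniteDimensional ℝ E] [Nontrivial E] [MeasurableSpace E] [BorelSpace E] (μ : Measure E)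
    [μ.IsAddHaarMeasure] {s : ℝ} (hs : -s < Module.finrank ℝ E) (r : ℝ) :
    IntegrableOn (fun x : E => ‖x‖ ^ s) (Metric.ball 0 r) μ := by
  rcases le_or_gt r 0 with hr | hr
  · simp [Metric.ball_eq_empty.2 hr]
  refine (integrableOn_fun_norm_addHaar μ (f := fun y => y ^ s)).2 ?_
  have hd : 0 < Module.finrank ℝ E := Module.finrank_pos
  refine ((intervalIntegral.integrableOn_Ioo_rpow_iff (s := s + (Module.finrank ℝ E - 1 : ℕ))
    hr).2 ?_).congr_fun (fun y hy => ?_) measurableSet_Ioo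
  · rw [Nat.cast_sub hd]; push_cast; linarith
  · simp only [smul_eq_mul]
    rw [Real.rpow_add hy.1, Real.rpow_natCast, mul_comm]

theorem isFiniteMeasure_timeCovariance {H : ℝ} (hH : 1 / 2 ≤ H) (hH1 : H < 1) (T₀ : ℝ) :
    IsFiniteMeasure (timeCovariance H T₀) := by
  rcases hH.eq_or_lt with rfl | hH
  · rw [timeCovariance, if_pos rfl]
    infer_instance
  · rw [timeCovariance, if_neg hH.ne']
    set g : ℝ → ℝ≥0∞ := fun x => ENNReal.ofReal (H * (2 * H - 1) * |x| ^ (2 * H - 2)) with hg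
    have hgm : Measurable g := by fun_prop
    have hfin : ∫⁻ x in Metric.ball 0 (T₀ + 1), g x < ∞ := by
      have := (integrableOn_norm_rpow_ball (volume : Measure ℝ) (s := 2 * H - 2)
        (by simp; linarith) (T₀ + 1)).const_mul (H * (2 * H - 1))
      exact this.lintegral_lt_top
    refine isFiniteMeasure_withDensity ?_
    rw [lintegral_prod _ (by fun_prop)]
    refine ne_of_lt ?_
    calc ∫⁻ s in Set.Icc 0 T₀, ∫⁻ r in Set.Icc 0 T₀, g (s - r)
        ≤ ∫⁻ s in Set.Icc 0 T₀, ∫⁻ x in Metric.ball 0 (T₀ + 1), g x := by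
          refine setLIntegral_mono' measurableSet_Icc fun s hs => ?_
          rw [← lintegral_indicator measurableSet_ball, ← lintegral_indicator measurableSet_Icc,
            ← lintegral_sub_left_eq_self ((Metric.ball (0 : ℝ) (T₀ + 1)).indicator fun x => g x) s]
          refine lintegral_mono fun r => ?_
          by_cases hr : r ∈ Set.Icc 0 T₀
          · have : s - r ∈ Metric.ball (0 : ℝ) (T₀ + 1) := by
              rw [mem_ball_zero_iff, Real.norm_eq_abs, abs_lt]
              constructor <;> linarith [hr.1, hr.2, hs.1, hs.2]
            rw [Set.indicator_of_mem hr, Set.indicator_of_mem this]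
          · simp [Set.indicator_of_notMem hr]
      _ < ∞ := by
          rw [lintegral_const]
          exact ENNReal.mul_lt_top hfin (measure_lt_top _ _)

section TestFunction

variable {d : ℕ} {φ : ℝ × Space d → ℝ}

theorem hasCompactSupport_section (hs : HasCompactSupport φ) (s : ℝ) :
    HasCompactSupport fun y => φ (s, y) := by
  refine HasCompactSupport.intro (hs.image continuous_snd) fun y hy => ?_
  by_contra h
  exact hy ⟨(s, y), subset_tsupport _ h, rfl⟩

theorem integrable_section (hc : Continuous φ) (hs : HasCompactSupport φ) (s : ℝ) :
    Integrable fun y => φ (s, y) :=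
  (hc.comp (Continuous.prodMk_right s)).integrable_of_hasCompactSupport
    (hasCompactSupport_section hs s)

theorem boundedSymbol_spaceFourier (hc : Continuous φ) (hs : HasCompactSupport φ) :
    BoundedSymbol (spaceFourier φ) := by
  obtain ⟨M, hM⟩ := hs.exists_bound_of_continuous hc
  constructor
  · have : Continuous fun p : (ℝ × Space d) × Space d =>
        Complex.exp (-Complex.I * (inner ℝ p.1.2 p.2 : ℝ)) * (φ (p.1.1, p.2) : ℂ) := by fun_prop
    exact this.stronglyMeasurable.integral_prod_right'.measurable
  · set K := Prod.snd '' tsupport φ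
    have hK : IsCompact K := hs.image continuous_snd
    refine ⟨M * volume.real K, fun s ξ => ?_⟩
    have h0 : ∀ y, y ∉ K → Complex.exp (-Complex.I * (inner ℝ ξ y : ℝ)) * (φ (s, y) : ℂ) = 0 := by
      intro y hy
      have : φ (s, y) = 0 := by
        by_contra h
        exact hy ⟨(s, y), subset_tsupport _ h, rfl⟩
      simp [this]
    rw [spaceFourier, ← setIntegral_eq_integral_of_forall_compl_eq_zero h0]
    refine norm_setIntegral_le_of_norm_le_const hK.measure_lt_top fun y _ => ?_
    rw [norm_mul, norm_exp_neg_I_mul, one_mul, Complex.norm_real]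
    exact hM _

/-- Plancherel on each time slice; the slices share a compact support and a bound, whence uniformity
in `s`. -/
theorem exists_lintegral_spaceFourier_sq_le (hc : ContDiff ℝ (⊤ : ℕ∞) φ) (hs : HasCompactSupport φ) :
    ∃ D : ℝ, ∀ s, ∫⁻ ξ, ‖spaceFourier φ s ξ‖ₑ ^ 2 ≤ ENNReal.ofReal D := by
  obtain ⟨M, hM⟩ := hs.exists_bound_of_continuous hc.continuous
  set K := Prod.snd '' tsupport φ
  have hK : IsCompact K := hs.image continuous_snd
  refine ⟨(2 * Real.pi) ^ d * (M ^ 2 * volume.real K), fun s => ?_⟩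
  have hcs : HasCompactSupport fun y => (φ (s, y) : ℂ) :=
    (hasCompactSupport_section hs s).comp_left (g := fun r : ℝ => (r : ℂ)) Complex.ofReal_zero
  have hcd : ContDiff ℝ (⊤ : ℕ∞) fun y => (φ (s, y) : ℂ) :=
    Complex.ofRealCLM.contDiff.comp (hc.comp (contDiff_prodMk_right s))
  set f : SchwartzMap (Space d) ℂ := hcs.toSchwartzMap hcd with hf
  have hfour : ∀ ξ, spaceFourier φ s ξ = FourierTransform.fourier f ((2 * Real.pi)⁻¹ • ξ) := by
    intro ξ
    rw [SchwartzMap.fourier_coe, Real.fourier_eq', spaceFourier]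
    refine integral_congr_ae (Eventually.of_forall fun y => ?_)
    simp only [smul_eq_mul, inner_smul_right]
    rw [real_inner_comm]
    have : -2 * Real.pi * ((2 * Real.pi)⁻¹ * inner ℝ y ξ) = -inner ℝ y ξ := by field_simp
    rw [this]
    congr 2
    push_cast
    ring
  have hi : Integrable fun ξ : Space d =>
      ‖(FourierTransform.fourier f : SchwartzMap (Space d) ℂ) ξ‖ ^ 2 := by
    simpa using integrable_one_add_norm_pow_mul_sq
      (FourierTransform.fourier f : SchwartzMap (Space d) ℂ) 0
  have hi' := hi.comp_smul (R := (2 * Real.pi)⁻¹) (by positivity)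
  have h2 := Measure.integral_comp_smul_of_nonneg (μ := (volume : Measure (Space d)))
    (fun ξ : Space d => ‖(FourierTransform.fourier f : SchwartzMap (Space d) ℂ) ξ‖ ^ 2)
    (2 * Real.pi)⁻¹ (hR := by positivity)
  rw [SchwartzMap.integral_norm_sq_fourier, finrank_euclideanSpace_fin] at h2
  calc ∫⁻ ξ, ‖spaceFourier φ s ξ‖ₑ ^ 2
      = ∫⁻ ξ, ENNReal.ofReal (‖(FourierTransform.fourier f : SchwartzMap (Space d) ℂ)
          ((2 * Real.pi)⁻¹ • ξ)‖ ^ 2) := by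
        refine lintegral_congr fun ξ => ?_
        rw [hfour, ← ofReal_norm, ENNReal.ofReal_pow (norm_nonneg _)]
    _ = ENNReal.ofReal ((((2 * Real.pi)⁻¹) ^ d)⁻¹ • ∫ y, ‖f y‖ ^ 2) := by
        rw [← h2, ofReal_integral_eq_lintegral_ofReal hi'
          (Eventually.of_forall fun ξ => by positivity)]
    _ ≤ _ := by
        refine ENNReal.ofReal_le_ofReal ?_
        rw [inv_pow, inv_inv, smul_eq_mul]
        gcongr
        have h0 : ∀ y, y ∉ K → ‖f y‖ ^ 2 = 0 := by
          intro y hy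
          have : f y = 0 := by
            change (φ (s, y) : ℂ) = 0
            rw [Complex.ofReal_eq_zero]
            by_contra h
            exact hy ⟨(s, y), subset_tsupport _ h, rfl⟩
          simp [this]
        rw [← setIntegral_eq_integral_of_forall_compl_eq_zero h0]
        refine (le_abs_self _).trans ?_
        rw [← Real.norm_eq_abs]
        refine norm_setIntegral_le_of_norm_le_const hK.measure_lt_top fun y _ => ?_
        rw [norm_pow, norm_norm]
        have : ‖f y‖ ≤ M := by
          change ‖(φ (s, y) : ℂ)‖ ≤ M
          rw [Complex.norm_real]
          exact hM _
        gcongr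

/-- Near `ξ = 0` the transform is bounded and `‖ξ‖^{-β}` is integrable because `β < d`; elsewhere
`h` is bounded and Plancherel applies. Cauchy–Schwarz handles two different times, and the time
covariance is finite. Absolute convergence is what allows the energy to be disintegrated over
frequencies. -/
theorem integrable_symbolSquare_spaceFourier {H β C : ℝ} (hH : 1 / 2 ≤ H) (hH1 : H < 1)
    {h : Space d → ℝ} (hh : Measurable h) (hβ : 0 < β) (hβd : β < d) (hC : 0 < C)
    (hhC : ∀ ξ, ξ ≠ 0 → h ξ ≤ C * ‖ξ‖ ^ (-β)) (T₀ : ℝ) (hc : ContDiff ℝ (⊤ : ℕ∞) φ)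
    (hs : HasCompactSupport φ) :
    Integrable (symbolSquare (spaceFourier φ))
      ((timeCovariance H T₀).prod (spectralMeasure h)) := by
  have hfin := isFiniteMeasure_timeCovariance hH hH1 T₀
  have hsf : SFinite (spectralMeasure h) := by unfold spectralMeasure; infer_instance
  have hF := boundedSymbol_spaceFourier hc.continuous hs
  obtain ⟨B, hB⟩ := hF.bounded
  obtain ⟨D, hD⟩ := exists_lintegral_spaceFourier_sq_le hc hs
  have hnt : Nontrivial (Space d) := by
    have : NeZero d := ⟨fun h0 => by simp [h0] at hβd; linarith⟩
    infer_instance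
  have hne : ∀ᵐ ξ : Space d, ξ ≠ 0 := by
    rw [ae_iff]; simp
  have hball := integrableOn_norm_rpow_ball (volume : Measure (Space d)) (s := -β)
    (by simpa using hβd) 1
  set A : ℝ≥0∞ := ENNReal.ofReal C * ((∫⁻ ξ in Metric.ball (0 : Space d) 1,
    ENNReal.ofReal (‖ξ‖ ^ (-β))) * ENNReal.ofReal B ^ 2 + ENNReal.ofReal D) with hA
  have hAfin : A < ∞ := by
    refine ENNReal.mul_lt_top ENNReal.ofReal_lt_top (ENNReal.add_lt_top.2
      ⟨ENNReal.mul_lt_top hball.lintegral_lt_top (by simp), ENNReal.ofReal_lt_top⟩)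
  have hsecm : ∀ s, Measurable fun ξ => ‖spaceFourier φ s ξ‖ₑ := fun s =>
    (hF.measurable.comp (by fun_prop : Measurable fun ξ : Space d => (s, ξ))).enorm
  have hbound : ∀ s, ∫⁻ ξ, ‖spaceFourier φ s ξ‖ₑ ^ 2 ∂(spectralMeasure h) ≤ A := by
    intro s
    rw [spectralMeasure, lintegral_withDensity_eq_lintegral_mul₀ (by fun_prop)
      ((hsecm s).pow_const 2).aemeasurable]
    have hnorm : Measurable fun ξ : Space d => ENNReal.ofReal (‖ξ‖ ^ (-β)) := by fun_prop
    calc ∫⁻ ξ, ENNReal.ofReal (h ξ) * ‖spaceFourier φ s ξ‖ₑ ^ 2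
        ≤ ∫⁻ ξ, ENNReal.ofReal C * ((Metric.ball (0 : Space d) 1).indicator
            (fun ξ => ENNReal.ofReal (‖ξ‖ ^ (-β))) ξ * ENNReal.ofReal B ^ 2 +
              ‖spaceFourier φ s ξ‖ₑ ^ 2) := by
          refine lintegral_mono_ae (hne.mono fun ξ hξ => ?_)
          calc ENNReal.ofReal (h ξ) * ‖spaceFourier φ s ξ‖ₑ ^ 2
              ≤ ENNReal.ofReal (C * ‖ξ‖ ^ (-β)) * ‖spaceFourier φ s ξ‖ₑ ^ 2 := by
                gcongr
                exact hhC ξ hξ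
            _ ≤ _ := by
                rw [ENNReal.ofReal_mul hC.le, mul_assoc]
                gcongr
                by_cases hb : ξ ∈ Metric.ball (0 : Space d) 1
                · rw [Set.indicator_of_mem hb]
                  refine le_add_right ?_
                  gcongr
                  rw [← ofReal_norm]
                  exact ENNReal.ofReal_le_ofReal (hB s ξ)
                · refine le_add_left (mul_le_of_le_one_left (by simp) ?_)
                  rw [mem_ball_zero_iff, not_lt] at hb
                  exact ENNReal.ofReal_le_one.2
                    (Real.rpow_le_one_of_one_le_of_nonpos hb (by linarith))
      _ ≤ A := by
          rw [lintegral_const_mul' _ _ ENNReal.ofReal_ne_top,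
            lintegral_add_left ((hnorm.indicator measurableSet_ball).mul_const _),
            lintegral_mul_const' _ _ (by simp), lintegral_indicator measurableSet_ball]
          rw [hA]
          gcongr
          exact hD s
  refine ⟨hF.measurable_symbolSquare.aestronglyMeasurable, ?_⟩
  rw [HasFiniteIntegral, lintegral_prod _ hF.measurable_symbolSquare.enorm.aemeasurable]
  calc ∫⁻ p, ∫⁻ ξ, ‖symbolSquare (spaceFourier φ) (p, ξ)‖ₑ ∂(spectralMeasure h)
        ∂(timeCovariance H T₀)
      ≤ ∫⁻ _, A ∂(timeCovariance H T₀) := by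
        refine lintegral_mono fun p => ?_
        rw [← ENNReal.pow_le_pow_left_iff (n := 2) (by simp)]
        calc (∫⁻ ξ, ‖symbolSquare (spaceFourier φ) (p, ξ)‖ₑ ∂(spectralMeasure h)) ^ 2
            = (∫⁻ ξ, ‖spaceFourier φ p.1 ξ‖ₑ * ‖spaceFourier φ p.2 ξ‖ₑ
                ∂(spectralMeasure h)) ^ 2 := by
              congr 1
              refine lintegral_congr fun ξ => ?_
              rw [symbolSquare, enorm_mul]
              congr 1
              simp [← ofReal_norm]
          _ ≤ _ := sq_lintegral_mul_le _ (hsecm _).aemeasurable (hsecm _).aemeasurable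
          _ ≤ A * A := mul_le_mul' (hbound _) (hbound _)
          _ = A ^ 2 := (sq A).symm
    _ < ∞ := by
        rw [lintegral_const]
        exact ENNReal.mul_lt_top hAfin (measure_lt_top _ _)

end TestFunction

/-! ### Square integrable and Gaussian random variables -/

section Gaussian

variable {Ω : Type*} [MeasurableSpace Ω] {Q : Measure Ω}

theorem sq_toReal_eLpNorm_two {f : Ω → ℝ} (hf : MemLp f 2 Q) :
    (eLpNorm f 2 Q).toReal ^ 2 = ∫ ω, f ω ^ 2 ∂Q := by
  have h0 : 0 ≤ ∫ ω, ‖f ω‖ ^ (2 : ℝ) ∂Q := integral_nonneg fun ω => by positivity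
  rw [hf.eLpNorm_eq_integral_rpow_norm (by norm_num) (by norm_num), ENNReal.toReal_ofNat,
    ENNReal.toReal_ofReal (by positivity), ← Real.rpow_natCast, ← Real.rpow_mul h0]
  norm_num

theorem tendsto_toReal_eLpNorm {Y : ℕ → Ω → ℝ} {Z : Ω → ℝ} (hY : ∀ k, MemLp (Y k) 2 Q)
    (hZ : MemLp Z 2 Q)
    (hlim : Tendsto (fun k => eLpNorm (fun ω => Y k ω - Z ω) 2 Q) atTop (𝓝 0)) :
    Tendsto (fun k => (eLpNorm (Y k) 2 Q).toReal) atTop (𝓝 (eLpNorm Z 2 Q).toReal) := by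
  have h := ((Lp.tendsto_Lp_iff_tendsto_eLpNorm'' Y hY Z hZ).2 hlim).norm
  simpa only [Lp.norm_toLp] using h

theorem tendsto_integral_sq {Y : ℕ → Ω → ℝ} {Z : Ω → ℝ} (hY : ∀ k, MemLp (Y k) 2 Q)
    (hZ : MemLp Z 2 Q)
    (hlim : Tendsto (fun k => eLpNorm (fun ω => Y k ω - Z ω) 2 Q) atTop (𝓝 0)) :
    Tendsto (fun k => ∫ ω, Y k ω ^ 2 ∂Q) atTop (𝓝 (∫ ω, Z ω ^ 2 ∂Q)) := by
  have h := (tendsto_toReal_eLpNorm hY hZ hlim).pow 2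
  simpa only [sq_toReal_eLpNorm_two (hY _), sq_toReal_eLpNorm_two hZ] using h

theorem tendsto_integral_of_eLpNorm_two [IsProbabilityMeasure Q] {Y : ℕ → Ω → ℝ} {Z : Ω → ℝ}
    (hY : ∀ k, MemLp (Y k) 2 Q) (hZ : MemLp Z 2 Q)
    (hlim : Tendsto (fun k => eLpNorm (fun ω => Y k ω - Z ω) 2 Q) atTop (𝓝 0)) :
    Tendsto (fun k => ∫ ω, Y k ω ∂Q) atTop (𝓝 (∫ ω, Z ω ∂Q)) := by
  refine tendsto_integral_of_L1 Z (hZ.integrable (by norm_num)).1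
    (Eventually.of_forall fun k => (hY k).integrable (by norm_num)) ?_
  refine tendsto_of_tendsto_of_tendsto_of_le_of_le tendsto_const_nhds hlim (fun k => zero_le)
    fun k => ?_
  rw [← eLpNorm_one_eq_lintegral_enorm]
  exact eLpNorm_le_eLpNorm_of_exponent_le (by norm_num) ((hY k).sub hZ).1

/-- An `L²` limit of centered Gaussian random variables is a centered Gaussian random variable. -/
theorem hasGaussianLaw_of_tendsto [IsProbabilityMeasure Q] {Y : ℕ → Ω → ℝ} {Z : Ω → ℝ}
    (hY : ∀ k, HasGaussianLaw (Y k) Q) (hY0 : ∀ k, ∫ ω, Y k ω ∂Q = 0) (hZ : MemLp Z 2 Q)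
    (hlim : Tendsto (fun k => eLpNorm (fun ω => Y k ω - Z ω) 2 Q) atTop (𝓝 0)) :
    HasGaussianLaw Z Q ∧ ∫ ω, Z ω ∂Q = 0 := by
  have hY2 : ∀ k, MemLp (Y k) 2 Q := fun k => (hY k).memLp_two
  have hZ0 : ∫ ω, Z ω ∂Q = 0 := by
    have := tendsto_integral_of_eLpNorm_two hY2 hZ hlim
    simp only [hY0] at this
    exact (tendsto_nhds_unique this tendsto_const_nhds)
  refine ⟨?_, hZ0⟩
  have hmeas : TendstoInMeasure Q Y atTop Z :=
    tendstoInMeasure_of_tendsto_eLpNorm (by norm_num) (fun k => (hY2 k).1) hZ.1 hlim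
  have hdist := hmeas.tendstoInDistribution fun k => (hY k).aemeasurable
  have hchar := ProbabilityMeasure.tendsto_iff_tendsto_charFun.1 hdist.tendsto
  -- For a centered variable the Gaussian characteristic function depends on the second moment
  -- alone, and second moments converge under `L²` convergence.
  have hmean : ∀ (V : Ω → ℝ) (t : ℝ), ∫ ω, V ω ∂Q = 0 → MemLp V 2 Q →
      Complex.exp ((Q[fun ω => inner ℝ t (V ω)] : ℝ) * Complex.I -
        Var[fun ω => inner ℝ t (V ω); Q] / 2) =
      Complex.exp (-((t ^ 2 * ∫ ω, V ω ^ 2 ∂Q : ℝ) : ℂ) / 2) := by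
    intro V t hV hV2
    have e1 : ∀ ω, inner ℝ t (V ω) = t * V ω := fun ω => by simp [mul_comm]
    simp only [e1]
    rw [integral_const_mul, hV, variance_const_mul, variance_eq_sub hV2, hV]
    simp [neg_div]
  refine (hasGaussianLaw_iff_charFun_map_eq hZ.1.aemeasurable).2 fun t => ?_
  rw [hmean Z t hZ0 hZ]
  refine tendsto_nhds_unique (hchar t) ?_
  have : ∀ k, charFun (Q.map (Y k)) t =
      Complex.exp (-((t ^ 2 * ∫ ω, Y k ω ^ 2 ∂Q : ℝ) : ℂ) / 2) := fun k => by
    rw [(hY k).charFun_map_eq, hmean (Y k) t (hY0 k) (hY2 k)]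
  simp only [ProbabilityMeasure.coe_mk, this]
  have hsq := tendsto_integral_sq hY2 hZ hlim
  have hcont : Continuous fun r : ℝ => Complex.exp (-((t ^ 2 * r : ℝ) : ℂ) / 2) := by fun_prop
  exact (hcont.tendsto _).comp hsq

/-- If all linear combinations are Gaussian, then the joint law is Gaussian. -/
theorem hasGaussianLaw_pi_prod {ι κ : Type*} [Fintype ι] [Fintype κ] {X : ι → Ω → ℝ}
    {V : κ → Ω → ℝ} (hX : ∀ i, Measurable (X i)) (hV : ∀ j, Measurable (V j))
    (h : ∀ (b : ι → ℝ) (a : κ → ℝ),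
      HasGaussianLaw (fun ω => ∑ i, b i * X i ω + ∑ j, a j * V j ω) Q) :
    HasGaussianLaw (fun ω => ((fun i => X i ω), fun j => V j ω)) Q := by
  classical
  have hm : Measurable fun ω => ((fun i => X i ω), fun j => V j ω) :=
    (measurable_pi_lambda _ hX).prodMk (measurable_pi_lambda _ hV)
  refine ⟨⟨fun L => ?_⟩⟩
  have hL : ∀ ω, L ((fun i => X i ω), fun j => V j ω) =
      ∑ i, L (Pi.single i 1, 0) * X i ω + ∑ j, L (0, Pi.single j 1) * V j ω := by
    intro ω
    have hx : (fun i => X i ω) = ∑ i, X i ω • (Pi.single i 1 : ι → ℝ) := by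
      ext k; simp [Finset.sum_apply, Pi.single_apply]
    have hv : (fun j => V j ω) = ∑ j, V j ω • (Pi.single j 1 : κ → ℝ) := by
      ext k; simp [Finset.sum_apply, Pi.single_apply]
    have : ((fun i => X i ω), fun j => V j ω) = ∑ i, X i ω • ((Pi.single i 1, 0) : (ι → ℝ) × (κ → ℝ)) +
        ∑ j, V j ω • ((0, Pi.single j 1) : (ι → ℝ) × (κ → ℝ)) := by
      ext k
      · simp [Prod.fst_sum, Finset.sum_apply, Pi.single_apply]
      · simp [Prod.snd_sum, Finset.sum_apply, Pi.single_apply]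
    rw [this, map_add, map_sum, map_sum]
    simp only [map_smul, smul_eq_mul, mul_comm]
  have hg := (h (fun i => L (Pi.single i 1, 0)) fun j => L (0, Pi.single j 1)).map_eq_gaussianReal
  have hfun : (fun ω => ∑ i, L (Pi.single i 1, 0) * X i ω + ∑ j, L (0, Pi.single j 1) * V j ω) =
      L ∘ fun ω => ((fun i => X i ω), fun j => V j ω) := by
    ext ω; exact (hL ω).symm
  rw [hfun] at hg
  rw [Measure.map_map L.continuous.measurable hm, hg, integral_map hm.aemeasurable
    L.continuous.aestronglyMeasurable, variance_map L.continuous.aemeasurable hm.aemeasurable]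
  rfl

/-- The coefficients of the orthogonal projection onto finitely many random variables. -/
theorem exists_orthogonal_coefficients {κ : Type*} [Fintype κ] {X : Ω → ℝ} {V : κ → Ω → ℝ}
    (hX : MemLp X 2 Q) (hV : ∀ j, MemLp (V j) 2 Q) :
    ∃ a : κ → ℝ, ∀ j, ∫ ω, (X ω - ∑ i, a i * V i ω) * V j ω ∂Q = 0 := by
  -- The variables may be linearly dependent: the projection is unique, its coefficients need not
  -- be.
  set K : Submodule ℝ (Lp ℝ 2 Q) := Submodule.span ℝ (Set.range fun j => (hV j).toLp (V j))
  have : FiniteDimensional ℝ K := FiniteDimensional.span_of_finite ℝ (Set.finite_range _)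
  obtain ⟨w, hw, horth⟩ := Submodule.HasOrthogonalProjection.exists_orthogonal (K := K)
    (hX.toLp X)
  obtain ⟨a, ha⟩ := (Submodule.mem_span_range_iff_exists_fun ℝ).1 hw
  refine ⟨a, fun j => ?_⟩
  have h0 := (Submodule.mem_orthogonal _ _).1 horth _ (Submodule.subset_span ⟨j, rfl⟩)
  have hin : ∀ {f g : Ω → ℝ} (hf : MemLp f 2 Q) (hg : MemLp g 2 Q),
      inner ℝ (hf.toLp f) (hg.toLp g) = ∫ ω, g ω * f ω ∂Q := by
    intro f g hf hg
    rw [L2.inner_def]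
    refine integral_congr_ae ?_
    filter_upwards [hf.coeFn_toLp, hg.coeFn_toLp] with ω h1 h2
    simp [h1, h2]
  have hint : ∀ {f g : Ω → ℝ} (hf : MemLp f 2 Q) (hg : MemLp g 2 Q),
      Integrable (fun ω => f ω * g ω) Q := fun hf hg => hf.integrable_mul hg
  rw [← ha, inner_sub_right, inner_sum, hin] at h0
  simp only [inner_smul_right, hin] at h0
  rw [← h0]
  simp only [sub_mul, Finset.sum_mul, mul_assoc]
  rw [integral_sub (hint hX (hV j))
    (integrable_finsetSum _ fun i _ => (hint (hV i) (hV j)).const_mul (a i)),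
    integral_finsetSum _ fun i _ => (hint (hV i) (hV j)).const_mul (a i)]
  simp only [integral_const_mul]

/-- The conditional variance of the sum of a random variable independent of `m` and an
`m`-measurable one. -/
theorem condVar_add_of_indep {Ω : Type*} {m mΩ : MeasurableSpace Ω} {Q : Measure Ω}
    [IsProbabilityMeasure Q] (hm : m ≤ mΩ) {Z S : Ω → ℝ} (hZm : Measurable Z)
    (hZ2 : MemLp Z 2 Q) (hS2 : MemLp S 2 Q) (hSm : Measurable[m] S) (hZ0 : ∫ ω, Z ω ∂Q = 0)
    (hind : Indep (MeasurableSpace.comap Z Real.measurableSpace) m Q) :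
    ∀ᵐ ω ∂Q, Var[Z + S; Q | m] ω = ∫ ω, Z ω ^ 2 ∂Q := by
  have hZle : MeasurableSpace.comap Z Real.measurableSpace ≤ mΩ := hZm.comap_le
  have hZcm : Measurable[MeasurableSpace.comap Z Real.measurableSpace] Z := comap_measurable Z
  have hcZ : Q[Z | m] =ᵐ[Q] fun _ => 0 := by
    have := condExp_indep_eq hZle hm hZcm.stronglyMeasurable hind
    rwa [hZ0] at this
  have hcS : Q[S | m] = S :=
    condExp_of_stronglyMeasurable hm hSm.stronglyMeasurable (hS2.integrable (by norm_num))
  have hcX : Q[Z + S | m] =ᵐ[Q] S := by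
    have := condExp_add (hZ2.integrable (by norm_num)) (hS2.integrable (by norm_num)) m (μ := Q)
    filter_upwards [this, hcZ] with ω h1 h2
    rw [h1, Pi.add_apply, h2, hcS, zero_add]
  -- The deviation of `Z + S` from its conditional mean `S` is `Z`.
  have hcv : Var[Z + S; Q | m] =ᵐ[Q] Q[fun ω => Z ω ^ 2 | m] := by
    refine condExp_congr_ae ?_
    filter_upwards [hcX] with ω hω
    simp [hω]
  have hcZ2 : Q[fun ω => Z ω ^ 2 | m] =ᵐ[Q] fun _ => ∫ ω, Z ω ^ 2 ∂Q :=
    condExp_indep_eq hZle hm (hZcm.pow_const 2).stronglyMeasurable hind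
  filter_upwards [hcv, hcZ2] with ω h1 h2
  rw [h1, h2]

/-- The conditional variance of a Gaussian random variable given finitely many others, all jointly
Gaussian and centered, is bounded from below by any lower bound for the squared distance to their
linear combinations. -/
theorem le_condVar_of_gaussian [IsProbabilityMeasure Q] {κ : Type*} [Fintype κ] {X : Ω → ℝ}
    {V : κ → Ω → ℝ} (hXm : Measurable X) (hVm : ∀ j, Measurable (V j))
    (hG : ∀ (b : ℝ) (a : κ → ℝ), HasGaussianLaw (fun ω => b * X ω + ∑ j, a j * V j ω) Q)
    (hX0 : ∫ ω, X ω ∂Q = 0) (hV0 : ∀ j, ∫ ω, V j ω ∂Q = 0) {c : ℝ}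
    (hc : ∀ a : κ → ℝ, c ≤ ∫ ω, (X ω - ∑ j, a j * V j ω) ^ 2 ∂Q) :
    ∀ᵐ ω ∂Q, c ≤ Var[X; Q | MeasurableSpace.comap (fun ω' j => V j ω') inferInstance] ω := by
  classical
  have hX2 : MemLp X 2 Q := by
    have := (hG 1 0).memLp_two
    simpa using this
  have hV2 : ∀ j, MemLp (V j) 2 Q := by
    intro j
    have := (hG 0 (Pi.single j 1)).memLp_two
    simpa [Pi.single_apply] using this
  -- The residual `Z` is uncorrelated with every `V j`. Joint Gaussianity upgrades this to
  -- independence, so the conditional variance is the constant `E Z²`, itself one of the quantities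
  -- bounded below by `hc`.
  obtain ⟨a, ha⟩ := exists_orthogonal_coefficients hX2 hV2
  set S : Ω → ℝ := fun ω => ∑ j, a j * V j ω with hS
  set Z : Ω → ℝ := fun ω => X ω - S ω with hZ
  have hSm : Measurable S := Finset.measurable_fun_sum _ fun j _ => (hVm j).const_mul _
  have hZm : Measurable Z := hXm.sub hSm
  have hS2 : MemLp S 2 Q := memLp_finsetSum _ fun j _ => (hV2 j).const_mul (a j)
  have hZ2 : MemLp Z 2 Q := hX2.sub hS2
  have hS0 : ∫ ω, S ω ∂Q = 0 := by
    rw [hS, integral_finsetSum _ fun j _ => ((hV2 j).integrable (by norm_num)).const_mul (a j)]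
    simp [integral_const_mul, hV0]
  have hZ0 : ∫ ω, Z ω ∂Q = 0 := by
    rw [hZ, integral_sub (hX2.integrable (by norm_num)) (hS2.integrable (by norm_num)), hX0, hS0,
      sub_zero]
  have hjoint : HasGaussianLaw (fun ω => ((fun _ : Unit => Z ω), fun j => V j ω)) Q := by
    refine hasGaussianLaw_pi_prod (X := fun _ : Unit => Z) (fun _ => hZm) hVm fun b e => ?_
    have := hG (b ()) (fun j => e j - b () * a j)
    refine this.congr (Eventually.of_forall fun ω => ?_)
    simp only [Finset.univ_unique, Finset.sum_singleton, hZ, hS, sub_mul, Finset.sum_sub_distrib,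
      mul_sub, Finset.mul_sum, mul_assoc]
    change _ = b () * X ω - ∑ i, b () * (a i * V i ω) + _
    ring
  have hindep : IndepFun (fun ω (_ : Unit) => Z ω) (fun ω j => V j ω) Q := by
    refine HasGaussianLaw.indepFun_of_covariance_eval (X := fun _ : Unit => Z) hjoint fun _ j => ?_
    rw [covariance_eq_sub hZ2 (hV2 j), hZ0, zero_mul, sub_zero]
    exact ha j
  have hindepZ : IndepFun Z (fun ω j => V j ω) Q :=
    hindep.comp (φ := fun f : Unit → ℝ => f ()) (ψ := id) (measurable_pi_apply ()) measurable_id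
  have hVall : Measurable fun ω j => V j ω := measurable_pi_lambda _ hVm
  have hSm' : Measurable[MeasurableSpace.comap (fun ω' j => V j ω') inferInstance] S := by
    have h1 : Measurable fun v : κ → ℝ => ∑ j, a j * v j := by fun_prop
    exact h1.comp (comap_measurable (fun ω' j => V j ω'))
  have key := condVar_add_of_indep hVall.comap_le hZm hZ2 hS2 hSm' hZ0
    ((IndepFun_iff_Indep _ _ _).1 hindepZ)
  have hXZ : Z + S = X := by ext ω; simp [hZ]
  rw [hXZ] at key
  filter_upwards [key] with ω h1
  rw [h1]
  exact hc a

end Gaussian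

/-! ### Wiener integrals -/

section Noise

variable {d : ℕ} {Ω : Type*} [MeasurableSpace Ω] {Q : Measure Ω} {H T₀ : ℝ} {h : Space d → ℝ}
  {W : 𝓓(openSlab d T₀, ℝ) → Ω → ℝ}

theorem exists_testFunction_sum (hW : IsFractionalColoredNoise Q H T₀ h W) {ι : Type*}
    (S : Finset ι) (c : ι → ℝ) (φ : ι → 𝓓(openSlab d T₀, ℝ)) :
    ∃ Φ : 𝓓(openSlab d T₀, ℝ), (∀ z, Φ z = ∑ i ∈ S, c i * φ i z) ∧
      W Φ =ᵐ[Q] fun ω => ∑ i ∈ S, c i * W (φ i) ω := by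
  classical
  induction S using Finset.induction_on with
  | empty =>
    refine ⟨0, fun z => by simp, ?_⟩
    have := hW.linear 0 0 0 0
    simpa using this
  | insert i S hi ih =>
    obtain ⟨Φ, h1, h2⟩ := ih
    refine ⟨c i • φ i + (1 : ℝ) • Φ, fun z => ?_, ?_⟩
    · rw [Finset.sum_insert hi, ← h1]
      simp
    · filter_upwards [hW.linear (c i) 1 (φ i) Φ, h2] with ω e1 e2
      rw [e1, e2, Finset.sum_insert hi, one_mul]

theorem memLp_noise (hW : IsFractionalColoredNoise Q H T₀ h W) (φ : 𝓓(openSlab d T₀, ℝ)) :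
    MemLp (W φ) 2 Q :=
  (hW.gaussian.hasGaussianLaw_eval φ).memLp_two

theorem exists_approximation (hW : IsFractionalColoredNoise Q H T₀ h W) {ι : Type*} [Fintype ι]
    (c : ι → ℝ) (φ : ι → ℕ → 𝓓(openSlab d T₀, ℝ)) {Y : ι → Ω → ℝ} (hY : ∀ i, MemLp (Y i) 2 Q)
    (hlim : ∀ i, Tendsto (fun k => eLpNorm (fun ω => W (φ i k) ω - Y i ω) 2 Q) atTop (𝓝 0)) :
    ∃ Φ : ℕ → 𝓓(openSlab d T₀, ℝ), (∀ k z, Φ k z = ∑ i, c i * φ i k z) ∧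
      Tendsto (fun k => eLpNorm (fun ω => W (Φ k) ω - ∑ i, c i * Y i ω) 2 Q) atTop (𝓝 0) := by
  choose Φ h1 h2 using fun k => exists_testFunction_sum hW Finset.univ c fun i => φ i k
  refine ⟨Φ, h1, ?_⟩
  have hbound : ∀ k, eLpNorm (fun ω => W (Φ k) ω - ∑ i, c i * Y i ω) 2 Q ≤
      ∑ i, ‖c i‖ₑ * eLpNorm (fun ω => W (φ i k) ω - Y i ω) 2 Q := by
    intro k
    calc eLpNorm (fun ω => W (Φ k) ω - ∑ i, c i * Y i ω) 2 Q
        = eLpNorm (∑ i, c i • fun ω => W (φ i k) ω - Y i ω) 2 Q := by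
          refine eLpNorm_congr_ae ?_
          filter_upwards [h2 k] with ω hω
          simp [hω, Finset.sum_apply, mul_sub, Finset.sum_sub_distrib]
      _ ≤ ∑ i, eLpNorm (c i • fun ω => W (φ i k) ω - Y i ω) 2 Q :=
          eLpNorm_sum_le (fun i _ => (((memLp_noise hW (φ i k)).sub (hY i)).const_smul (c i)).1)
            (by norm_num)
      _ = _ := by simp only [eLpNorm_const_smul]
  have hz : Tendsto (fun k => ∑ i, ‖c i‖ₑ * eLpNorm (fun ω => W (φ i k) ω - Y i ω) 2 Q) atTop
      (𝓝 0) := by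
    have : Tendsto (fun k => ∑ i, ‖c i‖ₑ * eLpNorm (fun ω => W (φ i k) ω - Y i ω) 2 Q) atTop
        (𝓝 (∑ i, ‖c i‖ₑ * 0)) :=
      tendsto_finsetSum _ fun i _ => ENNReal.Tendsto.const_mul (hlim i) (Or.inr (by simp))
    simpa using this
  exact tendsto_of_tendsto_of_tendsto_of_le_of_le tendsto_const_nhds hz (fun _ => zero_le) hbound

/-- A linear combination of Wiener integrals is the `L²` limit of the noise along single test
functions, hence a limit of centered Gaussian variables. -/
theorem gaussian_sum_of_wiener [IsProbabilityMeasure Q] (hW : IsFractionalColoredNoise Q H T₀ h W)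
    {ι : Type*} [Fintype ι] (c : ι → ℝ) {g : ι → ℝ × Space d → ℝ} {Y : ι → Ω → ℝ}
    (hY : ∀ i, IsWienerIntegral Q H T₀ h W (g i) (Y i)) :
    HasGaussianLaw (fun ω => ∑ i, c i * Y i ω) Q ∧ ∫ ω, ∑ i, c i * Y i ω ∂Q = 0 := by
  choose hYm φ hfin hinner hlim using hY
  obtain ⟨Φ, -, hΦ⟩ := exists_approximation hW c φ hYm hlim
  exact hasGaussianLaw_of_tendsto (fun k => hW.gaussian.hasGaussianLaw_eval (Φ k))
    (fun k => hW.centered (Φ k)) (memLp_finsetSum _ fun i _ => (hYm i).const_mul (c i)) hΦ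

theorem spaceFourier_sum {ι : Type*} [Fintype ι] (c : ι → ℝ) {φ : ι → ℝ × Space d → ℝ}
    (hφ : ∀ i s, Integrable fun y => φ i (s, y)) (s : ℝ) (ξ : Space d) :
    spaceFourier (fun z => ∑ i, c i * φ i z) s ξ = ∑ i, (c i : ℂ) * spaceFourier (φ i) s ξ := by
  simp only [spaceFourier]
  have hi : ∀ i, Integrable fun y : Space d =>
      (c i : ℂ) * (Complex.exp (-Complex.I * (inner ℝ ξ y : ℝ)) * (φ i (s, y) : ℂ)) := fun i =>
    Integrable.const_mul ((hφ i s).ofReal.bdd_mul (c := 1)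
      (Continuous.aestronglyMeasurable (by fun_prop))
      (Eventually.of_forall fun y => (norm_exp_neg_I_mul _).le)) _
  simp only [← integral_const_mul]
  rw [← integral_finsetSum _ fun i _ => hi i]
  refine integral_congr_ae (Eventually.of_forall fun y => ?_)
  simp only
  push_cast
  rw [Finset.mul_sum]
  exact Finset.sum_congr rfl fun i _ => by ring

theorem spaceFourier_sub {φ ψ : ℝ × Space d → ℝ} (hφ : ∀ s, Integrable fun y => φ (s, y))
    (hψ : ∀ s, Integrable fun y => ψ (s, y)) (s : ℝ) (ξ : Space d) :
    spaceFourier (fun z => φ z - ψ z) s ξ = spaceFourier φ s ξ - spaceFourier ψ s ξ := by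
  simp only [spaceFourier]
  have hi : ∀ {f : Space d → ℝ}, Integrable f → Integrable fun y : Space d =>
      Complex.exp (-Complex.I * (inner ℝ ξ y : ℝ)) * (f y : ℂ) := fun hf =>
    hf.ofReal.bdd_mul (c := 1) (Continuous.aestronglyMeasurable (by fun_prop))
      (Eventually.of_forall fun y => (norm_exp_neg_I_mul _).le)
  rw [← integral_sub (hi (hφ s)) (hi (hψ s))]
  refine integral_congr_ae (Eventually.of_forall fun y => ?_)
  push_cast
  ring

theorem re_integral_symbolSquare (H T₀ : ℝ) (h : Space d → ℝ) (φ : ℝ × Space d → ℝ) :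
    (∫ q, symbolSquare (spaceFourier φ) q ∂((timeCovariance H T₀).prod (spectralMeasure h))).re =
      (2 * Real.pi) ^ d * (hpInner H T₀ h φ φ).re := by
  have hpos : (0 : ℝ) < (2 * Real.pi) ^ d := by positivity
  have h1 : ((2 * Real.pi : ℝ) : ℂ) ^ (-(d : ℤ)) = (((2 * Real.pi) ^ d)⁻¹ : ℝ) := by
    rw [zpow_neg, zpow_natCast]
    push_cast
    rfl
  rw [hpInner, h1, Complex.re_ofReal_mul, ← mul_assoc, mul_inv_cancel₀ hpos.ne', one_mul]
  rfl

/-- The pairing of a linear combination of Green kernels is controlled by the variance of the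
corresponding linear combination of the solution. -/
theorem exists_pairing_le_integral_sq {α β : ℝ} [IsProbabilityMeasure Q] (hH : 1 / 2 ≤ H)
    (hH1 : H < 1) (hα : 0 < α) (hα2 : α ≤ 2) (hβ : 0 < β) (hβd : β < d)
    {Ω' : Type*} [MeasurableSpace Ω'] {P : Measure Ω'} [IsProbabilityMeasure P]
    {X : ℝ≥0 → Ω' → Space d} (hX : ∀ t, Measurable (X t)) {Ψ : Space d → ℝ}
    (hΨ : IsCharacteristicExponent P X Ψ) (hp : HasTransitionDensity P X Ψ)
    {c C : ℝ} (hc : 0 < c) (hC : 0 < C) (hΨc : ∀ ξ, c * ‖ξ‖ ^ α ≤ Ψ ξ)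
    (hΨC : ∀ ξ, Ψ ξ ≤ C * ‖ξ‖ ^ α) (hh : Measurable h) {ch Ch : ℝ} (hch : 0 < ch) (hCh : 0 < Ch)
    (hhc : ∀ ξ, ξ ≠ 0 → ch * ‖ξ‖ ^ (-β) ≤ h ξ) (hhC : ∀ ξ, ξ ≠ 0 → h ξ ≤ Ch * ‖ξ‖ ^ (-β))
    (hW : IsFractionalColoredNoise Q H T₀ h W) {u : ℝ × Space d → Ω → ℝ}
    (hu : IsRandomFieldSolution Q H T₀ h Ψ W u) :
    ∃ K : ℝ, 0 < K ∧ ∀ {ι : Type} [Fintype ι] (b : ι → ℝ) (q : ι → ℝ × Space d),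
      (∀ i, (q i).1 ∈ Set.Icc 0 T₀) → ∀ (t δ : ℝ) (x : Space d), 0 < δ →
      ‖∑ i, (b i : ℂ) * pairing Ψ T₀ t (δ ^ α) δ x (greenSymbol Ψ (q i).1 (q i).2)‖ ^ 2 ≤
        K * ((δ ^ α) ^ (4 - 2 * H) * (δ ^ β)⁻¹ * (δ ^ d)⁻¹) * ∫ ω, (∑ i, b i * u (q i) ω) ^ 2 ∂Q := by
  have hd : NeZero d := ⟨fun h0 => by simp [h0] at hβd; linarith⟩
  have hΨm := measurable_of_isCharacteristicExponent hΨ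
  have hΨ0 : ∀ ξ, 0 ≤ Ψ ξ := fun ξ => le_trans (by positivity) (hΨc ξ)
  obtain ⟨K, hK, hbound⟩ := exists_pairing_bound d hH hH1 hα2 hα hβ hβd hC hch
  refine ⟨K * (2 * Real.pi) ^ d, by positivity, ?_⟩
  intro ι _ b q hq t δ x hδ
  set L : (ℝ → Space d → ℂ) → ℂ := pairing Ψ T₀ t (δ ^ α) δ x with hL
  set A : ℝ := K * ((δ ^ α) ^ (4 - 2 * H) * (δ ^ β)⁻¹ * (δ ^ d)⁻¹) with hA
  have hA0 : 0 < A := by positivity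
  choose hYm φ hfin hinner hlim using fun i => hu.wiener (q i).1 (hq i) (q i).2
  have hφi : ∀ i k s, Integrable fun y => φ i k (s, y) := fun i k s =>
    integrable_section (φ i k).continuous (φ i k).hasCompactSupport s
  have hgi : ∀ i s, Integrable fun y => greenKernel Ψ (q i).1 (q i).2 (s, y) := fun i s =>
    integrable_greenKernel hX hΨ hp hc hα hΨc _ _ s
  have hF : ∀ i k, BoundedSymbol (spaceFourier (φ i k)) := fun i k =>
    boundedSymbol_spaceFourier (φ i k).continuous (φ i k).hasCompactSupport
  have hG : ∀ i, BoundedSymbol (greenSymbol Ψ (q i).1 (q i).2) := fun i =>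
    boundedSymbol_greenSymbol hΨm hΨ0 _ _
  have hbd : ∀ ψ : ℝ × Space d → ℝ, BoundedSymbol (spaceFourier ψ) →
      Integrable (symbolSquare (spaceFourier ψ)) ((timeCovariance H T₀).prod (spectralMeasure h)) →
      ‖L (spaceFourier ψ)‖ ^ 2 ≤ A * ((2 * Real.pi) ^ d * (hpInner H T₀ h ψ ψ).re) := by
    intro ψ h1 h2
    rw [← re_integral_symbolSquare]
    exact hbound Ψ h hΨm hh hΨ0 hΨC hhc T₀ _ h1 h2 t δ x hδ
  have hsub : ∀ i k, spaceFourier (fun z => φ i k z - greenKernel Ψ (q i).1 (q i).2 z) =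
      fun s ξ => spaceFourier (φ i k) s ξ - greenSymbol Ψ (q i).1 (q i).2 s ξ := by
    intro i k
    ext s ξ
    rw [spaceFourier_sub (hφi i k) (hgi i), spaceFourier_greenKernel hX hΨ hp hc hα hΨc]
  -- The approximation error is small in the norm of the noise, in which the pairing is bounded;
  -- hence the pairing passes to the limit for each Green kernel separately.
  have hconv : ∀ i, Tendsto (fun k => L (spaceFourier (φ i k))) atTop
      (𝓝 (L (greenSymbol Ψ (q i).1 (q i).2))) := by
    intro i
    rw [tendsto_iff_norm_sub_tendsto_zero]
    have hle : ∀ k, ‖L (spaceFourier (φ i k)) - L (greenSymbol Ψ (q i).1 (q i).2)‖ ^ 2 ≤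
        A * ((2 * Real.pi) ^ d * (hpInner H T₀ h
          (fun z => φ i k z - greenKernel Ψ (q i).1 (q i).2 z)
          (fun z => φ i k z - greenKernel Ψ (q i).1 (q i).2 z)).re) := by
      intro k
      have := hbd (fun z => φ i k z - greenKernel Ψ (q i).1 (q i).2 z)
        (by rw [hsub]; exact (hF i k).sub (hG i)) (hfin i k)
      rw [hsub] at this
      rwa [hL, pairing_sub hΨm hα hα2 hΨ0 hΨC hδ (hF i k) (hG i)] at this
    have hz : Tendsto (fun k => A * ((2 * Real.pi) ^ d * (hpInner H T₀ h
          (fun z => φ i k z - greenKernel Ψ (q i).1 (q i).2 z)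
          (fun z => φ i k z - greenKernel Ψ (q i).1 (q i).2 z)).re)) atTop (𝓝 0) := by
      have h1 := ((Complex.continuous_re.tendsto _).comp (hinner i)).const_mul ((2 * Real.pi) ^ d)
      have h2 := h1.const_mul A
      simpa using h2
    have hsq := squeeze_zero (fun k => by positivity) hle hz
    have h3 := (Real.continuous_sqrt.tendsto _).comp hsq
    simpa [Function.comp_def, Real.sqrt_sq] using h3
  obtain ⟨Φ, hΦ, hΦlim⟩ := exists_approximation hW b φ hYm hlim
  have hΦF : ∀ k, spaceFourier (Φ k) = fun s ξ => ∑ i, (b i : ℂ) * spaceFourier (φ i k) s ξ := by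
    intro k
    have : (Φ k : ℝ × Space d → ℝ) = fun z => ∑ i, b i * φ i k z := funext (hΦ k)
    ext s ξ
    rw [this, spaceFourier_sum b fun i s => hφi i k s]
  -- The variance is identified with the energy only for test functions, where the covariance
  -- formula is given. The Green kernels are reached in the limit, so no inner product between two
  -- of them is ever expanded.
  have hleft : ∀ k, ‖∑ i, (b i : ℂ) * L (spaceFourier (φ i k))‖ ^ 2 ≤
      A * ((2 * Real.pi) ^ d * ∫ ω, W (Φ k) ω ^ 2 ∂Q) := by
    intro k
    have h1 := hbd (Φ k) (boundedSymbol_spaceFourier (Φ k).continuous (Φ k).hasCompactSupport)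
      (integrable_symbolSquare_spaceFourier hH hH1 hh hβ hβd hCh hhC T₀ (Φ k).contDiff
        (Φ k).hasCompactSupport)
    have h2 : (hpInner H T₀ h (Φ k) (Φ k)).re = ∫ ω, W (Φ k) ω ^ 2 ∂Q := by
      rw [← hW.covariance, Complex.ofReal_re]
      simp only [sq]
    rw [h2, hΦF, hL, pairing_sum hΨm hα hα2 hΨ0 hΨC hδ Finset.univ (fun i => (b i : ℂ))
      fun i => hF i k] at h1
    exact h1
  have hYsum : MemLp (fun ω => ∑ i, b i * u (q i) ω) 2 Q :=
    memLp_finsetSum _ fun i _ => (hYm i).const_mul (b i)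
  have hr := ((tendsto_integral_sq (fun k => memLp_noise hW (Φ k)) hYsum hΦlim).const_mul
    ((2 * Real.pi) ^ d)).const_mul A
  have hl : Tendsto (fun k => ‖∑ i, (b i : ℂ) * L (spaceFourier (φ i k))‖ ^ 2) atTop
      (𝓝 (‖∑ i, (b i : ℂ) * L (greenSymbol Ψ (q i).1 (q i).2)‖ ^ 2)) :=
    (tendsto_finsetSum _ fun i _ => (hconv i).const_mul (b i : ℂ)).norm.pow 2
  refine (le_of_tendsto_of_tendsto' hl hr hleft).trans (le_of_eq ?_)
  rw [hA]
  ring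

end Noise

/-! ### The lower bound for the prediction error -/

theorem Delta_nonneg {d : ℕ} (θ₁ θ₂ : ℝ) (p q : ℝ × Space d) : 0 ≤ Delta θ₁ θ₂ p q := by
  unfold Delta
  positivity

theorem exists_Delta_le {d : ℕ} {θ₁ θ₂ : ℝ} (hθ₁ : 0 < θ₁) (hθ₂ : 0 < θ₂) (a a' : ℝ)
    (b b' : Fin d → ℝ) :
    ∃ R : ℝ, 0 < R ∧ ∀ p ∈ rectangle a a' b b', ∀ q ∈ rectangle a a' b b',
      Delta θ₁ θ₂ p q ≤ R := by
  refine ⟨|a' - a| ^ θ₁ + ∑ j, |b' j - b j| ^ θ₂ + 1, by positivity, fun p hp q hq => ?_⟩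
  have key : ∀ {x y l m : ℝ}, x ∈ Set.Icc l m → y ∈ Set.Icc l m → |x - y| ≤ |m - l| := by
    intro x y l m hx hy
    refine le_trans (abs_le.2 ⟨?_, ?_⟩) (le_abs_self _) <;> linarith [hx.1, hx.2, hy.1, hy.2]
  have h1 := Real.rpow_le_rpow (abs_nonneg _) (key hp.1 hq.1) hθ₁.le
  have h2 : ∑ j, |p.2 j - q.2 j| ^ θ₂ ≤ ∑ j, |b' j - b j| ^ θ₂ := Finset.sum_le_sum fun j _ =>
    Real.rpow_le_rpow (abs_nonneg _) (key (hp.2 j) (hq.2 j)) hθ₂.le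
  unfold Delta
  linarith

/-- A space-time bump at `(t, x)` of size `(δ ^ α, δ)` vanishes at the points that are far away in
the metric `Δ`. -/
theorem timeTest_mul_spaceBump_eq_zero {d : ℕ} {α θ r δ : ℝ} (hα : 0 < α) (hθ : 0 < θ)
    (hδ : 0 < δ) (hr : (3 ^ θ + d) * δ ^ (α * θ) ≤ r) {p q : ℝ × Space d}
    (hpq : r ≤ Delta θ (α * θ) p q) :
    timeTest p.1 (δ ^ α) q.1 * ((δ ^ d)⁻¹ * spaceBump d ((2 * Real.pi)⁻¹ • δ⁻¹ • (p.2 - q.2))) =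
      0 := by
  have hε : 0 < δ ^ α := by positivity
  -- If the product is nonzero, then the times differ by less than `3δ^α` and the positions by at
  -- most `δ`. This forces `Δ < (3^θ + d) δ^{αθ} ≤ r`.
  by_contra hne
  obtain ⟨h1, h2⟩ := mul_ne_zero_iff.1 hne
  have h3 := (mul_ne_zero_iff.1 h2).2
  have ht : |p.1 - q.1| < 3 * δ ^ α := by
    by_contra hcon
    refine h1 (timeTest_eq_zero hε ?_)
    rcases le_abs.1 (not_lt.1 hcon) with h | h
    · left; linarith
    · right; linarith
  have hx : ‖p.2 - q.2‖ ≤ δ := by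
    by_contra hcon
    refine h3 ((spaceBump d).zero_of_le_dist ?_)
    rw [dist_zero_right, norm_smul, norm_smul, Real.norm_of_nonneg (by positivity),
      Real.norm_of_nonneg (by positivity)]
    have : 1 ≤ δ⁻¹ * ‖p.2 - q.2‖ := by
      rw [inv_mul_eq_div, one_le_div hδ]
      exact (not_le.1 hcon).le
    change 1 / (2 * Real.pi) ≤ _
    rw [one_div]
    exact le_mul_of_one_le_right (by positivity) this
  have e1 : |p.1 - q.1| ^ θ < 3 ^ θ * δ ^ (α * θ) := by
    rw [Real.rpow_mul hδ.le, ← Real.mul_rpow (by norm_num) hε.le]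
    exact Real.rpow_lt_rpow (abs_nonneg _) ht hθ
  have e2 : ∑ j, |p.2 j - q.2 j| ^ (α * θ) ≤ d * δ ^ (α * θ) := by
    have : ∀ j ∈ Finset.univ, |p.2 j - q.2 j| ^ (α * θ) ≤ δ ^ (α * θ) := fun j _ =>
      Real.rpow_le_rpow (abs_nonneg _) (((PiLp.norm_apply_le (p.2 - q.2) j)).trans hx)
        (by positivity)
    simpa using Finset.sum_le_card_nsmul _ _ _ this
  unfold Delta at hpq
  linarith

/-- The pairing at `p` annihilates the Green kernels of all `q j`, so its value does not depend on
the weights `w`. Comparing its square, at least `δ^{4α-2d}/4`, with the bound `δ^{α(4-2H)-β-d}` of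
the pairing leaves `δ^{2θ₂}`. -/
theorem exists_le_integral_prediction_error {d : ℕ} {Ω : Type*} [MeasurableSpace Ω] {Q : Measure Ω}
    {H T₀ : ℝ} {h : Space d → ℝ} {W : 𝓓(openSlab d T₀, ℝ) → Ω → ℝ} {α β : ℝ}
    [IsProbabilityMeasure Q] (hH : 1 / 2 ≤ H)
    (hH1 : H < 1) (hα : 0 < α) (hα2 : α ≤ 2) (hβ : 0 < β) (hβd : β < d)
    {Ω' : Type*} [MeasurableSpace Ω'] {P : Measure Ω'} [IsProbabilityMeasure P]
    {X : ℝ≥0 → Ω' → Space d} (hX : ∀ t, Measurable (X t)) {Ψ : Space d → ℝ}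
    (hΨ : IsCharacteristicExponent P X Ψ) (hp : HasTransitionDensity P X Ψ)
    {c C : ℝ} (hc : 0 < c) (hC : 0 < C) (hΨc : ∀ ξ, c * ‖ξ‖ ^ α ≤ Ψ ξ)
    (hΨC : ∀ ξ, Ψ ξ ≤ C * ‖ξ‖ ^ α) (hh : Measurable h) {ch Ch : ℝ} (hch : 0 < ch) (hCh : 0 < Ch)
    (hhc : ∀ ξ, ξ ≠ 0 → ch * ‖ξ‖ ^ (-β) ≤ h ξ) (hhC : ∀ ξ, ξ ≠ 0 → h ξ ≤ Ch * ‖ξ‖ ^ (-β))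
    (hW : IsFractionalColoredNoise Q H T₀ h W) {u : ℝ × Space d → Ω → ℝ}
    (hu : IsRandomFieldSolution Q H T₀ h Ψ W u) (hθ : 0 < theta₁ d H α β)
    {a R : ℝ} (ha : 0 < a) (hR : 0 < R) :
    ∃ c₂ : ℝ, 0 < c₂ ∧ ∀ (n : ℕ) (p : ℝ × Space d) (q : Fin n → ℝ × Space d) (w : Fin n → ℝ)
      (r : ℝ), p.1 ∈ Set.Icc a T₀ → (∀ j, (q j).1 ∈ Set.Icc 0 T₀) → 0 ≤ r → r ≤ R →
      (∀ j, r ≤ Delta (theta₁ d H α β) (theta₂ d H α β) p (q j)) →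
      c₂ * r ^ 2 ≤ ∫ ω, (u p ω - ∑ j, w j * u (q j) ω) ^ 2 ∂Q := by
  obtain ⟨K, hK, hbound⟩ := exists_pairing_le_integral_sq hH hH1 hα hα2 hβ hβd hX hΨ hp hc hC hΨc
    hΨC hh hch hCh hhc hhC hW hu
  have hΨm := measurable_of_isCharacteristicExponent hΨ
  have hΨ0 : ∀ ξ, 0 ≤ Ψ ξ := fun ξ => le_trans (by positivity) (hΨc ξ)
  set θ := theta₁ d H α β with hθdef
  have hθ₂ : theta₂ d H α β = α * θ := rfl
  rw [hθ₂]
  have hαθ : 0 < α * θ := mul_pos hα hθ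
  set m : ℝ := 3 ^ θ + d with hm
  have hm0 : 0 < m := by positivity
  -- The bound `1/m` makes the bump miss every point at distance at least `r`; the bound `a^θ/R`
  -- gives `δ^α ≤ a`, so that the test function vanishes at time `0`.
  set γ : ℝ := min (1 / m) (a ^ θ / R) with hγ
  have hγ0 : 0 < γ := lt_min (by positivity) (by positivity)
  refine ⟨γ ^ 2 / (4 * K), by positivity, ?_⟩
  intro n p q w r hpT hqT hr0 hrR hfar
  rcases hr0.eq_or_lt with rfl | hr
  · have : 0 ≤ ∫ ω, (u p ω - ∑ j, w j * u (q j) ω) ^ 2 ∂Q := integral_nonneg fun _ => by positivity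
    simpa using this
  set δ : ℝ := (γ * r) ^ (α * θ)⁻¹ with hδdef
  have hδ : 0 < δ := by positivity
  have hδθ : δ ^ (α * θ) = γ * r := Real.rpow_inv_rpow (by positivity) hαθ.ne'
  have hε : 0 < δ ^ α := by positivity
  have hsmall : m * δ ^ (α * θ) ≤ r := by
    rw [hδθ, ← mul_assoc]
    have : m * γ ≤ 1 := by
      calc m * γ ≤ m * (1 / m) := by gcongr; exact min_le_left _ _
        _ = 1 := by field_simp
    exact mul_le_of_le_one_left hr.le this
  have hεa : δ ^ α ≤ a := by
    rw [← Real.rpow_le_rpow_iff hε.le ha.le hθ, ← Real.rpow_mul hδ.le, hδθ]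
    calc γ * r ≤ (a ^ θ / R) * R := by gcongr; exact min_le_right _ _
      _ = a ^ θ := by field_simp
  -- The index `none` stands for `p` with weight `1`, and `some j` for `q j` with weight `-w j`.
  have hmain := hbound (ι := Option (Fin n)) (fun i => i.elim 1 fun j => -w j)
    (fun i => i.elim p q) (by
      rintro (_ | j)
      · exact ⟨ha.le.trans hpT.1, hpT.2⟩
      · exact hqT j) p.1 δ p.2 hδ
  have hint : ∀ ω, ∑ i : Option (Fin n), (i.elim 1 fun j => -w j) * u (i.elim p q) ω =
      u p ω - ∑ j, w j * u (q j) ω := by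
    intro ω
    rw [Fintype.sum_option]
    simp [sub_eq_add_neg]
  have hpair : ∀ z : ℝ × Space d, z.1 ∈ Set.Icc 0 T₀ →
      pairing Ψ T₀ p.1 (δ ^ α) δ p.2 (greenSymbol Ψ z.1 z.2) = ((timeTest p.1 (δ ^ α) z.1 *
        ((δ ^ d)⁻¹ * spaceBump d ((2 * Real.pi)⁻¹ • δ⁻¹ • (p.2 - z.2))) : ℝ) : ℂ) := fun z hz =>
    pairing_greenSymbol hz.1 hz.2 hε (hεa.trans hpT.1) hδ p.2 z.2
  have hbump : spaceBump d 0 = 1 := (spaceBump d).one_of_mem_closedBall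
    (Metric.mem_closedBall_self (spaceBump d).rIn_pos.le)
  have hsum : ∑ i : Option (Fin n), (((i.elim 1 fun j => -w j : ℝ)) : ℂ) *
      pairing Ψ T₀ p.1 (δ ^ α) δ p.2 (greenSymbol Ψ ((i.elim p q).1) ((i.elim p q).2)) =
      ((timeTest p.1 (δ ^ α) p.1 * (δ ^ d)⁻¹ : ℝ) : ℂ) := by
    rw [Fintype.sum_option]
    have hz : ∀ j : Fin n, pairing Ψ T₀ p.1 (δ ^ α) δ p.2 (greenSymbol Ψ (q j).1 (q j).2) = 0 := by
      intro j
      rw [hpair _ (hqT j), timeTest_mul_spaceBump_eq_zero hα hθ hδ hsmall (hfar j),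
        Complex.ofReal_zero]
    simp only [Option.elim, hz, mul_zero, Finset.sum_const_zero, add_zero]
    rw [hpair _ ⟨ha.le.trans hpT.1, hpT.2⟩]
    simp [hbump]
  simp only [hint] at hmain
  rw [hsum, Complex.norm_real, Real.norm_eq_abs, sq_abs] at hmain
  set I : ℝ := ∫ ω, (u p ω - ∑ j, w j * u (q j) ω) ^ 2 ∂Q with hI
  have hlow : ((δ ^ α) ^ 2 / 2 * (δ ^ d)⁻¹) ^ 2 ≤
      K * ((δ ^ α) ^ (4 - 2 * H) * (δ ^ β)⁻¹ * (δ ^ d)⁻¹) * I := by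
    refine le_trans ?_ hmain
    have := le_timeTest (t := p.1) hε
    gcongr
  set B : ℝ := (δ ^ α) ^ (4 - 2 * H) * (δ ^ β)⁻¹ * (δ ^ d)⁻¹ with hB
  have hB0 : 0 < B := by positivity
  have hscale : ((δ ^ α) ^ 2 / 2 * (δ ^ d)⁻¹) ^ 2 = B * (γ * r) ^ 2 / 4 := by
    -- The identity of exponents is `α(4 - 2H) - β - d + 2αθ = 4α - 2d`, which is where the value of
    -- `θ₁` comes from.
    have hexp : B * (γ * r) ^ 2 = δ ^ (4 * α - 2 * d) := by
      rw [hB, ← hδθ, ← Real.rpow_natCast δ d, ← Real.rpow_mul hδ.le, ← Real.rpow_neg hδ.le,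
        ← Real.rpow_neg hδ.le, ← Real.rpow_mul_natCast hδ.le, ← Real.rpow_add hδ,
        ← Real.rpow_add hδ, ← Real.rpow_add hδ]
      congr 1
      rw [hθdef, theta₁]
      push_cast
      field_simp
      ring
    have hexp2 : ((δ ^ α) ^ 2 * (δ ^ d)⁻¹) ^ 2 = δ ^ (4 * α - 2 * d) := by
      rw [← Real.rpow_natCast δ d, ← Real.rpow_neg hδ.le, ← Real.rpow_mul_natCast hδ.le,
        ← Real.rpow_add hδ, ← Real.rpow_mul_natCast hδ.le]
      congr 1
      push_cast
      ring
    rw [hexp, ← hexp2]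
    ring
  rw [hscale] at hlow
  have hfin : B * ((γ * r) ^ 2 / 4) ≤ B * (K * I) := by linarith
  have hcancel := le_of_mul_le_mul_left hfin hB0
  rw [div_mul_eq_mul_div, div_le_iff₀ (by positivity)]
  nlinarith

end FractionalColored

end

/-! ### Conclusion: conditional variance and increments -/

theorem mainTheorem5 {d : ℕ} {H α β T₀ : ℝ}
    (hH : 1 / 2 ≤ H) (hH1 : H < 1)
    (hα : 0 < α) (hα2 : α ≤ 2) (hβ : 0 < β) (hβd : β < d)
    -- the symmetric Lévy process, its characteristic exponent and its density
    {Ω' : Type*} [MeasurableSpace Ω'] (P : Measure Ω') [IsProbabilityMeasure P]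
    (X : ℝ≥0 → Ω' → FractionalColored.Space d)
    (hX : FractionalColored.IsSymmetricLevyProcess P X)
    (Ψ : FractionalColored.Space d → ℝ)
    (hΨ : FractionalColored.IsCharacteristicExponent P X Ψ)
    (hp : FractionalColored.HasTransitionDensity P X Ψ)
    (hΨ_bound : ∃ c C : ℝ, 0 < c ∧ 0 < C ∧ ∀ ξ, c * ‖ξ‖ ^ α ≤ Ψ ξ ∧ Ψ ξ ≤ C * ‖ξ‖ ^ α)
    -- the spectral density of the noise
    (h : FractionalColored.Space d → ℝ) (hh : Measurable h)
    (hh_bound : ∃ c C : ℝ, 0 < c ∧ 0 < C ∧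
      ∀ ξ, ξ ≠ 0 → c * ‖ξ‖ ^ (-β) ≤ h ξ ∧ h ξ ≤ C * ‖ξ‖ ^ (-β))
    (hθ₁ : 0 < FractionalColored.theta₁ d H α β)
    (hθ₂ : FractionalColored.theta₂ d H α β < 1)
    -- the noise and the solution
    {Ω : Type*} [MeasurableSpace Ω] (Q : Measure Ω) [IsProbabilityMeasure Q]
    (W : 𝓓(FractionalColored.openSlab d T₀, ℝ) → Ω → ℝ)
    (hW : FractionalColored.IsFractionalColoredNoise Q H T₀ h W)
    (u : ℝ × FractionalColored.Space d → Ω → ℝ)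
    (hu : FractionalColored.IsRandomFieldSolution Q H T₀ h Ψ W u)
    -- the compact rectangle
    {a a' : ℝ} (b b' : Fin d → ℝ) (ha : 0 < a) (ha' : a' ≤ T₀) :
    ∃ c₂ : ℝ, 0 < c₂ ∧
      (∀ n : ℕ, 1 ≤ n → ∀ p ∈ FractionalColored.rectangle a a' b b',
        ∀ q : Fin n → ℝ × FractionalColored.Space d,
        (∀ j, q j ∈ FractionalColored.rectangle a a' b b') →
          ∀ᵐ ω ∂Q,
            c₂ * (⨅ j, FractionalColored.Delta (FractionalColored.theta₁ d H α β)
                (FractionalColored.theta₂ d H α β) p (q j) ^ 2) ≤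
              Var[u p; Q | MeasurableSpace.comap (fun ω' j => u (q j) ω') inferInstance] ω) ∧
      (∀ p ∈ FractionalColored.rectangle a a' b b',
        ∀ q ∈ FractionalColored.rectangle a a' b b',
          √c₂ * FractionalColored.Delta (FractionalColored.theta₁ d H α β)
              (FractionalColored.theta₂ d H α β) p q ≤
            (eLpNorm (fun ω => u p ω - u q ω) 2 Q).toReal) := by
  obtain ⟨c, C, hc, hC, hΨ'⟩ := hΨ_bound
  obtain ⟨ch, Ch, hch, hCh, hh'⟩ := hh_bound
  have hθ₂pos : 0 < FractionalColored.theta₂ d H α β := mul_pos hα hθ₁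
  obtain ⟨R, hR, hΔR⟩ := FractionalColored.exists_Delta_le hθ₁ hθ₂pos a a' b b'
  obtain ⟨c₂, hc₂, hlow⟩ := FractionalColored.exists_le_integral_prediction_error hH hH1 hα hα2 hβ
    hβd hX.measurable hΨ hp hc hC (fun ξ => (hΨ' ξ).1) (fun ξ => (hΨ' ξ).2) hh hch hCh
    (fun ξ hξ => (hh' ξ hξ).1) (fun ξ hξ => (hh' ξ hξ).2) hW hu hθ₁ ha hR
  have hslab : ∀ z ∈ FractionalColored.rectangle a a' b b', z.1 ∈ Set.Icc a T₀ := fun z hz =>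
    ⟨hz.1.1, hz.1.2.trans ha'⟩
  have hslab0 : ∀ z ∈ FractionalColored.rectangle a a' b b', z.1 ∈ Set.Icc 0 T₀ := fun z hz =>
    ⟨ha.le.trans (hslab z hz).1, (hslab z hz).2⟩
  refine ⟨c₂, hc₂, ?_, ?_⟩
  · intro n hn p hpT q hqT
    have hmean : ∀ z ∈ FractionalColored.rectangle a a' b b', ∫ ω, u z ω ∂Q = 0 := by
      intro z hz
      have := (FractionalColored.gaussian_sum_of_wiener hW (ι := Unit) (fun _ => 1)
        fun _ => hu.wiener z.1 (hslab0 z hz) z.2).2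
      simpa using this
    refine FractionalColored.le_condVar_of_gaussian (hu.measurable p.1 (hslab0 p hpT) p.2)
      (fun j => hu.measurable (q j).1 (hslab0 _ (hqT j)) (q j).2) ?_ (hmean p hpT)
      (fun j => hmean _ (hqT j)) ?_
    · intro s w
      have hG := (FractionalColored.gaussian_sum_of_wiener hW (ι := Option (Fin n))
        (fun i => i.elim s w) (g := fun i => FractionalColored.greenKernel Ψ
          (i.elim p q).1 (i.elim p q).2) (Y := fun i => u (i.elim p q)) (by
          rintro (_ | j)
          · exact hu.wiener p.1 (hslab0 p hpT) p.2
          · exact hu.wiener (q j).1 (hslab0 _ (hqT j)) (q j).2)).1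
      simpa [Fintype.sum_option] using hG
    · intro w
      have : Nonempty (Fin n) := ⟨⟨0, hn⟩⟩
      -- The prediction bound is applied with `r = √m`. As `n ≥ 1`, the infimum is over a nonempty
      -- family, so `r` is at most the `Δ`-diameter bound `R`.
      set m : ℝ := ⨅ j, FractionalColored.Delta (FractionalColored.theta₁ d H α β)
        (FractionalColored.theta₂ d H α β) p (q j) ^ 2 with hm
      have hm0 : 0 ≤ m := Real.iInf_nonneg fun j => by positivity
      have hle : ∀ j, √m ≤ FractionalColored.Delta (FractionalColored.theta₁ d H α β)
          (FractionalColored.theta₂ d H α β) p (q j) := fun j =>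
        Real.sqrt_le_iff.2 ⟨FractionalColored.Delta_nonneg _ _ _ _,
          ciInf_le (Set.finite_range _).bddBelow j⟩
      have := hlow n p q w (√m) (hslab p hpT) (fun j => hslab0 _ (hqT j)) (Real.sqrt_nonneg _)
        ((hle ⟨0, hn⟩).trans (hΔR p hpT _ (hqT _))) hle
      rwa [Real.sq_sqrt hm0] at this
  · intro p hpT q hqT
    -- With a single observation of weight `1`, the prediction error is the increment itself.
    have h1 := hlow 1 p (fun _ => q) (fun _ => 1) _ (hslab p hpT) (fun _ => hslab0 q hqT)
      (FractionalColored.Delta_nonneg _ _ p q) (hΔR p hpT q hqT) fun _ => le_rfl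
    have hmem : MemLp (fun ω => u p ω - u q ω) 2 Q :=
      (hu.wiener p.1 (hslab0 p hpT) p.2).1.sub (hu.wiener q.1 (hslab0 q hqT) q.2).1
    refine abs_le_of_sq_le_sq' ?_ ENNReal.toReal_nonneg |>.2
    rw [FractionalColored.sq_toReal_eLpNorm_two hmem, mul_pow, Real.sq_sqrt hc₂.le]
    simpa using h1
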